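/- **Setting.** Let $I$ be a finite index set, $(a_{ij})_{i,j\in I}$ a symmetrizable generalized Cartan matrix, with integers $d_i>0$ such that $d_ia_{ij}=d_ja_{ji}$. Let $P$ be a free abelian group of finite rank (the weight lattice), with linearly independent simple roots $\alpha_i\in P$ and simple coroots $h_i\in \mathrm{Hom}_{\mathbb Z}(P,\mathbb Z)$ such that $\langle h_i,\alpha_j\rangle=a_{ij}$ and such that for each $i$ there is $\varpi_i\in P$ with $\langle h_j,\varpi_i\rangle=\delta_{ij}$. Put $(\alpha_i|\alpha_j)=d_ia_{ij}$, $Q^+=\sum_i\mathbb Z_{\ge0}\alpha_i$, and $P^+=\{\Lambda\in P:\langle h_i,\Lambda\rangle\ge0\ \forall i\}$. For $\beta=\sum_i m_i\alpha_i\in Q^+$ let $|\beta|=\sum_i m_i$ and $I^\beta=\{\nu\in I^{|\beta|}:\alpha_{\nu_1}+\dots+\alpha_{\nu_{|\beta|}}=\beta\}$. Let $\mathbf k=\bigoplus_{n\ge0}\mathbf k_n$ be a graded commutative ring. For $i,j\in I$ let $Q_{ij}(u,v)=\sum_{p,q}t_{i,j;p,q}u^pv^q\in\mathbf k[u,v]$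 be polynomials with $Q_{ii}=0$, $Q_{ij}(u,v)=Q_{ji}(v,u)$ and, for $i\ne j$, $t_{i,j;p,q}\in\mathbf k_{-2(\alpha_i|\alpha_j)-(\alpha_i|\alpha_i)p-(\alpha_j|\alpha_j)q}$ and $t_{i,j;-a_{ij},0}\in\mathbf k_0^\times$. The Khovanov–Lauda–Rouquier algebra $R(n)$ is the $\mathbf k$-algebra generated by $e(\nu)$ ($\nu\in I^n$), $x_k$ ($1\le k\le n$), $\tau_l$ ($1\le l<n$) with the relations - $e(\nu)e(\nu')=\delta_{\nu\nu'}e(\nu)$, $\sum_\nu e(\nu)=1$, $x_kx_l=x_lx_k$, $x_ke(\nu)=e(\nu)x_k$; - $\tau_le(\nu)=e(s_l\nu)\tau_l$, and $\tau_k\tau_l=\tau_l\tau_k$ if $|k-l|>1$; - $\tau_l^2e(\nu)=Q_{\nu_l,\nu_{l+1}}(x_l,x_{l+1})e(\nu)$; - $(\tau_lx_k-x_{s_l(k)}\tau_l)e(\nu)$ equals $-e(\nu)$ if $k=l$ and $\nu_l=\nu_{l+1}$, equals $e(\nu)$ if $k=l+1$ and $\nu_l=\nu_{l+1}$, and is $0$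 otherwise; - $(\tau_{l+1}\tau_l\tau_{l+1}-\tau_l\tau_{l+1}\tau_l)e(\nu)$ equals $\dfrac{Q_{\nu_l,\nu_{l+1}}(x_l,x_{l+1})-Q_{\nu_l,\nu_{l+1}}(x_{l+2},x_{l+1})}{x_l-x_{l+2}}\,e(\nu)$ if $\nu_l=\nu_{l+2}$, and is $0$ otherwise. It is $\mathbb Z$-graded by $\deg e(\nu)=0$, $\deg x_ke(\nu)=(\alpha_{\nu_k}|\alpha_{\nu_k})$, $\deg\tau_le(\nu)=-(\alpha_{\nu_l}|\alpha_{\nu_{l+1}})$ and the grading of $\mathbf k$. For $\beta\in Q^+$ with $|\beta|=n$ put $e(\beta)=\sum_{\nu\in I^\beta}e(\nu)$, a central idempotent, and $R(\beta)=R(n)e(\beta)$. Let $e(\beta,i)\in R(\beta+\alpha_i)$ be the sum of the $e(\nu)$ with $\nu\in I^{\beta+\alpha_i}$ and last letter $\nu_{|\beta|+1}=i$. Fix $\Lambda\in P^+$ and monic polynomials $a_i^\Lambda(u)=\sum_{k=0}^{\langle h_i,\Lambda\rangle}c_{i;k}u^{\langle h_i,\Lambda\rangle-k}$ with $c_{i;0}=1$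 and $c_{i;k}\in\mathbf k_{k(\alpha_i|\alpha_i)}$. The cyclotomic quotient is $R^\Lambda(\beta)=R(\beta)/R(\beta)\,x[1]\,R(\beta)$, where $x[1]=\sum_{\nu\in I^\beta}a_{\nu_1}^\Lambda(x_1)e(\nu)$ for $\beta\neq0$ (and $x[1]=0$ for $\beta=0$); we put $R^\Lambda(\gamma)=0$ for $\gamma\in P\setminus Q^+$. Let $\mathrm{Mod}(R^\Lambda(\beta))$ be the category of $\mathbb Z$-graded left $R^\Lambda(\beta)$-modules and homomorphisms of degree $0$, and let $q$ be the shift functor $(qM)_k=M_{k-1}$. Define $$E_i^\Lambda:\mathrm{Mod}(R^\Lambda(\beta+\alpha_i))\to\mathrm{Mod}(R^\Lambda(\beta)),\quad N\mapsto e(\beta,i)N,$$ $$F_i^\Lambda:\mathrm{Mod}(R^\Lambda(\beta))\to\mathrm{Mod}(R^\Lambda(\beta+\alpha_i)),\quad M\mapsto R^\Lambda(\beta+\alpha_i)e(\beta,i)\otimes_{R^\Lambda(\beta)}M,$$ where $R^\Lambda(\beta)$ acts through the map $R^\Lambda(\beta)\to e(\beta,i)R^\Lambda(\beta+\alpha_i)e(\beta,i)$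 induced by $e(\nu)\mapsto e(\nu,i)$ (the word $\nu$ followed by $i$), $x_k\mapsto x_ke(\beta,i)$, $\tau_l\mapsto\tau_le(\beta,i)$. **Theorem.** Let $i,j\in I$ with $i\ne j$ and let $0\ne\beta\in Q^+$. There is a natural isomorphism $$q^{-(\alpha_i|\alpha_j)}\,F_j^\Lambda E_i^\Lambda\;\cong\;E_i^\Lambda F_j^\Lambda$$ of functors $\mathrm{Mod}(R^\Lambda(\beta))\to\mathrm{Mod}(R^\Lambda(\beta-\alpha_i+\alpha_j))$. (On the left $E_i^\Lambda$ goes to $\mathrm{Mod}(R^\Lambda(\beta-\alpha_i))$; if $\beta-\alpha_i\notin Q^+$, both functors are zero.) -/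

import Mathlib

open scoped TensorProduct DirectSum
open CategoryTheory

universe u v w

/-! ### Gradings: criteria used below -/

section Gradings

variable {M : Type*} [AddCommGroup M]

/-- The coaction `m ↦ ∑ m_d t^d` attached to a grading `M = ⨁ M_d`. -/
noncomputable def gradingCoaction {ℳ : ℤ → AddSubgroup M} (h : DirectSum.IsInternal ℳ) :
    M →+ (ℤ →₀ M) :=
  (DirectSum.toAddMonoid fun d => (Finsupp.singleAddHom d).comp (ℳ d).subtype).comp
    (AddEquiv.ofBijective (DirectSum.coeAddMonoidHom ℳ) (show Function.Bijective _ from h)).symm.toAddMonoidHom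

theorem gradingCoaction_of_mem {ℳ : ℤ → AddSubgroup M} (h : DirectSum.IsInternal ℳ)
    {d : ℤ} {m : M} (hm : m ∈ ℳ d) : gradingCoaction h m = Finsupp.single d m := by
  have : (AddEquiv.ofBijective (DirectSum.coeAddMonoidHom ℳ)
      (show Function.Bijective _ from h)).symm m = DirectSum.of (fun d => ℳ d) d ⟨m, hm⟩ := by
    rw [AddEquiv.symm_apply_eq]
    exact (DirectSum.coeAddMonoidHom_of ℳ d ⟨m, hm⟩).symm
  simp [gradingCoaction, this]

theorem mem_iSup_of_isInternal {ℳ : ℤ → AddSubgroup M} (h : DirectSum.IsInternal ℳ) (m : M) :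
    m ∈ ⨆ d, ℳ d := by
  obtain ⟨x, rfl⟩ := h.2 m
  induction x using DirectSum.induction_on with
  | zero => simp
  | of d x => simpa using AddSubgroup.mem_iSup_of_mem d x.2
  | add x y hx hy => simpa using add_mem hx hy

theorem grading_induction {ℳ : ℤ → AddSubgroup M} (h : DirectSum.IsInternal ℳ) {p : M → Prop}
    (hom : ∀ d, ∀ m ∈ ℳ d, p m) (zero : p 0) (add : ∀ x y, p x → p y → p (x + y)) (m : M) :
    p m :=
  AddSubgroup.iSup_induction ℳ (C := p) (mem_iSup_of_isInternal h m) hom zero add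

theorem isInternal_of_coaction (ℳ : ℤ → AddSubgroup M) (δ : M →+ (ℤ →₀ M))
    (hδ : ∀ d, ∀ m ∈ ℳ d, δ m = Finsupp.single d m) (hspan : ∀ m, m ∈ ⨆ d, ℳ d) :
    DirectSum.IsInternal ℳ := by
  have key : ∀ x : ⨁ d, ℳ d, ∀ d, δ (DirectSum.coeAddMonoidHom ℳ x) d = (x d : M) := by
    intro x d
    induction x using DirectSum.induction_on with
    | zero => simp
    | of e x =>
      rw [DirectSum.coeAddMonoidHom_of, hδ e x x.2, DirectSum.coe_of_apply, Finsupp.single_apply]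
      split_ifs <;> simp
    | add x y hx hy => simp [hx, hy]
  refine ⟨(injective_iff_map_eq_zero _).2 fun x hx => ?_, fun m => ?_⟩
  · ext d
    rw [← key x d, hx]; simp
  · refine AddSubgroup.iSup_induction ℳ (C := fun m => ∃ x, DirectSum.coeAddMonoidHom ℳ x = m)
      (hspan m) (fun d x hx => ⟨DirectSum.of (fun d => ℳ d) d ⟨x, hx⟩, by simp⟩) ⟨0, by simp⟩ ?_
    rintro _ _ ⟨x, rfl⟩ ⟨y, rfl⟩
    exact ⟨x + y, by simp⟩

theorem coaction_mem {ℳ : ℤ → AddSubgroup M} (h : DirectSum.IsInternal ℳ) (m : M) (d : ℤ) :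
    gradingCoaction h m d ∈ ℳ d := by
  refine grading_induction h (p := fun m => gradingCoaction h m d ∈ ℳ d) (fun e m hm => ?_) ?_ ?_ m
  · rw [gradingCoaction_of_mem h hm, Finsupp.single_apply]
    split_ifs with h'
    · exact h' ▸ hm
    · exact zero_mem _
  · simp
  · intro x y hx hy; simpa using add_mem hx hy

theorem coaction_sum {ℳ : ℤ → AddSubgroup M} (h : DirectSum.IsInternal ℳ) (m : M) :
    ((gradingCoaction h m).sum fun _ x => x) = m := by
  refine grading_induction h (p := fun m => ((gradingCoaction h m).sum fun _ x => x) = m)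
    (fun e m hm => ?_) ?_ ?_ m
  · rw [gradingCoaction_of_mem h hm, Finsupp.sum_single_index rfl]
  · simp
  · intro x y hx hy; rw [map_add, Finsupp.sum_add_index' (by simp) (by simp), hx, hy]

/-- A subgroup that contains the homogeneous components of its elements inherits the grading. -/
theorem isInternal_comap {ℳ : ℤ → AddSubgroup M} (h : DirectSum.IsInternal ℳ)
    {N : Type*} [AddCommGroup N] (j : N →+ M) (hj : Function.Injective j)
    (hN : ∀ n d, gradingCoaction h (j n) d ∈ j.range) :
    DirectSum.IsInternal fun d => (ℳ d).comap j := by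
  choose p hp using hN
  have p0 : ∀ n, p n = fun d => p n d := fun n => rfl
  have hfin : ∀ n, (Function.support (p n)).Finite := fun n =>
    (gradingCoaction h (j n)).hasFiniteSupport.subset fun d hd => by
      simp only [Function.mem_support, ne_eq] at hd ⊢
      intro h0
      exact hd (hj (by rw [hp, h0, map_zero]))
  let δ : N →+ (ℤ →₀ N) :=
    AddMonoidHom.mk' (fun n => Finsupp.ofSupportFinite (p n) (hfin n)) fun a b => by
      ext d
      apply hj
      change j (p (a + b) d) = j (p a d + p b d)
      simp [hp]
  have hδ : ∀ n d, j (δ n d) = gradingCoaction h (j n) d := fun n d => hp n d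
  refine isInternal_of_coaction _ δ (fun d n hn => ?_) fun n => ?_
  · ext e
    apply hj
    rw [hδ, gradingCoaction_of_mem h hn, Finsupp.single_apply, Finsupp.single_apply]
    split_ifs <;> simp
  · have : n = (δ n).sum fun _ x => x := by
      apply hj
      rw [← coaction_sum h (j n), Finsupp.sum, Finsupp.sum, map_sum]
      have hs : (δ n).support = (gradingCoaction h (j n)).support := by
        ext d
        rw [Finsupp.mem_support_iff, Finsupp.mem_support_iff, ← hδ]
        simp [map_eq_zero_iff j hj]
      rw [hs]
      exact Finset.sum_congr rfl fun d _ => (hδ n d).symm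
    rw [this]
    refine sum_mem fun d _ => AddSubgroup.mem_iSup_of_mem d ?_
    rw [AddSubgroup.mem_comap, hδ]
    exact coaction_mem h _ _

/-- A quotient by a subgroup stable under taking homogeneous components inherits the grading. -/
theorem isInternal_map {ℳ : ℤ → AddSubgroup M} (h : DirectSum.IsInternal ℳ)
    {N : Type*} [AddCommGroup N] (π : M →+ N) (hπ : Function.Surjective π)
    (hN : ∀ m, π m = 0 → ∀ d, π (gradingCoaction h m d) = 0) :
    DirectSum.IsInternal fun d => (ℳ d).map π := by
  let δ₀ : M →+ (ℤ →₀ N) := (Finsupp.mapRange.addMonoidHom π).comp (gradingCoaction h)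
  have hker : π.ker ≤ δ₀.ker := fun m hm => by
    rw [AddMonoidHom.mem_ker] at hm ⊢
    ext d
    simpa [δ₀] using hN m hm d
  let δ : N →+ (ℤ →₀ N) := π.liftOfSurjective hπ ⟨δ₀, hker⟩
  have hδ : ∀ m, δ (π m) = δ₀ m := fun m => by
    exact AddMonoidHom.liftOfRightInverse_comp_apply π _ (Function.rightInverse_surjInv hπ) ⟨δ₀, hker⟩ m
  refine isInternal_of_coaction _ δ ?_ fun n => ?_
  · rintro d _ ⟨m, hm, rfl⟩
    rw [hδ]
    simp [δ₀, gradingCoaction_of_mem h hm]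
  · obtain ⟨m, rfl⟩ := hπ n
    refine grading_induction h (p := fun m => π m ∈ _) (fun d m hm => ?_) ?_ ?_ m
    · exact AddSubgroup.mem_iSup_of_mem d ⟨m, hm, rfl⟩
    · simp
    · intro x y hx hy; rw [map_add]; exact add_mem hx hy

end Gradings

section GradedRings

variable {A : Type*} [Ring A] {𝒜 : ℤ → AddSubgroup A}

/-- For a graded ring `A` and a ring homomorphism `f : A → B`, the ring homomorphism
`A → B[t, t⁻¹]`, `a ↦ ∑ f (a_d) t^d`. -/
noncomputable def laurentHom (𝒜 : ℤ → AddSubgroup A) [GradedRing 𝒜] {B : Type*} [Ring B]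
    (f : A →+* B) : A →+* AddMonoidAlgebra B ℤ :=
  (DirectSum.toSemiring (fun d => ((AddMonoidAlgebra.singleAddHom d).comp
    f.toAddMonoidHom).comp (𝒜 d).subtype)
    (by
      change AddMonoidAlgebra.single 0 (f 1) = 1
      rw [map_one, AddMonoidAlgebra.one_def])
    (by
      intro i j a b
      change AddMonoidAlgebra.single (i + j) (f (a * b)) =
        AddMonoidAlgebra.single i (f a) * AddMonoidAlgebra.single j (f b)
      rw [AddMonoidAlgebra.single_mul_single, map_mul])).comp
    (DirectSum.decomposeRingEquiv 𝒜).toRingHom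

theorem laurentHom_of_mem [GradedRing 𝒜] {B : Type*} [Ring B] (f : A →+* B) {d : ℤ} {a : A}
    (ha : a ∈ 𝒜 d) : laurentHom 𝒜 f a = AddMonoidAlgebra.single d (f a) := by
  have : DirectSum.decomposeRingEquiv 𝒜 a = DirectSum.of (fun d => 𝒜 d) d ⟨a, ha⟩ :=
    DirectSum.decompose_of_mem 𝒜 ha
  change DirectSum.toAddMonoid _ (DirectSum.decomposeRingEquiv 𝒜 a) = _
  rw [this, DirectSum.toAddMonoid_of]
  rfl

theorem gradedRing_isInternal [GradedRing 𝒜] : DirectSum.IsInternal 𝒜 :=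
  DirectSum.Decomposition.isInternal 𝒜

theorem gradingCoaction_mul [GradedRing 𝒜] (a b : A) :
    AddMonoidAlgebra.ofCoeff (gradingCoaction (gradedRing_isInternal (𝒜 := 𝒜)) (a * b)) =
      AddMonoidAlgebra.ofCoeff (gradingCoaction (gradedRing_isInternal (𝒜 := 𝒜)) a) *
      AddMonoidAlgebra.ofCoeff (gradingCoaction (gradedRing_isInternal (𝒜 := 𝒜)) b) := by
  have : ∀ a, AddMonoidAlgebra.ofCoeff (gradingCoaction (gradedRing_isInternal (𝒜 := 𝒜)) a) =
      laurentHom 𝒜 (RingHom.id A) a := by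
    intro a
    refine grading_induction (p := fun a => AddMonoidAlgebra.ofCoeff
      (gradingCoaction (gradedRing_isInternal (𝒜 := 𝒜)) a) = laurentHom 𝒜 (RingHom.id A) a)
      (gradedRing_isInternal (𝒜 := 𝒜)) (fun d a ha => ?_) ?_ ?_ a
    · rw [gradingCoaction_of_mem _ ha, laurentHom_of_mem _ ha]; rfl
    · simp
    · intro x y hx hy; rw [map_add, map_add, ← hx, ← hy]; rfl
  rw [this, this, this, map_mul]

end GradedRings

theorem coaction_map {M : Type*} [AddCommGroup M] {ℳ : ℤ → AddSubgroup M}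
    (h : DirectSum.IsInternal ℳ) (f : M →+ M) (hf : ∀ d, ∀ m ∈ ℳ d, f m ∈ ℳ d) (m : M) (d : ℤ) :
    gradingCoaction h (f m) d = f (gradingCoaction h m d) := by
  refine grading_induction (p := fun m => gradingCoaction h (f m) d = f (gradingCoaction h m d)) h
    (fun e m hm => ?_) ?_ ?_ m
  · rw [gradingCoaction_of_mem h hm, gradingCoaction_of_mem h (hf e m hm), Finsupp.single_apply,
      Finsupp.single_apply]
    split_ifs <;> simp
  · simp
  · intro x y hx hy; simp [hx, hy]

/-! ### Graded modules -/

/-- A `ℤ`-graded left module over a ring `A` with grading `A = ⨁ A_d`. -/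
structure GrMod {A : Type w} [Ring A] (𝒜 : ℤ → AddSubgroup A) where
  carrier : Type w
  [addCommGroup : AddCommGroup carrier]
  [module : Module A carrier]
  gr : ℤ → AddSubgroup carrier
  internal : DirectSum.IsInternal gr
  smul_mem : ∀ {a b : ℤ} {r : A} {m : carrier}, r ∈ 𝒜 a → m ∈ gr b → r • m ∈ gr (a + b)

namespace GrMod

variable {A : Type w} [Ring A] {𝒜 : ℤ → AddSubgroup A} {B : Type w} [Ring B]
  {ℬ : ℤ → AddSubgroup B}

attribute [instance] GrMod.addCommGroup GrMod.module

/-- Morphisms of graded modules: module homomorphisms preserving degrees. -/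
@[ext]
structure Hom (M N : GrMod 𝒜) where
  lin : M.carrier →ₗ[A] N.carrier
  map_mem : ∀ (d : ℤ) (m : M.carrier), m ∈ M.gr d → lin m ∈ N.gr d

/-- The category `Mod(A)` of `ℤ`-graded `A`-modules. -/
instance : Category (GrMod 𝒜) where
  Hom := Hom
  id M := ⟨LinearMap.id, fun _ _ h => h⟩
  comp f g := ⟨g.lin ∘ₗ f.lin, fun d m h => g.map_mem d _ (f.map_mem d m h)⟩

@[ext]
theorem hom_ext {M N : GrMod 𝒜} {f g : M ⟶ N} (h : ∀ m, f.lin m = g.lin m) : f = g :=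
  Hom.ext (LinearMap.ext h)

@[simp] theorem id_lin (M : GrMod 𝒜) : Hom.lin (𝟙 M) = LinearMap.id := rfl

@[simp] theorem comp_lin {M N P : GrMod 𝒜} (f : M ⟶ N) (g : N ⟶ P) :
    (f ≫ g).lin = g.lin ∘ₗ f.lin := rfl

theorem shift_internal (a : ℤ) {M : Type*} [AddCommGroup M] {ℳ : ℤ → AddSubgroup M}
    (h : DirectSum.IsInternal ℳ) : DirectSum.IsInternal fun d => ℳ (d - a) := by
  refine isInternal_of_coaction _ ((Finsupp.mapDomain.addMonoidHom (· + a)).comp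
    (gradingCoaction h)) (fun d m hm => ?_) fun m => ?_
  · simp [gradingCoaction_of_mem h hm]
  · refine grading_induction (p := fun m => m ∈ _) h (fun d m hm => ?_) (zero_mem _)
      (fun x y hx hy => add_mem hx hy) m
    exact AddSubgroup.mem_iSup_of_mem (d + a) (by simpa using hm)

/-- The grading shift `q^a`: `(q^a M)_d = M_{d - a}`. -/
def shift (𝒜 : ℤ → AddSubgroup A) (a : ℤ) : GrMod 𝒜 ⥤ GrMod 𝒜 where
  obj M :=
    { carrier := M.carrier
      gr := fun d => M.gr (d - a)
      internal := shift_internal a M.internal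
      smul_mem := fun hr hm => by rw [add_sub_assoc]; exact M.smul_mem hr hm }
  map f := ⟨f.lin, fun d m h => f.map_mem (d - a) m h⟩

/-- A degree-preserving ring homomorphism `φ : A → B` which need not send `1` to `1`; thus `φ 1` is
an idempotent of `B`. -/
structure CornerHom (𝒜 : ℤ → AddSubgroup A) (ℬ : ℤ → AddSubgroup B) where
  toHom : A →ₙ+* B
  map_mem : ∀ (d : ℤ) (a : A), a ∈ 𝒜 d → toHom a ∈ ℬ d

namespace CornerHom

variable (φ : CornerHom 𝒜 ℬ)

/-- The idempotent `e = φ 1`. -/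
def idem : B := φ.toHom 1

theorem toHom_mul_idem (a : A) : φ.toHom a * φ.idem = φ.toHom a := by
  rw [idem, ← map_mul, mul_one]

theorem idem_mul_toHom (a : A) : φ.idem * φ.toHom a = φ.toHom a := by
  rw [idem, ← map_mul, one_mul]

theorem idem_mem [GradedRing 𝒜] : φ.idem ∈ ℬ 0 := φ.map_mem 0 1 (SetLike.GradedOne.one_mem)

/-! #### Truncation `N ↦ e N` -/

/-- The subgroup `e N = {n | e n = n}`. -/
def truncSubgroup (N : Type*) [AddCommGroup N] [Module B N] : AddSubgroup N where
  carrier := {n | φ.idem • n = n}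
  zero_mem' := smul_zero _
  add_mem' := fun {a b} ha hb => by
    simp only [Set.mem_ofPred_eq] at ha hb ⊢
    rw [smul_add, ha, hb]
  neg_mem' := fun {a} ha => by
    simp only [Set.mem_ofPred_eq] at ha ⊢
    rw [smul_neg, ha]

variable {φ} in
theorem mem_truncSubgroup {N : Type*} [AddCommGroup N] [Module B N] {n : N} :
    n ∈ φ.truncSubgroup N ↔ φ.idem • n = n := Iff.rfl

/-- `A` acts on `e N` through `φ`. -/
instance truncModule (N : Type*) [AddCommGroup N] [Module B N] :
    Module A (φ.truncSubgroup N) where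
  smul a n := ⟨φ.toHom a • n.1, by rw [mem_truncSubgroup, ← mul_smul, φ.idem_mul_toHom]⟩
  one_smul n := Subtype.ext n.2
  mul_smul a b n := Subtype.ext (by
    change φ.toHom (a * b) • n.1 = φ.toHom a • φ.toHom b • n.1
    rw [map_mul, mul_smul])
  smul_zero a := Subtype.ext (smul_zero (φ.toHom a))
  smul_add a m n := Subtype.ext (smul_add (φ.toHom a) m.1 n.1)
  add_smul a b n := Subtype.ext (by
    change φ.toHom (a + b) • n.1 = φ.toHom a • n.1 + φ.toHom b • n.1
    rw [map_add, add_smul])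
  zero_smul n := Subtype.ext (by
    change φ.toHom 0 • n.1 = 0
    rw [map_zero, zero_smul])

@[simp] theorem coe_trunc_smul {N : Type*} [AddCommGroup N] [Module B N] (a : A)
    (n : φ.truncSubgroup N) : ((a • n : φ.truncSubgroup N) : N) = φ.toHom a • (n : N) := rfl

theorem trunc_internal [GradedRing 𝒜] (N : GrMod ℬ) : DirectSum.IsInternal fun d =>
    (N.gr d).comap (φ.truncSubgroup N.carrier).subtype := by
  refine isInternal_comap N.internal _ Subtype.val_injective fun n d => ?_
  refine ⟨⟨_, ?_⟩, rfl⟩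
  have h := coaction_map N.internal (DistribSMul.toAddMonoidHom N.carrier φ.idem)
    (fun e m hm => by simpa using N.smul_mem φ.idem_mem hm) n.1 d
  rw [mem_truncSubgroup]
  refine h.symm.trans ?_
  congr 2
  exact n.2

/-- The functor `N ↦ e N` from graded `B`-modules to graded `A`-modules. -/
def trunc [GradedRing 𝒜] : GrMod ℬ ⥤ GrMod 𝒜 where
  obj N :=
    { carrier := φ.truncSubgroup N.carrier
      gr := fun d => (N.gr d).comap (φ.truncSubgroup N.carrier).subtype
      internal := φ.trunc_internal N
      smul_mem := fun {a b r m} hr hm => N.smul_mem (φ.map_mem a r hr) hm }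
  map {N N'} f :=
    { lin :=
        { toFun := fun n => ⟨f.lin n.1, by rw [mem_truncSubgroup, ← map_smul, n.2]⟩
          map_add' := fun x y => Subtype.ext (map_add f.lin x.1 y.1)
          map_smul' := fun a x => Subtype.ext (map_smul f.lin (φ.toHom a) x.1) }
      map_mem := fun d n hn => f.map_mem d n.1 hn }

/-! #### Induction `M ↦ B e ⊗_A M` -/

/-- The left ideal `B e = {b | b e = b}`; it is a right `A`-module through `φ`. -/
def leftIdeal : Submodule B B where
  carrier := {b | b * φ.idem = b}
  zero_mem' := zero_mul _
  add_mem' := fun {a b} ha hb => by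
    simp only [Set.mem_ofPred_eq] at ha hb ⊢
    rw [add_mul, ha, hb]
  smul_mem' := fun c b hb => by
    simp only [Set.mem_ofPred_eq, smul_eq_mul] at hb ⊢
    rw [mul_assoc, hb]

variable {φ} in
theorem mem_leftIdeal {b : B} : b ∈ φ.leftIdeal ↔ b * φ.idem = b := Iff.rfl

/-- The right action of `A` on `B e`: `k · a = k φ(a)`. -/
def rightMul (k : φ.leftIdeal) (a : A) : φ.leftIdeal :=
  ⟨k.1 * φ.toHom a, by rw [mem_leftIdeal, mul_assoc, φ.toHom_mul_idem]⟩

/-- The relations `k a ⊗ m = k ⊗ a m` defining `B e ⊗_A M` as a quotient of `B e ⊗_ℤ M`. -/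
def balancing (M : Type*) [AddCommGroup M] [Module A M] :
    Submodule B (φ.leftIdeal ⊗[ℤ] M) :=
  Submodule.span B {z | ∃ (k : φ.leftIdeal) (a : A) (m : M),
    z = φ.rightMul k a ⊗ₜ[ℤ] m - k ⊗ₜ[ℤ] (a • m)}

/-- The tensor product `B e ⊗_A M`, a left `B`-module. -/
abbrev Tens (M : Type*) [AddCommGroup M] [Module A M] : Type _ :=
  (φ.leftIdeal ⊗[ℤ] M) ⧸ φ.balancing M

/-- The pure tensor `k ⊗ m` in `B e ⊗_A M`. -/
def tmk {M : Type*} [AddCommGroup M] [Module A M] (k : φ.leftIdeal) (m : M) : φ.Tens M :=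
  (φ.balancing M).mkQ (k ⊗ₜ[ℤ] m)

/-- The degree `d` part of `B e ⊗_A M` is generated by the `k ⊗ m` with
`deg k + deg m = d`. -/
def tensGr {M : Type*} [AddCommGroup M] [Module A M] (ℳ : ℤ → AddSubgroup M) (d : ℤ) :
    AddSubgroup (φ.Tens M) :=
  AddSubgroup.closure {z | ∃ (a b : ℤ) (k : φ.leftIdeal) (m : M),
    a + b = d ∧ k.1 ∈ ℬ a ∧ m ∈ ℳ b ∧ z = φ.tmk k m}

theorem leftIdeal_internal [GradedRing 𝒜] [GradedRing ℬ] : DirectSum.IsInternal fun d =>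
    (ℬ d).comap φ.leftIdeal.subtype.toAddMonoidHom := by
  refine isInternal_comap (gradedRing_isInternal (𝒜 := ℬ)) φ.leftIdeal.subtype.toAddMonoidHom
    Subtype.val_injective fun k d => ?_
  refine ⟨⟨_, ?_⟩, rfl⟩
  have h := coaction_map (gradedRing_isInternal (𝒜 := ℬ)) (AddMonoidHom.mulRight φ.idem)
    (fun e m hm => by simpa using SetLike.mul_mem_graded hm φ.idem_mem) k.1 d
  rw [mem_leftIdeal]
  refine h.symm.trans ?_
  congr 2
  exact k.2

theorem tens_internal [GradedRing 𝒜] [GradedRing ℬ] (M : GrMod 𝒜) :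
    DirectSum.IsInternal (φ.tensGr M.gr) := by
  classical
  let hK := φ.leftIdeal_internal
  let δ₁ : φ.leftIdeal ⊗[ℤ] M.carrier →+ (ℤ →₀ φ.leftIdeal ⊗[ℤ] M.carrier) :=
    (Finsupp.mapDomain.addMonoidHom (fun p : ℤ × ℤ => p.1 + p.2)).comp
      ((finsuppTensorFinsupp ℤ ℤ φ.leftIdeal M.carrier ℤ ℤ).toAddEquiv.toAddMonoidHom.comp
        (TensorProduct.map (gradingCoaction hK).toIntLinearMap
          (gradingCoaction M.internal).toIntLinearMap).toAddMonoidHom)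
  have hδ₁ : ∀ (a b : ℤ) (k : φ.leftIdeal) (m : M.carrier), k.1 ∈ ℬ a → m ∈ M.gr b →
      δ₁ (k ⊗ₜ m) = Finsupp.single (a + b) (k ⊗ₜ m) := by
    intro a b k m hk hm
    have h1 : gradingCoaction hK k = Finsupp.single a k := gradingCoaction_of_mem hK hk
    simp [δ₁, h1, gradingCoaction_of_mem M.internal hm]
  let π : φ.leftIdeal ⊗[ℤ] M.carrier →+ φ.Tens M.carrier := (φ.balancing M.carrier).mkQ.toAddMonoidHom
  have hπ : Function.Surjective π := (φ.balancing M.carrier).mkQ_surjective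
  let δ₀ : φ.leftIdeal ⊗[ℤ] M.carrier →+ (ℤ →₀ φ.Tens M.carrier) :=
    (Finsupp.mapRange.addMonoidHom π).comp δ₁
  have hδ₀ : ∀ (a b : ℤ) (k : φ.leftIdeal) (m : M.carrier), k.1 ∈ ℬ a → m ∈ M.gr b →
      δ₀ (k ⊗ₜ m) = Finsupp.single (a + b) (φ.tmk k m) := by
    intro a b k m hk hm
    simp only [δ₀, AddMonoidHom.comp_apply, hδ₁ a b k m hk hm]
    simp [π, tmk]
  have hrel : ∀ (k : φ.leftIdeal) (a : A) (m : M.carrier),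
      φ.tmk (φ.rightMul k a) m = φ.tmk k (a • m) := by
    intro k a m
    rw [← sub_eq_zero, tmk, tmk, ← map_sub]
    exact (Submodule.Quotient.mk_eq_zero _).2 (Submodule.subset_span ⟨k, a, m, rfl⟩)
  have hbal : ∀ (k : φ.leftIdeal) (a : A) (m : M.carrier),
      δ₀ (φ.rightMul k a ⊗ₜ m) = δ₀ (k ⊗ₜ (a • m)) := by
    intro k a m
    refine grading_induction (p := fun k => δ₀ (φ.rightMul k a ⊗ₜ m) = δ₀ (k ⊗ₜ (a • m))) hK
      (fun d k hk => ?_) ?_ ?_ k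
    · refine grading_induction (p := fun a => δ₀ (φ.rightMul k a ⊗ₜ m) = δ₀ (k ⊗ₜ (a • m)))
        (gradedRing_isInternal (𝒜 := 𝒜)) (fun e a ha => ?_) ?_ ?_ a
      · refine grading_induction (p := fun m => δ₀ (φ.rightMul k a ⊗ₜ m) = δ₀ (k ⊗ₜ (a • m)))
          M.internal (fun f m hm => ?_) ?_ ?_ m
        · rw [hδ₀ (d + e) f _ m (SetLike.mul_mem_graded (A := ℬ) (show k.1 ∈ ℬ d from hk) (φ.map_mem e a ha)) hm,
            hδ₀ d (e + f) k _ hk (M.smul_mem ha hm), hrel, add_assoc]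
        · simp
        · intro x y hx hy
          simp only [TensorProduct.tmul_add, smul_add, map_add, hx, hy]
      · have : φ.rightMul k 0 = 0 := Subtype.ext (by simp [rightMul])
        simp [this]
      · intro x y hx hy
        have : φ.rightMul k (x + y) = φ.rightMul k x + φ.rightMul k y :=
          Subtype.ext (by simp [rightMul, mul_add])
        simp only [this, add_smul, TensorProduct.tmul_add, TensorProduct.add_tmul, map_add, hx, hy]
    · have : φ.rightMul 0 a = 0 := Subtype.ext (by simp [rightMul])
      simp [this]
    · intro x y hx hy
      have : φ.rightMul (x + y) a = φ.rightMul x a + φ.rightMul y a :=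
        Subtype.ext (by simp [rightMul, add_mul])
      simp only [this, TensorProduct.add_tmul, map_add, hx, hy]
  have hker : π.ker ≤ δ₀.ker := by
    intro z hz
    have hz' : z ∈ φ.balancing M.carrier := (Submodule.Quotient.mk_eq_zero _).1 hz
    rw [AddMonoidHom.mem_ker]
    refine Submodule.closure_induction (p := fun z _ => δ₀ z = 0) (map_zero _)
      (fun x y _ _ hx hy => by rw [map_add, hx, hy, add_zero]) ?_ hz'
    rintro b _ ⟨k, a, m, rfl⟩
    have hb : b • (φ.rightMul k a ⊗ₜ[ℤ] m - k ⊗ₜ[ℤ] (a • m)) =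
        φ.rightMul (b • k) a ⊗ₜ[ℤ] m - (b • k) ⊗ₜ[ℤ] (a • m) := by
      rw [smul_sub, TensorProduct.smul_tmul', TensorProduct.smul_tmul']
      congr 2
      exact Subtype.ext (by simp [rightMul, mul_assoc])
    rw [hb, map_sub, hbal, sub_self]
  let δ : φ.Tens M.carrier →+ (ℤ →₀ φ.Tens M.carrier) := π.liftOfSurjective hπ ⟨δ₀, hker⟩
  have hδ : ∀ z, δ (π z) = δ₀ z := fun z =>
    AddMonoidHom.liftOfRightInverse_comp_apply π _ (Function.rightInverse_surjInv hπ) ⟨δ₀, hker⟩ z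
  refine isInternal_of_coaction _ δ (fun d z hz => ?_) fun z => ?_
  · induction hz using AddSubgroup.closure_induction with
    | mem z hz =>
      obtain ⟨a, b, k, m, rfl, hk, hm, rfl⟩ := hz
      exact (hδ _).trans (hδ₀ a b k m hk hm)
    | zero => simp
    | add x y _ _ hx hy => rw [map_add, hx, hy, Finsupp.single_add]
    | neg x _ hx => rw [map_neg, hx, Finsupp.single_neg]
  · obtain ⟨z, rfl⟩ := hπ z
    induction z using TensorProduct.induction_on with
    | zero => rw [map_zero]; exact zero_mem _
    | add x y hx hy => rw [map_add]; exact add_mem hx hy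
    | tmul k m =>
      refine grading_induction (p := fun k => π (k ⊗ₜ m) ∈ ⨆ d, φ.tensGr M.gr d) hK
        (fun d k hk => ?_) (by simp) (fun x y hx hy => ?_) k
      · refine grading_induction (p := fun m => π (k ⊗ₜ m) ∈ ⨆ d, φ.tensGr M.gr d) M.internal
          (fun e m hm => ?_) (by simp) (fun x y hx hy => ?_) m
        · exact AddSubgroup.mem_iSup_of_mem (d + e)
            (AddSubgroup.subset_closure ⟨d, e, k, m, rfl, hk, hm, rfl⟩)
        · rw [TensorProduct.tmul_add, map_add]; exact add_mem hx hy
      · rw [TensorProduct.add_tmul, map_add]; exact add_mem hx hy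

theorem tens_smul_mem [GradedRing ℬ] (M : GrMod 𝒜) {a b : ℤ} {r : B} {z : φ.Tens M.carrier}
    (hr : r ∈ ℬ a) (hz : z ∈ φ.tensGr M.gr b) : r • z ∈ φ.tensGr M.gr (a + b) := by
  induction hz using AddSubgroup.closure_induction with
  | mem z hz =>
    obtain ⟨c, d, k, m, rfl, hk, hm, rfl⟩ := hz
    exact AddSubgroup.subset_closure ⟨a + c, d, r • k, m, add_assoc _ _ _,
      SetLike.mul_mem_graded hr hk, hm, rfl⟩
  | zero => rw [smul_zero]; exact zero_mem _
  | add x y _ _ hx hy => rw [smul_add]; exact add_mem hx hy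
  | neg x _ hx => rw [smul_neg]; exact neg_mem hx

/-- The map `id ⊗ f : B e ⊗_A M → B e ⊗_A M'` induced by an `A`-linear map `f`. -/
def tensMap {M M' : Type*} [AddCommGroup M] [Module A M] [AddCommGroup M'] [Module A M']
    (f : M →ₗ[A] M') : φ.Tens M →ₗ[B] φ.Tens M' :=
  Submodule.mapQ _ _
    (TensorProduct.AlgebraTensorModule.map (LinearMap.id : φ.leftIdeal →ₗ[B] φ.leftIdeal)
      f.toAddMonoidHom.toIntLinearMap) (by
    rw [balancing, Submodule.span_le]
    rintro _ ⟨k, a, m, rfl⟩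
    refine Submodule.subset_span ⟨k, a, f m, ?_⟩
    simp)

@[simp] theorem tensMap_tmk {M M' : Type*} [AddCommGroup M] [Module A M] [AddCommGroup M']
    [Module A M'] (f : M →ₗ[A] M') (k : φ.leftIdeal) (m : M) :
    φ.tensMap f (φ.tmk k m) = φ.tmk k (f m) := rfl

theorem tens_hom_ext {M : Type*} [AddCommGroup M] [Module A M] {N : Type*} [AddCommGroup N]
    [Module B N] {f g : φ.Tens M →ₗ[B] N} (h : ∀ k m, f (φ.tmk k m) = g (φ.tmk k m)) : f = g := by
  refine LinearMap.ext fun z => ?_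
  obtain ⟨z, rfl⟩ := (φ.balancing M).mkQ_surjective z
  induction z using TensorProduct.induction_on with
  | zero => simp
  | tmul k m => exact h k m
  | add x y hx hy => simp only [map_add, hx, hy]

/-- The functor `M ↦ B e ⊗_A M` from graded `A`-modules to graded `B`-modules. -/
def ind [GradedRing 𝒜] [GradedRing ℬ] : GrMod 𝒜 ⥤ GrMod ℬ where
  obj M :=
    { carrier := φ.Tens M.carrier
      gr := φ.tensGr M.gr
      internal := φ.tens_internal M
      smul_mem := fun hr hz => φ.tens_smul_mem M hr hz }
  map {M M'} f :=
    { lin := φ.tensMap f.lin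
      map_mem := fun d z hz => by
        induction hz using AddSubgroup.closure_induction with
        | mem z hz =>
          obtain ⟨a, b, k, m, rfl, hk, hm, rfl⟩ := hz
          exact AddSubgroup.subset_closure ⟨a, b, k, f.lin m, rfl, hk, f.map_mem b m hm, rfl⟩
        | zero => rw [map_zero]; exact zero_mem _
        | add x y _ _ hx hy => rw [map_add]; exact add_mem hx hy
        | neg x _ hx => rw [map_neg]; exact neg_mem hx }
  map_id M := Hom.ext (φ.tens_hom_ext fun _ _ => rfl)
  map_comp f g := Hom.ext (φ.tens_hom_ext fun _ _ => rfl)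

end CornerHom

end GrMod

/-! ### Cartan data and the Khovanov-Lauda-Rouquier algebra -/

/-- A Cartan datum: a symmetrizable generalized Cartan matrix `a` with symmetrizer
`diag (d i)`, simple roots `α i` in the weight lattice `P` and simple coroots `h i` in the dual
lattice. -/
structure CartanDatum (I : Type*) [Fintype I] [DecidableEq I] (P : Type*) [AddCommGroup P]
    [Module.Free ℤ P] [Module.Finite ℤ P] where
  a : I → I → ℤ
  a_diag : ∀ i, a i i = 2
  a_nonpos : ∀ i j, i ≠ j → a i j ≤ 0
  a_zero : ∀ i j, a j i = 0 → a i j = 0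
  d : I → ℤ
  d_pos : ∀ i, 0 < d i
  symm : ∀ i j, d i * a i j = d j * a j i
  α : I → P
  h : I → (P →ₗ[ℤ] ℤ)
  h_α : ∀ i j, h i (α j) = a i j
  α_indep : LinearIndependent ℤ α
  exists_fundamental : ∀ i, ∃ ϖ : P, ∀ j, h j ϖ = if j = i then 1 else 0

namespace CartanDatum

variable {I : Type*} [Fintype I] [DecidableEq I] {P : Type*} [AddCommGroup P]
    [Module.Free ℤ P] [Module.Finite ℤ P] (C : CartanDatum I P)

/-- The form `(α_i | α_j) = d_i a_{ij}` on simple roots. -/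
def form (i j : I) : ℤ := C.d i * C.a i j

theorem form_comm (i j : I) : C.form i j = C.form j i := C.symm i j

end CartanDatum

section KLRAlgebras

variable {I : Type v} [Fintype I] [DecidableEq I] {P : Type*} [AddCommGroup P]
    [Module.Free ℤ P] [Module.Finite ℤ P]

/-- The matrix `Q_{ij}(u, v) = ∑ t_{i,j;p,q} u^p v^q` of polynomials; `t i j` is the finitely
supported family of coefficients of `Q_{ij}`. -/
structure KLRDatum (C : CartanDatum I P) {k : Type u} [CommRing k] (𝓀 : ℤ → AddSubgroup k) where
  t : I → I → (ℕ × ℕ →₀ k)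
  t_diag : ∀ i, t i i = 0
  t_symm : ∀ i j p q, t i j (p, q) = t j i (q, p)
  t_mem : ∀ i j, i ≠ j → ∀ p q : ℕ,
    t i j (p, q) ∈ 𝓀 (-2 * C.form i j - C.form i i * p - C.form j j * q)
  t_unit : ∀ i j, i ≠ j → t i j ((-C.a i j).toNat, 0) ∈ 𝓀 0 ∧
    ∃ s ∈ 𝓀 0, t i j ((-C.a i j).toNat, 0) * s = 1

section Eval

variable {k : Type*} [CommRing k] {A : Type*} [Ring A] [Algebra k A]

/-- The value `f(x, y)` of a polynomial `f(u, v) = ∑ f_{pq} u^p v^q`. -/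
noncomputable def evalTwo (f : ℕ × ℕ →₀ k) (x y : A) : A :=
  f.sum fun p c => c • (x ^ p.1 * y ^ p.2)

/-- The value at `(u, v, w) = (x, y, z)` of the polynomial `(f(u, v) - f(w, v)) / (u - w)`. -/
noncomputable def evalDivDiff (f : ℕ × ℕ →₀ k) (x y z : A) : A :=
  f.sum fun p c => c • ((∑ b ∈ Finset.range p.1, x ^ b * z ^ (p.1 - 1 - b)) * y ^ p.2)

theorem evalDivDiff_mul_sub (f : ℕ × ℕ →₀ k) {x y z : A} (hxz : Commute x z) (hxy : Commute x y)
    (hyz : Commute y z) :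
    evalDivDiff f x y z * (x - z) = evalTwo f x y - evalTwo f z y := by
  rw [evalDivDiff, evalTwo, evalTwo, Finsupp.sum_mul, Finsupp.sum, Finsupp.sum, Finsupp.sum,
    ← Finset.sum_sub_distrib]
  refine Finset.sum_congr rfl fun p _ => ?_
  rw [← smul_sub, smul_mul_assoc, mul_assoc, ← sub_mul,
    ((hxy.symm.sub_right hyz).pow_left p.2).eq, ← mul_assoc, hxz.geom_sum₂_mul]

variable {B : Type*} [Ring B] [Algebra k B]

theorem map_evalTwo (g : A →ₐ[k] B) (f : ℕ × ℕ →₀ k) (x y : A) :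
    g (evalTwo f x y) = evalTwo f (g x) (g y) := by
  simp [evalTwo, Finsupp.sum]

theorem map_evalDivDiff (g : A →ₐ[k] B) (f : ℕ × ℕ →₀ k) (x y z : A) :
    g (evalDivDiff f x y z) = evalDivDiff f (g x) (g y) (g z) := by
  simp [evalDivDiff, Finsupp.sum]

end Eval

/-- Generators `e(ν)`, `x_k`, `τ_l` of `R(n)`; the positions `1, …, n` are numbered `0, …, n - 1`,
and `τ l` exchanges the positions `l` and `l + 1`. -/
inductive KLRGen (I : Type v) (n : ℕ) : Type v
  | e (ν : Fin n → I)
  | x (l : Fin n)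
  | τ (l : ℕ) (h : l + 1 < n)

/-- The position `l`. -/
abbrev pos {n : ℕ} (l : ℕ) (h : l < n) : Fin n := ⟨l, h⟩

/-- The transposition `s_l` of the positions `l` and `l + 1`. -/
def sSwap {n : ℕ} (l : ℕ) (h : l + 1 < n) : Equiv.Perm (Fin n) :=
  Equiv.swap (pos l (Nat.lt_of_succ_lt h)) (pos (l + 1) h)

variable {C : CartanDatum I P} {k : Type u} [CommRing k] {𝓀 : ℤ → AddSubgroup k}

section Relations

variable {n : ℕ}

/-- The generator `e(ν)` in the free algebra. -/
abbrev gE (k : Type u) [CommRing k] (ν : Fin n → I) : FreeAlgebra k (KLRGen I n) :=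
  FreeAlgebra.ι k (KLRGen.e ν)

/-- The generator `x_l` in the free algebra. -/
abbrev gX (I : Type v) (k : Type u) [CommRing k] (l : Fin n) : FreeAlgebra k (KLRGen I n) :=
  FreeAlgebra.ι k (KLRGen.x l)

/-- The generator `τ_l` in the free algebra. -/
abbrev gT (I : Type v) (k : Type u) [CommRing k] (l : ℕ) (h : l + 1 < n) :
    FreeAlgebra k (KLRGen I n) :=
  FreeAlgebra.ι k (KLRGen.τ l h)

/-- The defining relations of `R(n)`. -/
inductive KLRRel (Q : KLRDatum C 𝓀) (n : ℕ) :
    FreeAlgebra k (KLRGen I n) → FreeAlgebra k (KLRGen I n) → Prop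
  | e_mul (ν ν' : Fin n → I) : KLRRel Q n (gE k ν * gE k ν') (if ν = ν' then gE k ν else 0)
  | sum_e : KLRRel Q n (∑ ν : Fin n → I, gE k ν) 1
  | x_comm (l m : Fin n) : KLRRel Q n (gX I k l * gX I k m) (gX I k m * gX I k l)
  | x_e (l : Fin n) (ν : Fin n → I) : KLRRel Q n (gX I k l * gE k ν) (gE k ν * gX I k l)
  | τ_e (l : ℕ) (h : l + 1 < n) (ν : Fin n → I) :
      KLRRel Q n (gT I k l h * gE k ν) (gE k (ν ∘ sSwap l h) * gT I k l h)
  | τ_comm (l m : ℕ) (hl : l + 1 < n) (hm : m + 1 < n) (hlm : l + 1 < m ∨ m + 1 < l) :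
      KLRRel Q n (gT I k l hl * gT I k m hm) (gT I k m hm * gT I k l hl)
  | τ_sq (l : ℕ) (h : l + 1 < n) (ν : Fin n → I) :
      KLRRel Q n (gT I k l h * gT I k l h * gE k ν)
        (evalTwo (Q.t (ν (pos l (Nat.lt_of_succ_lt h))) (ν (pos (l + 1) h)))
          (gX I k (pos l (Nat.lt_of_succ_lt h))) (gX I k (pos (l + 1) h)) * gE k ν)
  | τ_x (l : ℕ) (h : l + 1 < n) (m : Fin n) (ν : Fin n → I) :
      KLRRel Q n ((gT I k l h * gX I k m - gX I k (sSwap l h m) * gT I k l h) * gE k ν)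
        (if ν (pos l (Nat.lt_of_succ_lt h)) = ν (pos (l + 1) h) then
          (if m = pos l (Nat.lt_of_succ_lt h) then -gE k ν
            else if m = pos (l + 1) h then gE k ν else 0)
          else 0)
  | braid (l : ℕ) (h : l + 2 < n) (ν : Fin n → I) :
      KLRRel Q n
        ((gT I k (l + 1) h * gT I k l (Nat.lt_of_succ_lt h) * gT I k (l + 1) h -
          gT I k l (Nat.lt_of_succ_lt h) * gT I k (l + 1) h * gT I k l (Nat.lt_of_succ_lt h)) *
            gE k ν)
        (if ν (pos l (by omega)) = ν (pos (l + 2) h) then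
          evalDivDiff (Q.t (ν (pos l (by omega))) (ν (pos (l + 1) (by omega))))
            (gX I k (pos l (by omega))) (gX I k (pos (l + 1) (by omega)))
            (gX I k (pos (l + 2) h)) * gE k ν
          else 0)

end Relations

/-- The Khovanov-Lauda-Rouquier algebra `R(n)`. -/
def KLR (Q : KLRDatum C 𝓀) (n : ℕ) : Type (max u v) := RingQuot (KLRRel Q n)

namespace KLR

variable (Q : KLRDatum C 𝓀) {n : ℕ}

noncomputable instance (n : ℕ) : Ring (KLR Q n) := inferInstanceAs (Ring (RingQuot (KLRRel Q n)))
noncomputable instance (n : ℕ) : Algebra k (KLR Q n) :=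
  inferInstanceAs (Algebra k (RingQuot (KLRRel Q n)))

/-- The projection from the free algebra. -/
noncomputable def mk (n : ℕ) : FreeAlgebra k (KLRGen I n) →ₐ[k] KLR Q n :=
  RingQuot.mkAlgHom k (KLRRel Q n)

theorem mk_surjective (n : ℕ) : Function.Surjective (mk Q n) :=
  RingQuot.mkAlgHom_surjective k (KLRRel Q n)

theorem mk_rel {a b : FreeAlgebra k (KLRGen I n)} (h : KLRRel Q n a b) : mk Q n a = mk Q n b :=
  RingQuot.mkAlgHom_rel k h

/-- The element `e(ν)` of `R(n)`. -/
noncomputable def e (ν : Fin n → I) : KLR Q n := mk Q n (gE k ν)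

/-- The element `x_l` of `R(n)`. -/
noncomputable def x (l : Fin n) : KLR Q n := mk Q n (gX I k l)

/-- The element `τ_l` of `R(n)`. -/
noncomputable def τ (l : ℕ) (h : l + 1 < n) : KLR Q n := mk Q n (gT I k l h)

theorem e_mul (ν ν' : Fin n → I) : e Q ν * e Q ν' = if ν = ν' then e Q ν else 0 := by
  have := mk_rel Q (KLRRel.e_mul (Q := Q) ν ν')
  rw [map_mul] at this
  rw [e, e, this]
  split_ifs <;> simp

theorem sum_e : ∑ ν : Fin n → I, e Q ν = 1 := by
  have := mk_rel Q (KLRRel.sum_e (Q := Q) (n := n))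
  rwa [map_sum, map_one] at this

theorem x_comm (l m : Fin n) : x Q l * x Q m = x Q m * x Q l := by
  have := mk_rel Q (KLRRel.x_comm (Q := Q) l m)
  rwa [map_mul, map_mul] at this

theorem x_e (l : Fin n) (ν : Fin n → I) : x Q l * e Q ν = e Q ν * x Q l := by
  have := mk_rel Q (KLRRel.x_e (Q := Q) l ν)
  rwa [map_mul, map_mul] at this

theorem τ_e (l : ℕ) (h : l + 1 < n) (ν : Fin n → I) :
    τ Q l h * e Q ν = e Q (ν ∘ sSwap l h) * τ Q l h := by
  have := mk_rel Q (KLRRel.τ_e (Q := Q) l h ν)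
  rwa [map_mul, map_mul] at this

theorem τ_comm (l m : ℕ) (hl : l + 1 < n) (hm : m + 1 < n) (hlm : l + 1 < m ∨ m + 1 < l) :
    τ Q l hl * τ Q m hm = τ Q m hm * τ Q l hl := by
  have := mk_rel Q (KLRRel.τ_comm (Q := Q) l m hl hm hlm)
  rwa [map_mul, map_mul] at this

theorem τ_sq (l : ℕ) (h : l + 1 < n) (ν : Fin n → I) :
    τ Q l h * τ Q l h * e Q ν =
      evalTwo (Q.t (ν (pos l (Nat.lt_of_succ_lt h))) (ν (pos (l + 1) h)))
        (x Q (pos l (Nat.lt_of_succ_lt h))) (x Q (pos (l + 1) h)) * e Q ν := by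
  have := mk_rel Q (KLRRel.τ_sq (Q := Q) l h ν)
  simp only [map_mul, map_evalTwo] at this
  exact this

theorem τ_x (l : ℕ) (h : l + 1 < n) (m : Fin n) (ν : Fin n → I) :
    (τ Q l h * x Q m - x Q (sSwap l h m) * τ Q l h) * e Q ν =
      if ν (pos l (Nat.lt_of_succ_lt h)) = ν (pos (l + 1) h) then
        (if m = pos l (Nat.lt_of_succ_lt h) then -e Q ν
          else if m = pos (l + 1) h then e Q ν else 0)
        else 0 := by
  have := mk_rel Q (KLRRel.τ_x (Q := Q) l h m ν)
  simp only [map_mul, map_sub, apply_ite (mk Q n), map_neg, map_zero] at this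
  exact this

theorem braid (l : ℕ) (h : l + 2 < n) (ν : Fin n → I) :
    (τ Q (l + 1) h * τ Q l (Nat.lt_of_succ_lt h) * τ Q (l + 1) h -
      τ Q l (Nat.lt_of_succ_lt h) * τ Q (l + 1) h * τ Q l (Nat.lt_of_succ_lt h)) * e Q ν =
      if ν (pos l (by omega)) = ν (pos (l + 2) h) then
        evalDivDiff (Q.t (ν (pos l (by omega))) (ν (pos (l + 1) (by omega))))
          (x Q (pos l (by omega))) (x Q (pos (l + 1) (by omega)))
          (x Q (pos (l + 2) h)) * e Q ν
        else 0 := by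
  have := mk_rel Q (KLRRel.braid (Q := Q) l h ν)
  simp only [map_mul, map_sub, apply_ite (mk Q n), map_evalDivDiff, map_zero] at this
  exact this

/-- Homogeneous elements of `R(n)`: the smallest family of additive subgroups closed under
products that contains `c` in degree `d` for `c ∈ k_d`, `e(ν)` in degree `0`, `x_l e(ν)` in degree
`(α_{ν_l} | α_{ν_l})` and `τ_l e(ν)` in degree `-(α_{ν_l} | α_{ν_{l+1}})`. -/
inductive IsHomog : ℤ → KLR Q n → Prop
  | scalar {d : ℤ} {c : k} (hc : c ∈ 𝓀 d) : IsHomog d (algebraMap k (KLR Q n) c)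
  | e (ν : Fin n → I) : IsHomog 0 (KLR.e Q ν)
  | x (l : Fin n) (ν : Fin n → I) : IsHomog (C.form (ν l) (ν l)) (KLR.x Q l * KLR.e Q ν)
  | τ (l : ℕ) (h : l + 1 < n) (ν : Fin n → I) :
      IsHomog (-C.form (ν (pos l (Nat.lt_of_succ_lt h))) (ν (pos (l + 1) h)))
        (KLR.τ Q l h * KLR.e Q ν)
  | zero (d : ℤ) : IsHomog d 0
  | add {d : ℤ} {a b : KLR Q n} (ha : IsHomog d a) (hb : IsHomog d b) : IsHomog d (a + b)
  | neg {d : ℤ} {a : KLR Q n} (ha : IsHomog d a) : IsHomog d (-a)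
  | mul {d d' : ℤ} {a b : KLR Q n} (ha : IsHomog d a) (hb : IsHomog d' b) :
      IsHomog (d + d') (a * b)

/-- The homogeneous part `R(n)_d`. -/
def gr (n : ℕ) (d : ℤ) : AddSubgroup (KLR Q n) where
  carrier := {a | IsHomog Q d a}
  zero_mem' := .zero d
  add_mem' := .add
  neg_mem' := .neg

/-! #### `R(n)` is a graded ring -/

theorem sSwap_left (l : ℕ) (h : l + 1 < n) :
    sSwap l h (pos l (Nat.lt_of_succ_lt h)) = pos (l + 1) h := Equiv.swap_apply_left _ _

theorem sSwap_right (l : ℕ) (h : l + 1 < n) :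
    sSwap l h (pos (l + 1) h) = pos l (Nat.lt_of_succ_lt h) := Equiv.swap_apply_right _ _

theorem sSwap_of_ne (l : ℕ) (h : l + 1 < n) (m : ℕ) (hm : m < n) (h1 : m ≠ l) (h2 : m ≠ l + 1) :
    sSwap l h (pos m hm) = pos m hm :=
  Equiv.swap_apply_of_ne_of_ne (by simpa [Fin.ext_iff] using h1) (by simpa [Fin.ext_iff] using h2)

theorem sSwap_sSwap (l : ℕ) (h : l + 1 < n) (m : Fin n) : sSwap l h (sSwap l h m) = m :=
  Equiv.swap_apply_self _ _ _

section Grading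

theorem t_mem (i j : I) (p : ℕ × ℕ) :
    Q.t i j p ∈ 𝓀 (-2 * C.form i j - C.form i i * p.1 - C.form j j * p.2) := by
  by_cases h : i = j
  · subst h
    rw [Q.t_diag]
    exact zero_mem _
  · exact Q.t_mem i j h p.1 p.2

/-- The ring `R(n)[t, t⁻¹]`, made a `k`-algebra through `c ↦ ∑ c_d t^d`. -/
def Tw (n : ℕ) : Type (max u v) := AddMonoidAlgebra (KLR Q n) ℤ

noncomputable instance (n : ℕ) : Ring (Tw Q n) :=
  inferInstanceAs (Ring (AddMonoidAlgebra (KLR Q n) ℤ))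

/-- The monomial `a t^d`. -/
noncomputable def Tw.S (d : ℤ) (a : KLR Q n) : Tw Q n := AddMonoidAlgebra.single d a

open Tw

theorem S_mul (d d' : ℤ) (a b : KLR Q n) : S Q d a * S Q d' b = S Q (d + d') (a * b) :=
  AddMonoidAlgebra.single_mul_single _ _ _ _

theorem S_add (d : ℤ) (a b : KLR Q n) : S Q d (a + b) = S Q d a + S Q d b :=
  AddMonoidAlgebra.single_add _ _ _

theorem S_zero (d : ℤ) : S Q d (0 : KLR Q n) = 0 := AddMonoidAlgebra.single_zero _

theorem S_neg (d : ℤ) (a : KLR Q n) : S Q d (-a) = -S Q d a :=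
  eq_neg_of_add_eq_zero_left (by rw [← S_add, neg_add_cancel, S_zero])

theorem S_one : S Q 0 (1 : KLR Q n) = 1 := rfl

theorem S_sum {ι : Type*} (s : Finset ι) (d : ℤ) (f : ι → KLR Q n) :
    S Q d (∑ i ∈ s, f i) = ∑ i ∈ s, S Q d (f i) :=
  map_sum (AddMonoidAlgebra.singleAddHom (R := KLR Q n) d) f s

theorem sum_S_mul (D : (Fin n → I) → ℤ) (a : KLR Q n) (ν : Fin n → I) :
    (∑ ν' : Fin n → I, S Q (D ν') (a * e Q ν')) * S Q 0 (e Q ν) = S Q (D ν) (a * e Q ν) := by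
  rw [Finset.sum_mul, Finset.sum_eq_single ν]
  · rw [S_mul, mul_assoc, e_mul, if_pos rfl, add_zero]
  · intro ν' _ h
    rw [S_mul, mul_assoc, e_mul, if_neg h, mul_zero, S_zero]
  · simp

theorem S_mul_sum (D : (Fin n → I) → ℤ) (a : KLR Q n) (ν ν' : Fin n → I)
    (h : a * e Q ν = e Q ν' * a) :
    S Q 0 (e Q ν') * (∑ ν' : Fin n → I, S Q (D ν') (a * e Q ν')) = S Q (D ν) (a * e Q ν) := by
  rw [Finset.mul_sum, Finset.sum_eq_single ν]
  · rw [S_mul, ← mul_assoc, ← h, mul_assoc, e_mul, if_pos rfl, zero_add]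
  · intro ν'' _ h'
    rw [S_mul, ← mul_assoc, ← h, mul_assoc, e_mul, if_neg h'.symm, mul_zero, S_zero]
  · simp

variable [GradedRing 𝓀]

/-- The structure map `c ↦ ∑ c_d t^d`. -/
noncomputable def Tw.κ (n : ℕ) : k →+* Tw Q n := laurentHom 𝓀 (algebraMap k (KLR Q n))

theorem κ_of_mem {d : ℤ} {c : k} (hc : c ∈ 𝓀 d) : κ Q n c = S Q d (algebraMap k (KLR Q n) c) :=
  laurentHom_of_mem _ hc

theorem laurentHom_comm (c : k) (z : AddMonoidAlgebra (KLR Q n) ℤ) :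
    laurentHom 𝓀 (algebraMap k (KLR Q n)) c * z = z * laurentHom 𝓀 (algebraMap k (KLR Q n)) c := by
  refine grading_induction (p := fun c => laurentHom 𝓀 (algebraMap k (KLR Q n)) c * z =
    z * laurentHom 𝓀 (algebraMap k (KLR Q n)) c)
    (gradedRing_isInternal (𝒜 := 𝓀)) (fun d c hc => ?_) (by simp)
    (fun x y hx hy => by rw [map_add, add_mul, mul_add, hx, hy]) c
  rw [laurentHom_of_mem _ hc]
  induction z using AddMonoidAlgebra.induction_linear with
  | zero => rw [mul_zero, zero_mul]
  | add x y hx hy => rw [mul_add, add_mul, hx, hy]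
  | single e b =>
    rw [AddMonoidAlgebra.single_mul_single, AddMonoidAlgebra.single_mul_single, add_comm,
      Algebra.commutes]

noncomputable instance (n : ℕ) : Algebra k (Tw Q n) := (κ Q n).toAlgebra' (laurentHom_comm Q)

theorem smul_S {d e : ℤ} {c : k} (hc : c ∈ 𝓀 d) (a : KLR Q n) :
    c • S Q e a = S Q (d + e) (c • a) := by
  rw [Algebra.smul_def, Algebra.smul_def, ← S_mul, ← κ_of_mem Q hc]
  rfl

/-- The map from the free algebra to `R(n)[t, t⁻¹]` that records degrees. -/
noncomputable def Tw.δ₀ (n : ℕ) : FreeAlgebra k (KLRGen I n) →ₐ[k] Tw Q n :=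
  FreeAlgebra.lift k fun g =>
    match g with
    | .e ν => S Q 0 (e Q ν)
    | .x l => ∑ ν : Fin n → I, S Q (C.form (ν l) (ν l)) (x Q l * e Q ν)
    | .τ l h => ∑ ν : Fin n → I,
        S Q (-C.form (ν (pos l (Nat.lt_of_succ_lt h))) (ν (pos (l + 1) h))) (τ Q l h * e Q ν)

theorem δ₀_e (ν : Fin n → I) : δ₀ Q n (gE k ν) = S Q 0 (e Q ν) := FreeAlgebra.lift_ι_apply _ _

theorem δ₀_x (l : Fin n) : δ₀ Q n (gX I k l) =
    ∑ ν : Fin n → I, S Q (C.form (ν l) (ν l)) (x Q l * e Q ν) := FreeAlgebra.lift_ι_apply _ _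

theorem δ₀_τ (l : ℕ) (h : l + 1 < n) : δ₀ Q n (gT I k l h) = ∑ ν : Fin n → I,
    S Q (-C.form (ν (pos l (Nat.lt_of_succ_lt h))) (ν (pos (l + 1) h))) (τ Q l h * e Q ν) :=
  FreeAlgebra.lift_ι_apply _ _

/-- `w e(ν) = e(ν') w` in `R(n)`, and this element has degree `d`. -/
def Tw.H (w : FreeAlgebra k (KLRGen I n)) (ν' ν : Fin n → I) (d : ℤ) : Prop :=
  δ₀ Q n w * S Q 0 (e Q ν) = S Q d (mk Q n w * e Q ν) ∧ mk Q n w * e Q ν = e Q ν' * mk Q n w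

variable {Q}

theorem H_x (l : Fin n) (ν : Fin n → I) : H Q (gX I k l) ν ν (C.form (ν l) (ν l)) :=
  ⟨by rw [δ₀_x, sum_S_mul]; rfl, x_e Q l ν⟩

theorem H_τ (l : ℕ) (h : l + 1 < n) (ν : Fin n → I) : H Q (gT I k l h) (ν ∘ sSwap l h) ν
    (-C.form (ν (pos l (Nat.lt_of_succ_lt h))) (ν (pos (l + 1) h))) :=
  ⟨by rw [δ₀_τ, sum_S_mul Q fun ν =>
      -C.form (ν (pos l (Nat.lt_of_succ_lt h))) (ν (pos (l + 1) h))]; rfl, τ_e Q l h ν⟩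

theorem H_mul {w w' : FreeAlgebra k (KLRGen I n)} {ν ν' ν'' : Fin n → I} {d d' : ℤ}
    (h : H Q w ν'' ν' d) (h' : H Q w' ν' ν d') : H Q (w * w') ν'' ν (d + d') := by
  have idem : ∀ ν : Fin n → I, e Q ν * e Q ν = e Q ν := fun ν => by rw [e_mul, if_pos rfl]
  have key : mk Q n w' * e Q ν = e Q ν' * (mk Q n w' * e Q ν) := by
    rw [← mul_assoc, ← h'.2, mul_assoc, idem]
  refine ⟨?_, ?_⟩
  · rw [map_mul, mul_assoc, h'.1, key, ← zero_add d', ← S_mul, ← mul_assoc, h.1, S_mul, zero_add,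
      mul_assoc, ← key, map_mul, mul_assoc]
  · rw [map_mul, mul_assoc, h'.2, ← mul_assoc, h.2, mul_assoc]

theorem H_add {w w' : FreeAlgebra k (KLRGen I n)} {ν ν' : Fin n → I} {d : ℤ}
    (h : H Q w ν' ν d) (h' : H Q w' ν' ν d) : H Q (w + w') ν' ν d :=
  ⟨by rw [map_add, add_mul, h.1, h'.1, map_add, add_mul, S_add],
    by rw [map_add, add_mul, mul_add, h.2, h'.2]⟩

theorem H_neg {w : FreeAlgebra k (KLRGen I n)} {ν ν' : Fin n → I} {d : ℤ}
    (h : H Q w ν' ν d) : H Q (-w) ν' ν d :=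
  ⟨by rw [map_neg, neg_mul, h.1, map_neg, neg_mul, S_neg],
    by rw [map_neg, neg_mul, mul_neg, h.2]⟩

theorem H_sub {w w' : FreeAlgebra k (KLRGen I n)} {ν ν' : Fin n → I} {d : ℤ}
    (h : H Q w ν' ν d) (h' : H Q w' ν' ν d) : H Q (w - w') ν' ν d := by
  rw [sub_eq_add_neg]
  exact H_add h (H_neg h')

theorem H_zero (ν ν' : Fin n → I) (d : ℤ) : H Q 0 ν' ν d :=
  ⟨by rw [map_zero, map_zero, zero_mul, zero_mul, S_zero], by rw [map_zero, zero_mul, mul_zero]⟩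

theorem H_one (ν : Fin n → I) : H Q 1 ν ν 0 :=
  ⟨by rw [map_one, map_one, one_mul, one_mul], by rw [map_one, one_mul, mul_one]⟩

theorem H_e (ν : Fin n → I) : H Q (gE k ν) ν ν 0 :=
  ⟨by rw [δ₀_e, S_mul, add_zero]; rfl, rfl⟩

theorem H_pow {w : FreeAlgebra k (KLRGen I n)} {ν : Fin n → I} {d : ℤ}
    (h : H Q w ν ν d) (p : ℕ) : H Q (w ^ p) ν ν (d * p) := by
  induction p with
  | zero => simpa using H_one ν
  | succ p ih =>
    have := H_mul ih h
    rw [pow_succ]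
    convert this using 1
    push_cast; ring

theorem H_smul {w : FreeAlgebra k (KLRGen I n)} {ν ν' : Fin n → I} {d d' : ℤ} {c : k}
    (hc : c ∈ 𝓀 d) (h : H Q w ν' ν d') : H Q (c • w) ν' ν (d + d') :=
  ⟨by rw [map_smul, smul_mul_assoc, h.1, smul_S Q hc, map_smul, smul_mul_assoc],
    by rw [map_smul, smul_mul_assoc, mul_smul_comm, h.2]⟩

theorem H_sum {ι : Type*} {s : Finset ι} {f : ι → FreeAlgebra k (KLRGen I n)} {ν ν' : Fin n → I}
    {d : ℤ} (h : ∀ i ∈ s, H Q (f i) ν' ν d) : H Q (∑ i ∈ s, f i) ν' ν d := by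
  classical
  induction s using Finset.induction_on with
  | empty => simpa using H_zero ν ν' d
  | insert a s ha ih =>
    rw [Finset.sum_insert ha]
    exact H_add (h a (Finset.mem_insert_self a s))
      (ih fun i hi => h i (Finset.mem_insert_of_mem hi))

theorem H_evalTwo (l m : Fin n) (ν : Fin n → I) :
    H Q (evalTwo (Q.t (ν l) (ν m)) (gX I k l) (gX I k m)) ν ν (-2 * C.form (ν l) (ν m)) := by
  refine H_sum fun p _ => ?_
  convert H_smul (t_mem Q (ν l) (ν m) p) (H_mul (H_pow (H_x l ν) p.1) (H_pow (H_x m ν) p.2)) using 1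
  ring

theorem H_evalDivDiff (l m r : Fin n) (ν : Fin n → I) (hν : ν l = ν r) :
    H Q (evalDivDiff (Q.t (ν l) (ν m)) (gX I k l) (gX I k m) (gX I k r)) ν ν
      (-2 * C.form (ν l) (ν m) - C.form (ν l) (ν l)) := by
  refine H_sum fun p _ => ?_
  have h : H Q (∑ b ∈ Finset.range p.1, gX I k l ^ b * gX I k r ^ (p.1 - 1 - b)) ν ν
      (C.form (ν l) (ν l) * p.1 - C.form (ν l) (ν l)) := by
    refine H_sum fun b hb => ?_
    rw [Finset.mem_range] at hb
    convert H_mul (H_pow (H_x l ν) b) (H_pow (H_x r ν) (p.1 - 1 - b)) using 1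
    rw [← hν, ← mul_add]
    have : ((p.1 - 1 - b : ℕ) : ℤ) = p.1 - 1 - b := by omega
    rw [this]; ring
  convert H_smul (t_mem Q (ν l) (ν m) p) (H_mul h (H_pow (H_x m ν) p.2)) using 1
  ring

theorem H_ext {w w' : FreeAlgebra k (KLRGen I n)} (hw : mk Q n w = mk Q n w')
    (h : ∀ ν : Fin n → I, ∃ ν₁ ν₂ d, H Q w ν₁ ν d ∧ H Q w' ν₂ ν d) : δ₀ Q n w = δ₀ Q n w' := by
  rw [← mul_one (δ₀ Q n w), ← mul_one (δ₀ Q n w'), ← S_one, ← sum_e, S_sum, Finset.mul_sum,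
    Finset.mul_sum]
  refine Finset.sum_congr rfl fun ν _ => ?_
  obtain ⟨ν₁, ν₂, d, h1, h2⟩ := h ν
  rw [h1.1, h2.1, hw]

theorem H_ext_e {w w' : FreeAlgebra k (KLRGen I n)} {ν ν' : Fin n → I} {d : ℤ}
    (hw : mk Q n (w * gE k ν) = mk Q n (w' * gE k ν))
    (h : H Q w ν' ν d) {ν'' : Fin n → I} (h' : H Q w' ν'' ν d) :
    δ₀ Q n (w * gE k ν) = δ₀ Q n (w' * gE k ν) := by
  rw [map_mul, map_mul] at hw
  rw [map_mul, map_mul, δ₀_e, h.1, h'.1]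
  exact congrArg _ hw

theorem H_of_eq {w : FreeAlgebra k (KLRGen I n)} {ν ν' : Fin n → I} {d d' : ℤ}
    (h : H Q w ν' ν d) (hd : d = d') : H Q w ν' ν d' := hd ▸ h

theorem δ₀_rel {w w' : FreeAlgebra k (KLRGen I n)} (h : KLRRel Q n w w') :
    δ₀ Q n w = δ₀ Q n w' := by
  have hmk := mk_rel Q h
  cases h with
  | e_mul ν ν' =>
    rw [map_mul, δ₀_e, δ₀_e, S_mul, e_mul, add_zero]
    split_ifs
    · rw [δ₀_e]
    · rw [S_zero, map_zero]
  | sum_e =>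
    rw [map_sum, map_one, ← S_one, ← sum_e, S_sum]
    exact Finset.sum_congr rfl fun ν _ => δ₀_e Q ν
  | x_comm l m =>
    refine H_ext hmk fun ν => ⟨_, ν, _, H_mul (H_x l ν) (H_x m ν), ?_⟩
    exact H_of_eq (H_mul (H_x m ν) (H_x l ν)) (add_comm _ _)
  | x_e l ν =>
    rw [map_mul, map_mul, δ₀_e, δ₀_x, sum_S_mul Q fun ν => C.form (ν l) (ν l),
      S_mul_sum Q (fun ν => C.form (ν l) (ν l)) (x Q l) ν ν (x_e Q l ν)]
  | τ_e l h ν =>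
    rw [map_mul, map_mul, δ₀_e, δ₀_e, δ₀_τ, sum_S_mul Q fun ν =>
      -C.form (ν (pos l (Nat.lt_of_succ_lt h))) (ν (pos (l + 1) h)),
      S_mul_sum Q (fun ν => -C.form (ν (pos l (Nat.lt_of_succ_lt h))) (ν (pos (l + 1) h)))
        (τ Q l h) ν _ (τ_e Q l h ν)]
  | τ_comm l m hl hm hlm =>
    refine H_ext hmk fun ν =>
      ⟨_, (ν ∘ sSwap l hl) ∘ sSwap m hm, _, H_mul (H_τ l hl _) (H_τ m hm ν), ?_⟩
    refine H_of_eq (H_mul (H_τ m hm _) (H_τ l hl ν)) ?_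
    simp only [Function.comp_apply]
    rw [sSwap_of_ne m hm l _ (by omega) (by omega), sSwap_of_ne m hm (l + 1) _ (by omega) (by omega),
      sSwap_of_ne l hl m _ (by omega) (by omega), sSwap_of_ne l hl (m + 1) _ (by omega) (by omega),
      add_comm]
  | τ_sq l h ν =>
    refine H_ext_e hmk (H_mul (H_τ l h _) (H_τ l h ν)) (H_of_eq (H_evalTwo _ _ ν) ?_)
    simp only [Function.comp_apply]
    rw [sSwap_left, sSwap_right, C.form_comm (ν (pos (l + 1) h))]
    ring
  | τ_x l h m ν =>
    have hx := H_mul (H_τ (Q := Q) l h ν) (H_x m ν)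
    have hx' : H Q (gX I k (sSwap l h m) * gT I k l h) (ν ∘ sSwap l h) ν _ :=
      H_mul (H_x (sSwap l h m) _) (H_τ l h ν)
    simp only [Function.comp_apply, sSwap_sSwap] at hx'
    have hs := H_sub hx (H_of_eq hx' (add_comm _ _))
    have h0 : ∀ d, H Q (0 : FreeAlgebra k (KLRGen I n)) ν ν d := H_zero ν ν
    have hz : mk Q n ((gT I k l h * gX I k m - gX I k (sSwap l h m) * gT I k l h) * gE k ν) = 0 →
        δ₀ Q n ((gT I k l h * gX I k m - gX I k (sSwap l h m) * gT I k l h) * gE k ν) =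
          δ₀ Q n 0 := fun h' => by
      rw [H_ext_e (w' := 0) (by rw [h', zero_mul, map_zero]) hs (h0 _), zero_mul]
    split_ifs at hmk ⊢ with h1 h2 h3
    · have : -gE k ν = (-1 : FreeAlgebra k (KLRGen I n)) * gE k ν := by rw [neg_one_mul]
      rw [this] at hmk ⊢
      refine H_ext_e hmk hs (H_of_eq (H_neg (H_one ν)) ?_)
      rw [h2, h1]; ring
    · rw [← one_mul (gE k ν), ← mul_assoc, mul_one] at hmk ⊢
      refine H_ext_e hmk hs (H_of_eq (H_one ν) ?_)
      rw [h3, h1]; ring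
    · exact hz (by rw [hmk, map_zero])
    · exact hz (by rw [hmk, map_zero])
  | braid l h ν =>
    have h1 := H_mul (H_mul (H_τ (Q := Q) (l + 1) h _) (H_τ l (Nat.lt_of_succ_lt h) _)) (H_τ (l + 1) h ν)
    have h2 : H Q (gT I k l (Nat.lt_of_succ_lt h) * gT I k (l + 1) h *
        gT I k l (Nat.lt_of_succ_lt h)) _ ν _ :=
      H_mul (H_mul (H_τ l (Nat.lt_of_succ_lt h) _) (H_τ (l + 1) h _))
        (H_τ l (Nat.lt_of_succ_lt h) ν)
    have e0 : sSwap (n := n) l (Nat.lt_of_succ_lt h) (pos (l + 2) h) = pos (l + 2) h :=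
      sSwap_of_ne _ _ _ _ (by omega) (by omega)
    have e1 : sSwap (n := n) (l + 1) h (pos l (by omega)) = pos l (by omega) :=
      sSwap_of_ne _ _ _ _ (by omega) (by omega)
    have e2 := sSwap_left (n := n) l (Nat.lt_of_succ_lt h)
    have e3 := sSwap_right (n := n) l (Nat.lt_of_succ_lt h)
    have e4 : sSwap (n := n) (l + 1) h (pos (l + 1) (by omega)) = pos (l + 2) h :=
      sSwap_left (n := n) (l + 1) h
    have e5 : sSwap (n := n) (l + 1) h (pos (l + 2) h) = pos (l + 1) (by omega) :=
      sSwap_right (n := n) (l + 1) h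
    have h3 : δ₀ Q n (gT I k (l + 1) h * gT I k l (Nat.lt_of_succ_lt h) * gT I k (l + 1) h) *
        S Q 0 (e Q ν) = S Q (-C.form (ν (pos l (by omega))) (ν (pos (l + 1) (by omega)))
          - C.form (ν (pos l (by omega))) (ν (pos (l + 2) h))
          - C.form (ν (pos (l + 1) (by omega))) (ν (pos (l + 2) h)))
        (mk Q n (gT I k (l + 1) h * gT I k l (Nat.lt_of_succ_lt h) * gT I k (l + 1) h) * e Q ν) := by
      rw [h1.1]
      congr 1
      simp only [Function.comp_apply, e0, e1, e2, e3, e4, e5]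
      ring
    have h4 : δ₀ Q n (gT I k l (Nat.lt_of_succ_lt h) * gT I k (l + 1) h *
          gT I k l (Nat.lt_of_succ_lt h)) *
        S Q 0 (e Q ν) = S Q (-C.form (ν (pos l (by omega))) (ν (pos (l + 1) (by omega)))
          - C.form (ν (pos l (by omega))) (ν (pos (l + 2) h))
          - C.form (ν (pos (l + 1) (by omega))) (ν (pos (l + 2) h)))
        (mk Q n (gT I k l (Nat.lt_of_succ_lt h) * gT I k (l + 1) h *
          gT I k l (Nat.lt_of_succ_lt h)) * e Q ν) := by
      rw [h2.1]
      congr 1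
      simp only [Function.comp_apply, e0, e1, e2, e3, e4, e5]
      ring
    rw [map_mul, map_sub, δ₀_e, sub_mul, h3, h4, sub_eq_add_neg, ← S_neg, ← S_add, ← sub_eq_add_neg,
      ← sub_mul, ← map_sub]
    rw [map_mul] at hmk
    refine (congrArg _ hmk).trans ?_
    split_ifs with hν
    · rw [map_mul, map_mul, δ₀_e, (H_evalDivDiff _ _ _ ν hν).1]
      congr 1
      rw [← hν, C.form_comm (ν (pos (l + 1) _))]
      ring
    · rw [map_zero, map_zero, S_zero]

variable (Q)

/-- The ring homomorphism `R(n) → R(n)[t, t⁻¹]` with `a ↦ a t^d` for `a` of degree `d`. -/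
noncomputable def Tw.δ (n : ℕ) : KLR Q n →ₐ[k] Tw Q n :=
  RingQuot.liftAlgHom k ⟨δ₀ Q n, fun _ _ h => δ₀_rel h⟩

theorem δ_mk (w : FreeAlgebra k (KLRGen I n)) : δ Q n (mk Q n w) = δ₀ Q n w :=
  RingQuot.liftAlgHom_mkAlgHom_apply _ _ _ _

theorem δ_of_homog {d : ℤ} {a : KLR Q n} (h : IsHomog Q d a) : δ Q n a = S Q d a := by
  induction h with
  | scalar hc => rw [AlgHom.commutes]; exact κ_of_mem Q hc
  | e ν => rw [KLR.e, δ_mk, δ₀_e]; rfl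
  | x l ν => rw [map_mul]; exact (congrArg₂ _ (δ_mk Q _) ((δ_mk Q _).trans (δ₀_e Q ν))).trans (H_x l ν).1
  | τ l h ν => rw [map_mul]; exact (congrArg₂ _ (δ_mk Q _) ((δ_mk Q _).trans (δ₀_e Q ν))).trans (H_τ l h ν).1
  | zero d => rw [map_zero, S_zero]
  | add _ _ ha hb => rw [map_add, ha, hb, S_add]
  | neg _ ha => rw [map_neg, ha, S_neg]
  | mul _ _ ha hb => rw [map_mul, ha, hb, S_mul]

theorem mem_iSup_gr (a : KLR Q n) : a ∈ ⨆ d, gr Q n d := by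
  have hhom : ∀ {d : ℤ} {a : KLR Q n}, IsHomog Q d a → a ∈ ⨆ d, gr Q n d :=
    fun {d a} h => AddSubgroup.mem_iSup_of_mem (S := gr Q n) d h
  obtain ⟨w, rfl⟩ := mk_surjective Q n a
  induction w using FreeAlgebra.induction with
  | grade0 c =>
    rw [AlgHom.commutes]
    refine grading_induction (p := fun c => algebraMap k (KLR Q n) c ∈ ⨆ d, gr Q n d)
      (gradedRing_isInternal (𝒜 := 𝓀)) (fun d c hc => hhom (.scalar hc)) (by simp)
      (fun x y hx hy => by rw [map_add]; exact add_mem hx hy) c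
  | grade1 g =>
    cases g with
    | e ν => exact hhom (.e ν)
    | x l =>
      change x Q l ∈ _
      rw [← mul_one (x Q l), ← sum_e, Finset.mul_sum]
      exact sum_mem fun ν _ => hhom (.x l ν)
    | τ l h =>
      change τ Q l h ∈ _
      rw [← mul_one (τ Q l h), ← sum_e, Finset.mul_sum]
      exact sum_mem fun ν _ => hhom (.τ l h ν)
  | mul w w' hw hw' =>
    rw [map_mul]
    refine AddSubgroup.iSup_induction (gr Q n) (C := fun a => a * mk Q n w' ∈ ⨆ d, gr Q n d) hw
      (fun d a ha => ?_) (by simp) (fun x y hx hy => by rw [add_mul]; exact add_mem hx hy)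
    exact AddSubgroup.iSup_induction (gr Q n) (C := fun b => a * b ∈ ⨆ d, gr Q n d) hw'
      (fun d b hb => hhom (.mul ha hb)) (by simp)
      (fun x y hx hy => by rw [mul_add]; exact add_mem hx hy)
  | add w w' hw hw' => rw [map_add]; exact add_mem hw hw'

theorem gr_internal (n : ℕ) : DirectSum.IsInternal (gr Q n) :=
  isInternal_of_coaction _
    ((AddMonoidAlgebra.coeffAddEquiv (R := KLR Q n) (M := ℤ)).toAddMonoidHom.comp
      (δ Q n).toRingHom.toAddMonoidHom)
    (fun _ _ hm => congrArg AddMonoidAlgebra.coeff (δ_of_homog Q hm)) (mem_iSup_gr Q)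

noncomputable instance (n : ℕ) : GradedRing (gr Q n) where
  one_mem := by
    have := IsHomog.scalar (Q := Q) (n := n) (SetLike.GradedOne.one_mem (A := 𝓀))
    rwa [map_one] at this
  mul_mem _ _ _ _ := .mul
  toDecomposition := (gr_internal Q n).chooseDecomposition

end Grading

/-! #### The inclusion `R(n) → R(n + 1)` -/

/-- The word `(ν, i)`. -/
def snocW {J : Type*} (ν : Fin n → J) (i : J) : Fin (n + 1) → J := Fin.snoc ν i

@[simp] theorem snocW_castSucc {J : Type*} (ν : Fin n → J) (i : J) (l : Fin n) :
    snocW ν i l.castSucc = ν l := Fin.snoc_castSucc (α := fun _ => J) _ _ _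

@[simp] theorem snocW_last {J : Type*} (ν : Fin n → J) (i : J) : snocW ν i (Fin.last n) = i :=
  Fin.snoc_last (α := fun _ => J) _ _

theorem snocW_inj {J : Type*} {ν ν' : Fin n → J} {i i' : J} : snocW ν i = snocW ν' i' ↔ ν = ν' ∧ i = i' := by
  refine ⟨fun h => ⟨funext fun l => ?_, ?_⟩, fun h => by rw [h.1, h.2]⟩
  · simpa using congrFun h l.castSucc
  · simpa using congrFun h (Fin.last n)

theorem snocW_init {J : Type*} (ν : Fin (n + 1) → J) : snocW (fun l => ν l.castSucc) (ν (Fin.last n)) = ν :=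
  Fin.snoc_init_self ν

theorem sSwap_castSucc (l : ℕ) (h : l + 1 < n) (m : Fin n) :
    sSwap l (Nat.lt_succ_of_lt h) m.castSucc = (sSwap l h m).castSucc := by
  by_cases h1 : m = pos l (Nat.lt_of_succ_lt h)
  · subst h1
    exact (sSwap_left l (Nat.lt_succ_of_lt h)).trans (congrArg Fin.castSucc (sSwap_left l h).symm)
  · by_cases h2 : m = pos (l + 1) h
    · subst h2
      exact (sSwap_right l (Nat.lt_succ_of_lt h)).trans
        (congrArg Fin.castSucc (sSwap_right l h).symm)
    · rw [Fin.ext_iff] at h1 h2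
      exact (sSwap_of_ne l (Nat.lt_succ_of_lt h) m.1 (Nat.lt_succ_of_lt m.2) h1 h2).trans
        (congrArg Fin.castSucc (sSwap_of_ne l h m.1 m.2 h1 h2).symm)

theorem snocW_swap {J : Type*} (ν : Fin n → J) (i : J) (l : ℕ) (h : l + 1 < n) :
    snocW ν i ∘ sSwap l (Nat.lt_succ_of_lt h) = snocW (ν ∘ sSwap l h) i := by
  funext m
  refine Fin.lastCases ?_ (fun m => ?_) m
  · have : sSwap l (Nat.lt_succ_of_lt h) (Fin.last n) = Fin.last n :=
      sSwap_of_ne l (Nat.lt_succ_of_lt h) n (Nat.lt_succ_self n) (by omega) (by omega)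
    rw [Function.comp_apply, this, snocW_last, snocW_last]
  · rw [Function.comp_apply, sSwap_castSucc, snocW_castSucc, snocW_castSucc, Function.comp_apply]

/-- The image `∑_i e(ν, i)` of `e(ν) ⊗ 1` in `R(n + 1)`. -/
noncomputable def eExt (ν : Fin n → I) : KLR Q (n + 1) := ∑ i : I, e Q (snocW ν i)

/-- The inclusion on generators. -/
noncomputable def incl₀ (n : ℕ) : FreeAlgebra k (KLRGen I n) →ₐ[k] KLR Q (n + 1) :=
  FreeAlgebra.lift k fun g =>
    match g with
    | .e ν => eExt Q ν
    | .x l => x Q l.castSucc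
    | .τ l h => τ Q l (Nat.lt_succ_of_lt h)

theorem incl₀_e (ν : Fin n → I) : incl₀ Q n (gE k ν) = eExt Q ν := FreeAlgebra.lift_ι_apply _ _

theorem incl₀_x (l : Fin n) : incl₀ Q n (gX I k l) = x Q l.castSucc := FreeAlgebra.lift_ι_apply _ _

theorem incl₀_τ (l : ℕ) (h : l + 1 < n) :
    incl₀ Q n (gT I k l h) = τ Q l (Nat.lt_succ_of_lt h) := FreeAlgebra.lift_ι_apply _ _

theorem incl₀_rel {w w' : FreeAlgebra k (KLRGen I n)} (h : KLRRel Q n w w') :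
    incl₀ Q n w = incl₀ Q n w' := by
  have sw : ∀ (ν : Fin n → I) (i : I) (l : ℕ) (h : l < n),
    snocW ν i (pos l (Nat.lt_succ_of_lt h)) = ν (pos l h) := fun ν i l h => snocW_castSucc ν i (pos l h)
  cases h with
  | e_mul ν ν' =>
    rw [map_mul, incl₀_e, incl₀_e, apply_ite (incl₀ Q n), map_zero, incl₀_e]
    simp only [eExt, Finset.sum_mul_sum, e_mul, snocW_inj]
    split_ifs with h
    · simp [h]
    · simp [h]
  | sum_e =>
    rw [map_sum, map_one, ← sum_e]
    simp only [incl₀_e, eExt]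
    rw [← Fintype.sum_prod_type']
    exact Fintype.sum_bijective (fun p : (Fin n → I) × I => snocW p.1 p.2)
      ⟨fun p q h => Prod.ext (snocW_inj.1 h).1 (snocW_inj.1 h).2, fun ν => ⟨(_, _), snocW_init ν⟩⟩
      _ _ fun _ => rfl
  | x_comm l m => rw [map_mul, map_mul, incl₀_x, incl₀_x, x_comm]
  | x_e l ν =>
    rw [map_mul, map_mul, incl₀_x, incl₀_e, eExt, Finset.mul_sum, Finset.sum_mul]
    exact Finset.sum_congr rfl fun i _ => x_e Q _ _
  | τ_e l h ν =>
    rw [map_mul, map_mul, incl₀_τ, incl₀_e, incl₀_e, eExt, eExt, Finset.mul_sum, Finset.sum_mul]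
    refine Finset.sum_congr rfl fun i _ => ?_
    rw [τ_e, snocW_swap]
  | τ_comm l m hl hm hlm => rw [map_mul, map_mul, incl₀_τ, incl₀_τ, τ_comm Q _ _ _ _ hlm]
  | τ_sq l h ν =>
    rw [map_mul, map_mul, map_mul, map_evalTwo, incl₀_τ, incl₀_e, incl₀_x, incl₀_x, eExt,
      Finset.mul_sum, Finset.mul_sum]
    refine Finset.sum_congr rfl fun i _ => ?_
    rw [τ_sq, sw _ _ _ (Nat.lt_of_succ_lt h), sw _ _ _ h]
    rfl
  | τ_x l h m ν =>
    rw [map_mul, map_sub, map_mul, map_mul, incl₀_τ, incl₀_e, incl₀_x, incl₀_x, eExt,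
      Finset.mul_sum, ← sSwap_castSucc]
    simp only [τ_x]
    have c1 : (m.castSucc = pos l (Nat.lt_succ_of_lt (Nat.lt_of_succ_lt h))) =
      (m = pos l (Nat.lt_of_succ_lt h)) := by simp [Fin.ext_iff]
    have c2 : (m.castSucc = pos (l + 1) (Nat.lt_succ_of_lt h)) = (m = pos (l + 1) h) := by
      simp [Fin.ext_iff]
    simp only [sw _ _ _ (Nat.lt_of_succ_lt h), sw _ _ _ h, c1, c2]
    split_ifs
    · rw [map_neg, incl₀_e, eExt, Finset.sum_neg_distrib]
    · rw [incl₀_e, eExt]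
    · simp
    · simp
  | braid l h ν =>
    rw [map_mul, map_sub, map_mul, map_mul, map_mul, map_mul, incl₀_τ, incl₀_τ, incl₀_e, eExt,
      Finset.mul_sum]
    have hb : ∀ i : I, _ := fun i => braid Q l (Nat.lt_succ_of_lt h) (snocW ν i)
    simp only [sw _ _ l (by omega), sw _ _ (l + 1) (by omega), sw _ _ (l + 2) h] at hb
    refine (Finset.sum_congr rfl fun i _ => hb i).trans ?_
    split_ifs
    · rw [map_mul, map_evalDivDiff, incl₀_x, incl₀_x, incl₀_x, incl₀_e, eExt, Finset.mul_sum]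
      rfl
    · simp

/-- The inclusion `R(n) → R(n + 1)`, `a ↦ a ⊗ 1`. -/
noncomputable def incl (n : ℕ) : KLR Q n →ₐ[k] KLR Q (n + 1) :=
  RingQuot.liftAlgHom k ⟨incl₀ Q n, fun _ _ h => incl₀_rel Q h⟩

theorem incl_mk (w : FreeAlgebra k (KLRGen I n)) : incl Q n (mk Q n w) = incl₀ Q n w :=
  RingQuot.liftAlgHom_mkAlgHom_apply _ _ _ _

theorem incl_e (ν : Fin n → I) : incl Q n (e Q ν) = ∑ i : I, e Q (snocW ν i) :=
  (incl_mk Q _).trans (incl₀_e Q ν)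

theorem incl_x (l : Fin n) : incl Q n (x Q l) = x Q l.castSucc := (incl_mk Q _).trans (incl₀_x Q l)

theorem incl_τ (l : ℕ) (h : l + 1 < n) : incl Q n (τ Q l h) = τ Q l (Nat.lt_succ_of_lt h) :=
  (incl_mk Q _).trans (incl₀_τ Q l h)

theorem IsHomog.sum {ι : Type*} {s : Finset ι} {f : ι → KLR Q n} {d : ℤ}
    (h : ∀ i ∈ s, IsHomog Q d (f i)) : IsHomog Q d (∑ i ∈ s, f i) :=
  sum_mem (S := gr Q n d) h

theorem incl_homog {d : ℤ} {a : KLR Q n} (h : IsHomog Q d a) : IsHomog Q d (incl Q n a) := by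
  induction h with
  | scalar hc => rw [AlgHom.commutes]; exact .scalar hc
  | e ν => rw [incl_e]; exact .sum Q fun i _ => .e _
  | x l ν =>
    rw [map_mul, incl_e, incl_x, Finset.mul_sum]
    refine .sum Q fun i _ => ?_
    have := IsHomog.x (Q := Q) l.castSucc (snocW ν i)
    rwa [snocW_castSucc] at this
  | τ l h ν =>
    rw [map_mul, incl_e, incl_τ, Finset.mul_sum]
    refine .sum Q fun i _ => ?_
    have := IsHomog.τ (Q := Q) l (Nat.lt_succ_of_lt h) (snocW ν i)
    rwa [show snocW ν i (pos l _) = ν (pos l (Nat.lt_of_succ_lt h)) from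
        snocW_castSucc ν i (pos l _),
      show snocW ν i (pos (l + 1) _) = ν (pos (l + 1) h) from
        snocW_castSucc ν i (pos (l + 1) _)] at this
  | zero d => rw [map_zero]; exact .zero d
  | add _ _ ha hb => rw [map_add]; exact .add ha hb
  | neg _ ha => rw [map_neg]; exact .neg ha
  | mul _ _ ha hb => rw [map_mul]; exact .mul ha hb

/-! #### The algebras `R(β)` -/

/-- `∑ e(ν)` over the words `ν` in a set `s`. -/
noncomputable def eSum (s : Finset (Fin n → I)) : KLR Q n := ∑ ν ∈ s, e Q ν

theorem eSum_mul (s t : Finset (Fin n → I)) : eSum Q s * eSum Q t = eSum Q (s ∩ t) := by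
  rw [eSum, eSum, eSum, Finset.sum_mul_sum]
  simp only [e_mul]
  rw [← Finset.filter_mem_eq_inter, Finset.sum_filter]
  exact Finset.sum_congr rfl fun ν _ => Finset.sum_ite_eq _ _ _

theorem eSum_homog (s : Finset (Fin n → I)) : IsHomog Q 0 (eSum Q s) := .sum Q fun ν _ => .e ν

open Classical in
/-- The set `I^β` of the words `ν` of length `n` with `α_{ν_1} + ⋯ + α_{ν_n} = β`. -/
noncomputable def words (C : CartanDatum I P) (n : ℕ) (β : P) : Finset (Fin n → I) :=
  Finset.univ.filter fun ν => ∑ l, C.α (ν l) = β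

/-- The idempotent `e(β)` of `R(n)`. -/
noncomputable def eβ (n : ℕ) (β : P) : KLR Q n := eSum Q (words C n β)

theorem eβ_idem (n : ℕ) (β : P) : IsIdempotentElem (eβ Q n β) := by
  rw [IsIdempotentElem, eβ, eSum_mul, Finset.inter_self]

open Classical in
/-- The idempotent `e(β - α_i, i)`: the sum of the `e(ν)` over the words `ν` in `I^β` with last
letter `i`. -/
noncomputable def eβi (n : ℕ) (β : P) (i : I) : KLR Q (n + 1) :=
  eSum Q ((words C (n + 1) β).filter fun ν => ν (Fin.last n) = i)

theorem eβ_mul_eβi (n : ℕ) (β : P) (i : I) : eβ Q (n + 1) β * eβi Q n β i = eβi Q n β i := by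
  rw [eβ, eβi, eSum_mul, Finset.inter_eq_right.2 (Finset.filter_subset _ _)]

theorem eβi_mul_eβ (n : ℕ) (β : P) (i : I) : eβi Q n β i * eβ Q (n + 1) β = eβi Q n β i := by
  rw [eβ, eβi, eSum_mul, Finset.inter_eq_left.2 (Finset.filter_subset _ _)]

theorem eβi_idem (n : ℕ) (β : P) (i : I) : eβi Q n β i * eβi Q n β i = eβi Q n β i := by
  rw [eβi, eSum_mul, Finset.inter_self]

theorem x_mul_eSum (l : Fin n) (s : Finset (Fin n → I)) : x Q l * eSum Q s = eSum Q s * x Q l := by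
  rw [eSum, Finset.mul_sum, Finset.sum_mul]
  exact Finset.sum_congr rfl fun ν _ => x_e Q l ν

theorem τ_mul_eSum (l : ℕ) (h : l + 1 < n) (s : Finset (Fin n → I))
    (hs : ∀ ν ∈ s, ν ∘ sSwap l h ∈ s) : τ Q l h * eSum Q s = eSum Q s * τ Q l h := by
  rw [eSum, Finset.mul_sum, Finset.sum_mul]
  refine Finset.sum_bij' (fun ν _ => ν ∘ sSwap l h) (fun ν _ => ν ∘ sSwap l h) hs hs ?_ ?_
    fun ν _ => τ_e Q l h ν
  all_goals
    intro ν _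
    funext m
    simp only [Function.comp_apply, sSwap_sSwap]

theorem words_swap (l : ℕ) (h : l + 1 < n) (β : P) (ν : Fin n → I) (hν : ν ∈ words C n β) :
    ν ∘ sSwap l h ∈ words C n β := by
  simp only [words, Finset.mem_filter, Finset.mem_univ, true_and] at hν ⊢
  rw [← hν]
  exact Equiv.sum_comp (sSwap l h) fun m => C.α (ν m)

theorem commute_induction {B : Type*} [Ring B] [Algebra k B] (f : KLR Q n →ₐ[k] B) (b : B)
    (he : ∀ ν, f (e Q ν) * b = b * f (e Q ν)) (hx : ∀ l, f (x Q l) * b = b * f (x Q l))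
    (hτ : ∀ l h, f (τ Q l h) * b = b * f (τ Q l h)) (a : KLR Q n) : f a * b = b * f a := by
  obtain ⟨w, rfl⟩ := mk_surjective Q n a
  induction w using FreeAlgebra.induction with
  | grade0 c => rw [AlgHom.commutes, AlgHom.commutes, Algebra.commutes]
  | grade1 g =>
    cases g with
    | e ν => exact he ν
    | x l => exact hx l
    | τ l h => exact hτ l h
  | mul w w' hw hw' => rw [map_mul, map_mul, mul_assoc, hw', ← mul_assoc, hw, mul_assoc]
  | add w w' hw hw' => rw [map_add, map_add, add_mul, mul_add, hw, hw']

theorem eβ_central (β : P) (a : KLR Q n) : a * eβ Q n β = eβ Q n β * a :=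
  commute_induction Q (AlgHom.id k _) (eβ Q n β)
    (fun ν => by
      have : e Q ν = eSum Q {ν} := (Finset.sum_singleton _ _).symm
      simp only [AlgHom.id_apply]
      rw [this, eβ, eSum_mul, eSum_mul, Finset.inter_comm])
    (fun l => x_mul_eSum Q l _) (fun l h => τ_mul_eSum Q l h _ (words_swap l h β)) a

theorem incl_mul_eβi (β : P) (i : I) (a : KLR Q n) :
    incl Q n a * eβi Q n β i = eβi Q n β i * incl Q n a := by
  classical
  refine commute_induction Q (incl Q n) (eβi Q n β i) (fun ν => ?_) (fun l => ?_) (fun l h => ?_) a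
  · have : incl Q n (e Q ν) = eSum Q (Finset.univ.image (snocW ν)) := by
      rw [incl_e, eSum, Finset.sum_image]
      intro a _ b _ hab
      exact (snocW_inj.1 hab).2
    rw [this, eβi, eSum_mul, eSum_mul, Finset.inter_comm]
  · rw [incl_x]; exact x_mul_eSum Q _ _
  · rw [incl_τ]
    refine τ_mul_eSum Q _ _ _ fun ν hν => ?_
    rw [Finset.mem_filter] at hν ⊢
    refine ⟨words_swap _ _ _ _ hν.1, ?_⟩
    rw [← hν.2, Function.comp_apply]
    exact congrArg ν (sSwap_of_ne l (Nat.lt_succ_of_lt h) n (Nat.lt_succ_self n) (by omega)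
      (by omega))

theorem incl_eβ_mul_eβi (β β' : P) (i : I) (h : β + C.α i = β') :
    incl Q n (eβ Q n β) * eβi Q n β' i = eβi Q n β' i := by
  classical
  have : incl Q n (eβ Q n β) =
      eSum Q ((words C n β ×ˢ (Finset.univ : Finset I)).image fun p => snocW p.1 p.2) := by
    rw [eβ, eSum, map_sum, eSum, Finset.sum_image, Finset.sum_product]
    · exact Finset.sum_congr rfl fun ν _ => incl_e Q ν
    · intro p _ q _ hpq
      exact Prod.ext (snocW_inj.1 hpq).1 (snocW_inj.1 hpq).2
  rw [this, eβi, eSum_mul]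
  congr 1
  refine Finset.inter_eq_right.2 fun ν hν => ?_
  simp only [words, Finset.mem_filter, Finset.mem_univ, true_and] at hν
  rw [Finset.mem_image]
  refine ⟨(fun l => ν l.castSucc, ν (Fin.last n)), ?_, snocW_init ν⟩
  simp only [words, Finset.mem_product, Finset.mem_filter, Finset.mem_univ, true_and, and_true]
  have h1 := hν.1
  rw [Fin.sum_univ_castSucc, hν.2, ← h] at h1
  exact add_right_cancel h1

end KLR

/-- The Khovanov-Lauda-Rouquier algebra `R(β) = R(n) e(β) = e(β) R(n) e(β)` at `β`, where `n` is
the height of `β`; it is a ring with unit `e(β)`. (It is the zero ring if there is no word of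
length `n` and weight `β`.) -/
def KLRβ (Q : KLRDatum C 𝓀) (n : ℕ) (β : P) : Type (max u v) := (KLR.eβ_idem Q n β).Corner

namespace KLRβ

open KLR

variable (Q : KLRDatum C 𝓀) {n : ℕ}

noncomputable instance (n : ℕ) (β : P) : Ring (KLRβ Q n β) :=
  inferInstanceAs (Ring (KLR.eβ_idem Q n β).Corner)

variable {β : P}

/-- The underlying element of `R(n)`. -/
def val (a : KLRβ Q n β) : KLR Q n := Subtype.val a

theorem val_injective : Function.Injective (val Q : KLRβ Q n β → KLR Q n) := Subtype.val_injective

theorem val_mul (a b : KLRβ Q n β) : val Q (a * b) = val Q a * val Q b := rfl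
theorem val_add (a b : KLRβ Q n β) : val Q (a + b) = val Q a + val Q b := rfl
theorem val_zero : val Q (0 : KLRβ Q n β) = 0 := rfl
theorem val_one : val Q (1 : KLRβ Q n β) = eβ Q n β := rfl

theorem eβ_mul_val (a : KLRβ Q n β) : eβ Q n β * val Q a = val Q a :=
  ((Subsemigroup.mem_corner_iff (eβ_idem Q n β)).1 a.2).1

theorem val_mul_eβ (a : KLRβ Q n β) : val Q a * eβ Q n β = val Q a :=
  ((Subsemigroup.mem_corner_iff (eβ_idem Q n β)).1 a.2).2

/-- The projection `R(n) → R(β)`, `a ↦ e(β) a e(β) = a e(β)`. -/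
noncomputable def proj (β : P) (a : KLR Q n) : KLRβ Q n β := ⟨eβ Q n β * a * eβ Q n β, a, rfl⟩

theorem val_proj (a : KLR Q n) : val Q (proj Q β a) = eβ Q n β * a * eβ Q n β := rfl

theorem proj_val (a : KLRβ Q n β) : proj Q β (val Q a) = a :=
  val_injective Q (by rw [val_proj, eβ_mul_val, val_mul_eβ])

/-- The inclusion of `R(β)` in `R(n)`, as a map of additive groups. -/
def valHom (n : ℕ) (β : P) : KLRβ Q n β →+ KLR Q n where
  toFun := val Q
  map_zero' := rfl
  map_add' _ _ := rfl

/-- The homogeneous part `R(β)_d = R(β) ∩ R(n)_d`. -/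
noncomputable def gr (n : ℕ) (β : P) (d : ℤ) : AddSubgroup (KLRβ Q n β) :=
  (KLR.gr Q n d).comap (valHom Q n β)

theorem gr_internal [GradedRing 𝓀] (n : ℕ) (β : P) : DirectSum.IsInternal (gr Q n β) := by
  refine isInternal_comap (KLR.gr_internal Q n) (valHom Q n β) (val_injective Q) fun a d => ?_
  let f : KLR Q n →+ KLR Q n :=
    (AddMonoidHom.mulRight (eβ Q n β)).comp (AddMonoidHom.mulLeft (eβ Q n β))
  have h := coaction_map (KLR.gr_internal Q n) f (fun e m hm => by
    have := IsHomog.mul (.mul (eSum_homog Q (words C n β)) hm) (eSum_homog Q (words C n β))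
    rwa [zero_add, add_zero] at this) (val Q a) d
  have hf : f (val Q a) = val Q a := by
    change eβ Q n β * val Q a * eβ Q n β = _
    rw [eβ_mul_val, val_mul_eβ]
  rw [hf] at h
  exact ⟨proj Q β _, h.symm⟩

noncomputable instance [GradedRing 𝓀] (n : ℕ) (β : P) : GradedRing (gr Q n β) where
  one_mem := eSum_homog Q _
  mul_mem _ _ _ _ ha hb := IsHomog.mul ha hb
  toDecomposition := (gr_internal Q n β).chooseDecomposition

/-- The ring homomorphism `R(β) → R(β')`, `a ↦ (a ⊗ 1) e(β, i)`, where `β' = β + α_i`. It sends the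
unit to `e(β, i)`. -/
noncomputable def incl (i : I) (n : ℕ) (β β' : P) : KLRβ Q n β →ₙ+* KLRβ Q (n + 1) β' where
  toFun a := ⟨KLR.incl Q n (val Q a) * eβi Q n β' i, by
    rw [Subsemigroup.mem_corner_iff (eβ_idem Q (n + 1) β')]
    constructor
    · rw [incl_mul_eβi, ← mul_assoc, eβ_mul_eβi]
    · rw [mul_assoc, eβi_mul_eβ]⟩
  map_zero' := val_injective Q (by
    change KLR.incl Q n 0 * _ = 0
    rw [map_zero, zero_mul])
  map_add' a b := val_injective Q (by
    change KLR.incl Q n (val Q a + val Q b) * _ = KLR.incl Q n (val Q a) * _ + KLR.incl Q n (val Q b) * _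
    rw [map_add, add_mul])
  map_mul' a b := val_injective Q (by
    change KLR.incl Q n (val Q a * val Q b) * _ =
      (KLR.incl Q n (val Q a) * _) * (KLR.incl Q n (val Q b) * _)
    rw [map_mul, mul_assoc, mul_assoc, ← mul_assoc (eβi Q n β' i), ← incl_mul_eβi Q β' i (val Q b),
      mul_assoc (KLR.incl Q n (val Q b)), eβi_idem])

theorem val_incl (i : I) (β' : P) (a : KLRβ Q n β) :
    val Q (incl Q i n β β' a) = KLR.incl Q n (val Q a) * eβi Q n β' i := rfl

theorem val_incl_one (i : I) (β' : P) (h : β + C.α i = β') :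
    val Q (incl Q i n β β' 1) = eβi Q n β' i := by
  rw [val_incl, val_one, incl_eβ_mul_eβi Q β β' i h]

theorem incl_mem (i : I) (β' : P) {d : ℤ} {a : KLRβ Q n β} (ha : a ∈ gr Q n β d) :
    incl Q i n β β' a ∈ gr Q (n + 1) β' d := by
  have := IsHomog.mul (incl_homog Q ha) 
    (show IsHomog Q 0 (eβi Q n β' i) from eSum_homog Q _)
  rwa [add_zero] at this

end KLRβ

/-! ### Cyclotomic quotients -/

namespace CartanDatum

/-- `Λ` is a dominant integral weight. -/
def IsDominant (C : CartanDatum I P) (Λ : P) : Prop := ∀ i, 0 ≤ C.h i Λ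

end CartanDatum

/-- The coefficients `c_{i;m} ∈ k_{m (α_i | α_i)}`, `c_{i;0} = 1`, of the monic polynomials
`a_i^Λ(u) = ∑_{m ≤ ⟨h_i, Λ⟩} c_{i;m} u^{⟨h_i, Λ⟩ - m}`. -/
structure CyclotomicDatum (C : CartanDatum I P) {k : Type u} [CommRing k]
    (𝓀 : ℤ → AddSubgroup k) (Λ : P) where
  c : I → ℕ → k
  c_zero : ∀ i, c i 0 = 1
  c_mem : ∀ i (m : ℕ), m ≤ (C.h i Λ).toNat → c i m ∈ 𝓀 (m * C.form i i)

namespace CyclotomicDatum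

variable {Λ : P} (a : CyclotomicDatum C 𝓀 Λ)

/-- The value `a_i^Λ(y)`. -/
noncomputable def eval {A : Type*} [Ring A] [Algebra k A] (i : I) (y : A) : A :=
  ∑ m ∈ Finset.range ((C.h i Λ).toNat + 1), a.c i m • y ^ ((C.h i Λ).toNat - m)

end CyclotomicDatum

namespace KLR

variable (Q : KLRDatum C 𝓀) {n : ℕ} {Λ : P} (a : CyclotomicDatum C 𝓀 Λ)

/-- The element `x[l] = ∑_ν a_{ν_l}^Λ(x_l) e(ν)` of `R(n)`. -/
noncomputable def cyc (l : Fin n) : KLR Q n := ∑ ν : Fin n → I, a.eval (ν l) (x Q l) * e Q ν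

theorem incl_cyc (l : Fin n) : incl Q n (cyc Q a l) = cyc Q a l.castSucc := by
  have ev : ∀ i, incl Q n (a.eval i (x Q l)) = a.eval i (x Q l.castSucc) := fun i => by
    simp [CyclotomicDatum.eval, incl_x]
  rw [cyc, cyc, map_sum]
  simp only [map_mul, ev, incl_e, Finset.mul_sum]
  rw [← Fintype.sum_prod_type']
  refine Fintype.sum_bijective (fun p : (Fin n → I) × I => snocW p.1 p.2)
      ⟨fun p q h => Prod.ext (snocW_inj.1 h).1 (snocW_inj.1 h).2, fun ν => ⟨(_, _), snocW_init ν⟩⟩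
      _ _ fun p => by rw [snocW_castSucc]

theorem x_pow_homog (l : Fin n) (ν : Fin n → I) (p : ℕ) :
    IsHomog Q (p * C.form (ν l) (ν l)) (x Q l ^ p * e Q ν) := by
  induction p with
  | zero => simpa using IsHomog.e ν
  | succ p ih =>
    have h := IsHomog.mul (IsHomog.x l ν) ih
    have h1 : x Q l * e Q ν * (x Q l ^ p * e Q ν) = x Q l ^ (p + 1) * e Q ν := by
      have hc : Commute (e Q ν) (x Q l ^ p) := (Commute.pow_left (x_e Q l ν) p).symm
      rw [mul_assoc, ← mul_assoc (e Q ν), hc.eq, mul_assoc, e_mul, if_pos rfl, ← mul_assoc,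
        pow_succ']
    rw [h1] at h
    convert h using 1
    push_cast; ring

theorem eval_homog [GradedRing 𝓀] (l : Fin n) (ν : Fin n → I) :
    IsHomog Q ((C.h (ν l) Λ).toNat * C.form (ν l) (ν l)) (a.eval (ν l) (x Q l) * e Q ν) := by
  rw [CyclotomicDatum.eval, Finset.sum_mul]
  refine .sum Q fun m hm => ?_
  rw [Finset.mem_range, Nat.lt_succ_iff] at hm
  rw [smul_mul_assoc, Algebra.smul_def]
  convert IsHomog.mul (.scalar (a.c_mem _ m hm)) (x_pow_homog Q l ν ((C.h (ν l) Λ).toNat - m))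
    using 1
  rw [Nat.cast_sub hm]; ring

end KLR

section QuotientGrading

variable {A : Type*} [Ring A] (𝒜 : ℤ → AddSubgroup A) (J : TwoSidedIdeal A)

/-- The images of the homogeneous parts of `A` in `A / J`. -/
def quotientGr (d : ℤ) : AddSubgroup J.ringCon.Quotient :=
  (𝒜 d).map J.ringCon.mk'.toAddMonoidHom

theorem laurentHom_eq [GradedRing 𝒜] {B : Type*} [Ring B] (f : A →+* B) (a : A) (d : ℤ) :
    (laurentHom 𝒜 f a).coeff d = f (gradingCoaction (gradedRing_isInternal (𝒜 := 𝒜)) a d) := by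
  refine grading_induction (p := fun a => (laurentHom 𝒜 f a).coeff d =
    f (gradingCoaction (gradedRing_isInternal (𝒜 := 𝒜)) a d)) (gradedRing_isInternal (𝒜 := 𝒜))
    (fun e a ha => ?_) (by simp) (fun x y hx hy => ?_) a
  · rw [laurentHom_of_mem f ha, gradingCoaction_of_mem _ ha]
    change Finsupp.single e (f a) d = _
    rw [Finsupp.single_apply, Finsupp.single_apply]
    split_ifs <;> simp
  · rw [map_add, map_add, Finsupp.add_apply, map_add, ← hx, ← hy]
    rfl

theorem quotientGr_internal [GradedRing 𝒜]
    (hJ : J ≤ TwoSidedIdeal.ker (laurentHom 𝒜 J.ringCon.mk')) :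
    DirectSum.IsInternal (quotientGr 𝒜 J) := by
  refine isInternal_map (gradedRing_isInternal (𝒜 := 𝒜)) J.ringCon.mk'.toAddMonoidHom
    J.ringCon.mk'_surjective fun m hm d => ?_
  have hm' : m ∈ J := by
    rw [← TwoSidedIdeal.ker_ringCon_mk' J, TwoSidedIdeal.mem_ker]
    exact hm
  have := (TwoSidedIdeal.mem_ker _).1 (hJ hm')
  refine (laurentHom_eq 𝒜 J.ringCon.mk' m d).symm.trans ?_
  rw [this]
  rfl

end QuotientGrading

namespace KLRβ

open KLR

variable (Q : KLRDatum C 𝓀) {n : ℕ} {Λ : P} (a : CyclotomicDatum C 𝓀 Λ)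

/-- The two-sided ideal `R(β) x[1] R(β)` of `R(β)`; it is `0` for `n = 0`. -/
noncomputable def cycIdeal (n : ℕ) (β : P) : TwoSidedIdeal (KLRβ Q n β) :=
  TwoSidedIdeal.span {y | ∃ h : 0 < n, y = proj Q β (cyc Q a (pos 0 h))}

end KLRβ

/-- The cyclotomic Khovanov-Lauda-Rouquier algebra `R^Λ(β) = R(β) / R(β) x[1] R(β)`, where `n` is
the height of `β`. -/
def CycKLR (Q : KLRDatum C 𝓀) {Λ : P} (a : CyclotomicDatum C 𝓀 Λ) (n : ℕ) (β : P) :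
    Type (max u v) := (KLRβ.cycIdeal Q a n β).ringCon.Quotient

namespace CycKLR

open KLR KLRβ

variable (Q : KLRDatum C 𝓀) {Λ : P} (a : CyclotomicDatum C 𝓀 Λ)

noncomputable instance (n : ℕ) (β : P) : Ring (CycKLR Q a n β) :=
  inferInstanceAs (Ring (KLRβ.cycIdeal Q a n β).ringCon.Quotient)

/-- The projection `R(β) → R^Λ(β)`. -/
noncomputable def mk (n : ℕ) (β : P) : KLRβ Q n β →+* CycKLR Q a n β :=
  (KLRβ.cycIdeal Q a n β).ringCon.mk'

theorem mk_surjective (n : ℕ) (β : P) : Function.Surjective (mk Q a n β) :=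
  (KLRβ.cycIdeal Q a n β).ringCon.mk'_surjective

theorem mk_eq_zero {n : ℕ} {β : P} {y : KLRβ Q n β} :
    mk Q a n β y = 0 ↔ y ∈ cycIdeal Q a n β := by
  rw [← TwoSidedIdeal.ker_ringCon_mk' (cycIdeal Q a n β), TwoSidedIdeal.mem_ker]
  rfl

/-- The homogeneous part `R^Λ(β)_d`, the image of `R(β)_d`. -/
noncomputable def gr (n : ℕ) (β : P) (d : ℤ) : AddSubgroup (CycKLR Q a n β) :=
  (KLRβ.gr Q n β d).map (mk Q a n β).toAddMonoidHom

theorem cycIdeal_le [GradedRing 𝓀] (n : ℕ) (β : P) :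
    cycIdeal Q a n β ≤ TwoSidedIdeal.ker (laurentHom (KLRβ.gr Q n β)
      (cycIdeal Q a n β).ringCon.mk') := by
  rw [cycIdeal, TwoSidedIdeal.span_le]
  rintro _ ⟨h, rfl⟩
  rw [SetLike.mem_coe, TwoSidedIdeal.mem_ker]
  set l := pos 0 h
  -- the generator is the sum of homogeneous elements of the ideal
  have hsum : proj Q β (cyc Q a l) =
      ∑ ν ∈ words C n β, proj Q β (a.eval (ν l) (x Q l) * e Q ν) := by
    apply val_injective Q
    change _ = valHom Q n β _
    rw [map_sum]
    change eβ Q n β * cyc Q a l * eβ Q n β =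
      ∑ ν ∈ words C n β, eβ Q n β * (a.eval (ν l) (x Q l) * e Q ν) * eβ Q n β
    rw [← Finset.sum_mul, ← Finset.mul_sum, mul_assoc, mul_assoc]
    congr 1
    rw [Finset.sum_mul, cyc, Finset.sum_mul]
    symm
    refine Finset.sum_subset (Finset.subset_univ _) fun ν _ hν => ?_
    have : e Q ν * eβ Q n β = 0 := by
      rw [eβ, eSum, Finset.mul_sum]
      refine Finset.sum_eq_zero fun ν' hν' => ?_
      rw [e_mul, if_neg]
      rintro rfl
      exact hν hν'
    rw [mul_assoc, this, mul_zero]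
  rw [hsum, map_sum]
  refine Finset.sum_eq_zero fun ν hν => ?_
  have hmem : proj Q β (a.eval (ν l) (x Q l) * e Q ν) ∈ KLRβ.gr Q n β
      ((C.h (ν l) Λ).toNat * C.form (ν l) (ν l)) := by
    have := IsHomog.mul (.mul (eSum_homog Q (words C n β)) (eval_homog Q a l ν))
      (eSum_homog Q (words C n β))
    rwa [zero_add, add_zero] at this
  rw [laurentHom_of_mem _ hmem]
  have hz : mk Q a n β (proj Q β (a.eval (ν l) (x Q l) * e Q ν)) = 0 := by
    rw [mk_eq_zero]
    have : proj Q β (a.eval (ν l) (x Q l) * e Q ν) =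
        proj Q β (cyc Q a l) * proj Q β (e Q ν) := by
      apply val_injective Q
      rw [val_mul, val_proj, val_proj, val_proj]
      have h1 : cyc Q a l * e Q ν = a.eval (ν l) (x Q l) * e Q ν := by
        rw [cyc, Finset.sum_mul, Finset.sum_eq_single ν]
        · rw [mul_assoc, e_mul, if_pos rfl]
        · intro ν' _ hne
          rw [mul_assoc, e_mul, if_neg hne, mul_zero]
        · simp
      have hi : eβ Q n β * eβ Q n β = eβ Q n β := eβ_idem Q n β
      rw [← h1, ← eβ_central Q β (cyc Q a l), mul_assoc (cyc Q a l), hi, ← eβ_central Q β (e Q ν),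
        mul_assoc (e Q ν), hi, mul_assoc (cyc Q a l), ← eβ_central Q β (e Q ν * eβ Q n β),
        mul_assoc (e Q ν), hi, ← eβ_central Q β (cyc Q a l * e Q ν), mul_assoc, mul_assoc, hi]
    rw [this]
    exact TwoSidedIdeal.mul_mem_right _ _ _ (TwoSidedIdeal.subset_span ⟨h, rfl⟩)
  exact (congrArg (AddMonoidAlgebra.single _) hz).trans (AddMonoidAlgebra.single_zero _)

theorem gr_internal [GradedRing 𝓀] (n : ℕ) (β : P) : DirectSum.IsInternal (gr Q a n β) :=
  quotientGr_internal (KLRβ.gr Q n β) (cycIdeal Q a n β) (cycIdeal_le Q a n β)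

noncomputable instance [GradedRing 𝓀] (n : ℕ) (β : P) : GradedRing (gr Q a n β) where
  one_mem := ⟨1, SetLike.GradedOne.one_mem (A := KLRβ.gr Q n β), map_one (mk Q a n β)⟩
  mul_mem := by
    rintro d d' _ _ ⟨y, hy, rfl⟩ ⟨z, hz, rfl⟩
    exact ⟨y * z, SetLike.mul_mem_graded (A := KLRβ.gr Q n β) hy hz, map_mul (mk Q a n β) y z⟩
  toDecomposition := (gr_internal Q a n β).chooseDecomposition

theorem incl_cycIdeal (i : I) (n : ℕ) (β β' : P) {y : KLRβ Q n β} (hy : y ∈ cycIdeal Q a n β) :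
    KLRβ.incl Q i n β β' y ∈ cycIdeal Q a (n + 1) β' := by
  rw [← TwoSidedIdeal.mem_comap]
  refine TwoSidedIdeal.span_le.2 ?_ hy
  rintro _ ⟨h, rfl⟩
  rw [SetLike.mem_coe, TwoSidedIdeal.mem_comap]
  have key : KLRβ.incl Q i n β β' (proj Q β (cyc Q a (pos 0 h))) =
      KLRβ.incl Q i n β β' 1 * proj Q β' (cyc Q a (pos 0 (Nat.succ_pos n))) *
        KLRβ.incl Q i n β β' 1 := by
    apply val_injective Q
    have hc : incl Q n (cyc Q a (pos 0 h)) = cyc Q a (pos 0 (Nat.succ_pos n)) := incl_cyc Q a _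
    have h1 : ∀ b : KLR Q n, incl Q n b * eβi Q n β' i * eβ Q (n + 1) β' =
        incl Q n b * eβi Q n β' i := fun b => by rw [mul_assoc, eβi_mul_eβ]
    have h2 : ∀ b : KLR Q n, eβ Q (n + 1) β' * (incl Q n b * eβi Q n β' i) =
        incl Q n b * eβi Q n β' i := fun b => by rw [incl_mul_eβi, ← mul_assoc, eβ_mul_eβi]
    rw [val_mul, val_mul, val_incl, val_incl, val_one, val_proj, val_proj, map_mul, map_mul, hc]
    calc incl Q n (eβ Q n β) * cyc Q a (pos 0 (Nat.succ_pos n)) * incl Q n (eβ Q n β) * eβi Q n β' i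
        = incl Q n (eβ Q n β) * (cyc Q a (pos 0 (Nat.succ_pos n)) * eβi Q n β' i) *
            (incl Q n (eβ Q n β) * eβi Q n β' i) := by
          rw [mul_assoc _ (_ * eβi Q n β' i), mul_assoc (cyc Q a (pos 0 (Nat.succ_pos n))),
            ← mul_assoc (eβi Q n β' i), ← incl_mul_eβi, mul_assoc _ (eβi Q n β' i), eβi_idem]
          simp only [mul_assoc]
      _ = incl Q n (eβ Q n β) * (eβi Q n β' i * cyc Q a (pos 0 (Nat.succ_pos n))) *
            (incl Q n (eβ Q n β) * eβi Q n β' i) := by rw [← hc, incl_mul_eβi]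
      _ = incl Q n (eβ Q n β) * eβi Q n β' i * eβ Q (n + 1) β' *
            cyc Q a (pos 0 (Nat.succ_pos n)) *
            (eβ Q (n + 1) β' * (incl Q n (eβ Q n β) * eβi Q n β' i)) := by
          rw [h1, h2]; simp only [mul_assoc]
      _ = _ := by simp only [mul_assoc]
  rw [key]
  exact TwoSidedIdeal.mul_mem_right _ _ _ (TwoSidedIdeal.mul_mem_left _ _ _
    (TwoSidedIdeal.subset_span ⟨_, rfl⟩))

/-- The map underlying `CycKLR.incl`. -/
noncomputable def inclAdd (i : I) (n : ℕ) (β β' : P) :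
    CycKLR Q a n β →+ CycKLR Q a (n + 1) β' :=
  (mk Q a n β).toAddMonoidHom.liftOfSurjective (mk_surjective Q a n β)
    ⟨(mk Q a (n + 1) β').toAddMonoidHom.comp
      (KLRβ.incl Q i n β β' : KLRβ Q n β →+ KLRβ Q (n + 1) β'),
      fun _ hy => (mk_eq_zero Q a).2 (incl_cycIdeal Q a i n β β' ((mk_eq_zero Q a).1 hy))⟩

theorem inclAdd_mk (i : I) (n : ℕ) (β β' : P) (y : KLRβ Q n β) :
    inclAdd Q a i n β β' (mk Q a n β y) = mk Q a (n + 1) β' (KLRβ.incl Q i n β β' y) :=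
  AddMonoidHom.liftOfRightInverse_comp_apply (mk Q a n β).toAddMonoidHom _
    (Function.rightInverse_surjInv (mk_surjective Q a n β))
    ⟨(mk Q a (n + 1) β').toAddMonoidHom.comp
      (KLRβ.incl Q i n β β' : KLRβ Q n β →+ KLRβ Q (n + 1) β'), _⟩ y

/-- The ring homomorphism `R^Λ(β) → R^Λ(β')` induced by `R(β) → R(β')`, `a ↦ (a ⊗ 1) e(β, i)`,
where `β' = β + α_i`. -/
noncomputable def incl (i : I) (n : ℕ) (β β' : P) : CycKLR Q a n β →ₙ+* CycKLR Q a (n + 1) β' :=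
  { inclAdd Q a i n β β' with
    map_mul' := by
      intro y z
      obtain ⟨y, rfl⟩ := mk_surjective Q a n β y
      obtain ⟨z, rfl⟩ := mk_surjective Q a n β z
      change inclAdd Q a i n β β' (mk Q a n β y * mk Q a n β z) =
        inclAdd Q a i n β β' (mk Q a n β y) * inclAdd Q a i n β β' (mk Q a n β z)
      rw [← map_mul, inclAdd_mk, inclAdd_mk, inclAdd_mk, map_mul, map_mul] }

theorem incl_mk (i : I) (n : ℕ) (β β' : P) (y : KLRβ Q n β) :
    incl Q a i n β β' (mk Q a n β y) = mk Q a (n + 1) β' (KLRβ.incl Q i n β β' y) :=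
  inclAdd_mk Q a i n β β' y

/-- The image of `e(β' - α_i, i)` in `R^Λ(β')`. -/
noncomputable def idem (i : I) (n : ℕ) (β' : P) : CycKLR Q a (n + 1) β' :=
  mk Q a (n + 1) β' (proj Q β' (eβi Q n β' i))

theorem incl_one (i : I) (n : ℕ) (β β' : P) (h : β + C.α i = β') :
    incl Q a i n β β' 1 = idem Q a i n β' := by
  rw [← map_one (mk Q a n β), incl_mk, idem]
  congr 1
  apply val_injective Q
  rw [val_incl_one Q i β' h, val_proj, eβ_mul_eβi, eβi_mul_eβ]

/-- The degree-preserving ring homomorphism `R^Λ(β) → R^Λ(β + α_i)`; it sends the unit to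
`e(β, i)`, see `incl_one`. -/
noncomputable def cornerHom (i : I) (n : ℕ) {β β' : P} (_ : β + C.α i = β') :
    GrMod.CornerHom (gr Q a n β) (gr Q a (n + 1) β') where
  toHom := incl Q a i n β β'
  map_mem := by
    rintro d _ ⟨y, hy, rfl⟩
    exact ⟨_, incl_mem Q i β' hy, (incl_mk Q a i n β β' y).symm⟩

variable [GradedRing 𝓀]

/-- The functor `E_i^Λ : Mod(R^Λ(β + α_i)) ⥤ Mod(R^Λ(β))`, `N ↦ e(β, i) N`, where `n = |β|` and
`β' = β + α_i`. -/
noncomputable def functorE (i : I) (n : ℕ) {β β' : P} (h : β + C.α i = β') :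
    GrMod (gr Q a (n + 1) β') ⥤ GrMod (gr Q a n β) :=
  (cornerHom Q a i n h).trunc

/-- The functor `F_i^Λ : Mod(R^Λ(β)) ⥤ Mod(R^Λ(β + α_i))`,
`M ↦ R^Λ(β + α_i) e(β, i) ⊗_{R^Λ(β)} M`, where `n = |β|` and `β' = β + α_i`. -/
noncomputable def functorF (i : I) (n : ℕ) {β β' : P} (h : β + C.α i = β') :
    GrMod (gr Q a n β) ⥤ GrMod (gr Q a (n + 1) β') :=
  (cornerHom Q a i n h).ind

end CycKLR

end KLRAlgebras

/-! Strands are numbered from 0, `M` is a graded module over R^Λ(β) with |β| = n + 1, and e_i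
denotes the idempotent of the words ending in i. The isomorphism is induced by s ⊗ w ↦ s τ_n ⊗ w,
from F_j E_i M to E_i F_j M (`swapMap`). It is well defined because τ_n commutes with R(n) and
exchanges the last two letters, and because R(n + 1) and R(n + 2) have the same element x[1]. Its
degree -(α_i|α_j) accounts for the shift.

Surjectivity: R(n + 2) is spanned by the products τ_b ⋯ τ_n c in which c does not involve τ_n
(`IsCrossing.mem_filtration`). On words ending in j, c reduces to x_{n+1}^p times an element of R(n
+ 1), and the latter is absorbed by `M`. Multiplication by e_i on the left kills the terms without a
crossing, because i ≠ j. The other terms contain τ_n, and dots slide through τ_n without correction,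
because it crosses strands of different colours.

Injectivity needs coordinates on R(n + 2) e_j. Let S be a ring over R(n) with a central z such that
all z - x_l are invertible. Then R(n + 1) acts on column vectors of length n + 1 over S
(`SpectralRing.rep`): the basis vector c stands for the strands of R(n) with an extra strand of
colour j, carrying z, inserted at position c. For S = R(n)((t)) and z = t⁻¹, the element τ_b ⋯
τ_{n-1} x_n^p sends the last basis vector to a vector that is 0 left of b and equals z^p at b. The
coefficients of these vectors (`strandCoeff`) are right R(n)-linear, and they are triangular on the
spanning set above.

One level up, with values in `M`, the coordinates (`strandVec`) are defined on R(n + 2) × M but not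
on F_j M, since x[1] has not been divided out. For b > 0, x[1] commutes with τ_b ⋯ τ_n and then acts
as zero on `M`. So after multiplication by e_i the coordinates are well defined modulo the vectors
of e_i r x[1] τ_0 ⋯ τ_n x_{n+1}^p (`ambiguity`). Write r as a sum of terms c τ_n ⋯ τ_b. If b = 0,
then e_i travels down to the first strand and back to the last one, where it meets e_j and gives
zero. If b > 0, then τ_n ⋯ τ_b passes to the right, becomes τ_{n-1} ⋯ τ_{b-1} and is absorbed by
`M`; what remains is the vector of some s τ_n ⊗ w with s in the cyclotomic ideal of R(n + 1), that
is, of the zero tensor. So the ambiguity comes only from zero tensors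
(`mem_pairGroup_of_mem_ambiguity`). Together with triangularity (`pairSum_injective`) this proves
injectivity. -/

section Crossing

/-! ### Crossings and a spectral strand: the identities behind the braid relation -/

/-- The relations between a crossing `T` of two strands and the diagonal elements `u, q` (resp.
`u', q'`) attached to the first (resp. second) strand by an additional spectral strand. -/
structure IsSpectral {S : Type*} [Ring S] (T u u' q q' D : S) : Prop where
  u'_T : u' * T = T * u + u * u'
  u_T : u * T = T * u' - u * u'
  q'_T : q' * T = T * q + D
  q_T : q * T = T * q' - D
  uu' : Commute u u'
  uq : Commute u q
  uq' : Commute u q'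
  u'q : Commute u' q
  u'q' : Commute u' q'
  qq' : Commute q q'
  uD : Commute u D
  u'D : Commute u' D
  qD : Commute q D
  q'D : Commute q' D

namespace IsSpectral

variable {S : Type*} [Ring S] {T u u' q q' D : S}

theorem reassoc {a b c : S} (h : a * b = c) (x : S) : a * (b * x) = c * x := by
  rw [← mul_assoc, h]

set_option linter.unusedSimpArgs false in
-- These are the entries of τ_{l+1} τ_l τ_{l+1} - τ_l τ_{l+1} τ_l on the three basis vectors with
-- the extra strand at l, l + 1 and l + 2, where a crossing with the extra strand has rows (-u, 1)
-- and (q - u², u). The upper right entry T - T needs no relation and is left out. Only the diagonal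
-- survives: (q - T²)u', D and (q' - T²)u.
theorem braid_entries (h : IsSpectral T u u' q q' D) :
    (-(T * u * T) - (u * T * u - u' * (q - u * u)) = (q - T * T) * u') ∧
    (-(T * u') - (-(u * T) - u' * u) = 0) ∧
    (-(u' * (q - u * u) * T) - (-((q - u * u) * T * u) - u * u' * (q - u * u)) = 0) ∧
    (u' * u * u' + T * (q' - u' * u') - ((q - u * u) * T - u * u' * u) = D) ∧
    (-(u' * u) + T * u' - u * T = 0) ∧
    ((q' - u' * u') * (q - u * u) * T - T * (q' - u' * u') * (q - u * u) = 0) ∧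
    (-((q' - u' * u') * u * u') + u' * T * (q' - u' * u') - T * (q' - u' * u') * u = 0) ∧
    ((q' - u' * u') * u + u' * T * u' - T * u' * T = (q' - T * T) * u) := by
  obtain ⟨h1, h2, h3, h4, c1, c2, c3, c4, c5, c6, c7, c8, c9, c10⟩ := h
  have k1 : (q - u * u) * u' = u' * (q - u * u) :=
    ((c4.symm.sub_left (c1.mul_left c1))).eq
  have k2 : (q' - u' * u') * (q - u * u) = (q - u * u) * (q' - u' * u') :=
    (c6.symm.sub_left (c4.mul_left c4)).sub_right
      (((c3.symm.sub_left (c1.symm.mul_left c1.symm))).mul_right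
        ((c3.symm.sub_left (c1.symm.mul_left c1.symm)))) |>.eq
  -- The lower left entry q - u² passes T as q does, with D replaced by E = D - u²u' - uu'². By
  -- `k5`, E commutes with q' - u'².
  have k3 : (q' - u' * u') * T = T * (q - u * u) + (D - u * u * u' - u * u' * u') := by
    simp only [mul_add, add_mul, mul_sub, sub_mul, mul_assoc, neg_mul, mul_neg, neg_add, neg_sub,
    h1, h2, h3, h4, reassoc h1, reassoc h2, reassoc h4, c1.symm.eq, c2.symm.eq, c3.symm.eq,
    c4.symm.eq, c5.symm.eq, c6.symm.eq, c7.symm.eq, c8.symm.eq, reassoc c1.symm.eq,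
    reassoc c3.symm.eq]
    abel
  have k4 : (q - u * u) * T = T * (q' - u' * u') - (D - u * u * u' - u * u' * u') := by
    simp only [mul_add, add_mul, mul_sub, sub_mul, mul_assoc, neg_mul, mul_neg, neg_add, neg_sub,
    h1, h2, h3, h4, reassoc h1, reassoc h2, reassoc h4, c1.symm.eq, c2.symm.eq, c3.symm.eq,
    c4.symm.eq, c5.symm.eq, c6.symm.eq, c7.symm.eq, c8.symm.eq, reassoc c1.symm.eq,
    reassoc c3.symm.eq]
    abel
  have k5 : (D - u * u * u' - u * u' * u') * (q' - u' * u') =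
      (q' - u' * u') * (D - u * u * u' - u * u' * u') := by
    have hu : Commute (q' - u' * u') u := c3.symm.sub_left (c1.symm.mul_left c1.symm)
    have hu' : Commute (q' - u' * u') u' := c5.symm.sub_left ((Commute.refl u').mul_left rfl)
    have hD : Commute (q' - u' * u') D := c10.sub_left (c8.mul_left c8)
    exact (((hD.sub_right ((hu.mul_right hu).mul_right hu')).sub_right
      ((hu.mul_right hu').mul_right hu')).eq).symm
  refine ⟨?_, ?_, ?_, ?_, ?_, ?_, ?_, ?_⟩
  -- q - u² commutes with u and u', so it factors out on the left; the other factor is the relation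
  -- `u'_T`.
  case refine_3 =>
    have : -(u' * (q - u * u) * T) - (-((q - u * u) * T * u) - u * u' * (q - u * u)) =
        (q - u * u) * (T * u + u * u' - u' * T) := by
      have k6 : u * u' * (q - u * u) = (q - u * u) * (u * u') := by
        have hu : Commute (q - u * u) u := c2.symm.sub_left ((Commute.refl u).mul_left rfl)
        exact (hu.mul_right k1).eq.symm
      rw [← k1, k6]
      noncomm_ring
    rw [this, h1, sub_self, mul_zero]
  -- Passing T through both factors produces E(q' - u'²) and (q' - u'²)E with opposite signs.
  case refine_6 =>
    rw [mul_assoc, k4, mul_sub, ← mul_assoc, k3, mul_assoc T (q' - u' * u'), k2, add_mul, k5]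
    noncomm_ring
  all_goals
    simp only [mul_add, add_mul, mul_sub, sub_mul, mul_assoc, neg_mul, mul_neg, neg_add, neg_sub,
    h1, h2, h3, h4, reassoc h1, reassoc h2, reassoc h4, c1.symm.eq, c2.symm.eq, c3.symm.eq,
    c4.symm.eq, c5.symm.eq, c6.symm.eq, c7.symm.eq, c8.symm.eq, reassoc c1.symm.eq,
    reassoc c3.symm.eq]
    abel

end IsSpectral

end Crossing

/-! ### Relations of R(n) summed over all words, and diagonal elements of a spectral ring -/

section KLRAlgebras

variable {I : Type v} [Fintype I] [DecidableEq I] {P : Type*} [AddCommGroup P]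
    [Module.Free ℤ P] [Module.Finite ℤ P]
variable {C : CartanDatum I P} {k : Type u} [CommRing k] {𝓀 : ℤ → AddSubgroup k}

namespace KLR

variable (Q : KLRDatum C 𝓀) {n : ℕ}

theorem ext_e {B : Type*} [Ring B] (f : KLR Q n →+* B) {a b : B}
    (h : ∀ ν, a * f (e Q ν) = b * f (e Q ν)) : a = b := by
  rw [← mul_one a, ← mul_one b, ← map_one f, ← sum_e, map_sum, Finset.mul_sum, Finset.mul_sum]
  exact Finset.sum_congr rfl fun ν _ => h ν

theorem eSum_mul_e (s : Finset (Fin n → I)) (ν : Fin n → I) :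
    eSum Q s * e Q ν = if ν ∈ s then e Q ν else 0 := by
  simp only [eSum, Finset.sum_mul, e_mul]
  exact Finset.sum_ite_eq' s ν _

theorem e_mul_eSum (s : Finset (Fin n → I)) (ν : Fin n → I) :
    e Q ν * eSum Q s = if ν ∈ s then e Q ν else 0 := by
  simp only [eSum, Finset.mul_sum, e_mul]
  exact Finset.sum_ite_eq s ν _

theorem e_idem (ν : Fin n → I) : e Q ν * e Q ν = e Q ν := by rw [e_mul, if_pos rfl]

/-- The idempotent `∑ e(ν)` over the words with letter `j` at position `l`. -/
noncomputable def eAt (l : Fin n) (j : I) : KLR Q n := eSum Q (Finset.univ.filter fun ν => ν l = j)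

theorem eAt_mul_e (l : Fin n) (j : I) (ν : Fin n → I) :
    eAt Q l j * e Q ν = if ν l = j then e Q ν else 0 := by
  rw [eAt, eSum_mul_e]; simp

theorem eAt_mul_eAt (l : Fin n) (i j : I) :
    eAt Q l i * eAt Q l j = if i = j then eAt Q l i else 0 := by
  refine ext_e Q (RingHom.id _) fun ν => ?_
  simp only [RingHom.id_apply]
  rw [mul_assoc, eAt_mul_e]
  split_ifs with h1 h2 h2
  · rfl
  · rw [eAt_mul_e, if_neg (by rintro rfl; exact h2 h1), zero_mul]
  · rw [eAt_mul_e, if_neg (by rintro rfl; exact h1 h2), mul_zero]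
  · rw [mul_zero, zero_mul]

theorem e_comm_eSum (s : Finset (Fin n → I)) (ν : Fin n → I) : Commute (e Q ν) (eSum Q s) := by
  rw [Commute, SemiconjBy, eSum_mul_e, e_mul_eSum]

theorem eSum_comm (s t : Finset (Fin n → I)) : Commute (eSum Q s) (eSum Q t) := by
  rw [Commute, SemiconjBy, eSum_mul, eSum_mul, Finset.inter_comm]

theorem x_comm_eSum (l : Fin n) (s : Finset (Fin n → I)) : Commute (x Q l) (eSum Q s) :=
  x_mul_eSum Q l s

theorem τ_mul_eAt (l : ℕ) (h : l + 1 < n) (m : Fin n) (j : I) :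
    τ Q l h * eAt Q m j = eAt Q (sSwap l h m) j * τ Q l h := by
  refine ext_e Q (RingHom.id _) fun ν => ?_
  simp only [RingHom.id_apply]
  rw [mul_assoc, mul_assoc, eAt_mul_e, τ_e, ← mul_assoc, eAt_mul_e, Function.comp_apply, sSwap_sSwap]
  split_ifs <;> simp [τ_e]

/-- The idempotent `∑ e(ν)` over the words with equal letters at the positions `l` and `l + 1`. -/
noncomputable def eEq (l : ℕ) (h : l + 1 < n) : KLR Q n := eSum Q (Finset.univ.filter fun ν =>
  ν (pos l (Nat.lt_of_succ_lt h)) = ν (pos (l + 1) h))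

theorem eEq_mul_e (l : ℕ) (h : l + 1 < n) (ν : Fin n → I) : eEq Q l h * e Q ν =
    if ν (pos l (Nat.lt_of_succ_lt h)) = ν (pos (l + 1) h) then e Q ν else 0 := by
  rw [eEq, eSum_mul_e]; simp

theorem eEq_mul_eAt (l : ℕ) (h : l + 1 < n) (j : I) :
    eEq Q l h * eAt Q (pos l (Nat.lt_of_succ_lt h)) j =
      eAt Q (pos l (Nat.lt_of_succ_lt h)) j * eAt Q (pos (l + 1) h) j := by
  refine ext_e Q (RingHom.id _) fun ν => ?_
  simp only [RingHom.id_apply]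
  rw [mul_assoc, mul_assoc, eAt_mul_e, eAt_mul_e]
  split_ifs with h1 h2 h2
  · rw [eEq_mul_e, eAt_mul_e, if_pos h1, if_pos (h1.trans h2.symm)]
  · rw [eEq_mul_e, if_neg (by rw [h1]; exact fun h => h2 h.symm), mul_zero]
  · rw [eAt_mul_e, if_neg h1, mul_zero]
  · rw [mul_zero, mul_zero]

/-- The relation for a single word is summed over all words; the correction becomes the idempotent
of the words with equal letters at the crossing. -/
theorem τ_x_left (l : ℕ) (h : l + 1 < n) :
    τ Q l h * x Q (pos l (Nat.lt_of_succ_lt h)) = x Q (pos (l + 1) h) * τ Q l h - eEq Q l h := by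
  rw [← sub_eq_zero, sub_sub_eq_add_sub, add_sub_right_comm, ← eq_neg_iff_add_eq_zero]
  refine ext_e Q (RingHom.id _) fun ν => ?_
  have := τ_x Q l h (pos l (Nat.lt_of_succ_lt h)) ν
  rw [sSwap_left, if_pos rfl] at this
  simp only [RingHom.id_apply]
  rw [this, neg_mul, eEq_mul_e]
  split_ifs <;> simp

theorem τ_x_right (l : ℕ) (h : l + 1 < n) :
    τ Q l h * x Q (pos (l + 1) h) = x Q (pos l (Nat.lt_of_succ_lt h)) * τ Q l h + eEq Q l h := by
  rw [← sub_eq_iff_eq_add']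
  refine ext_e Q (RingHom.id _) fun ν => ?_
  have := τ_x Q l h (pos (l + 1) h) ν
  have h0 : ¬ pos (l + 1) h = pos l (Nat.lt_of_succ_lt h) := by simp
  rw [sSwap_right, if_neg h0, if_pos rfl] at this
  rw [RingHom.id_apply, this, eEq_mul_e]

theorem τ_x_of_ne (l : ℕ) (h : l + 1 < n) (m : Fin n) (h1 : m.1 ≠ l) (h2 : m.1 ≠ l + 1) :
    τ Q l h * x Q m = x Q m * τ Q l h := by
  rw [← sub_eq_zero]
  refine ext_e Q (RingHom.id _) fun ν => ?_
  have := τ_x Q l h m ν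
  have h3 : ¬ m = pos l (Nat.lt_of_succ_lt h) := by simpa [Fin.ext_iff] using h1
  have h4 : ¬ m = pos (l + 1) h := by simpa [Fin.ext_iff] using h2
  rw [show sSwap l h m = m from sSwap_of_ne l h m.1 m.2 h1 h2, if_neg h3, if_neg h4, ite_self] at this
  rw [RingHom.id_apply, this, zero_mul]

end KLR

/-- A ring over `R(n)` with a central element `z` such that every `z - x_l` is invertible. -/
structure SpectralRing (Q : KLRDatum C 𝓀) (n : ℕ) (S : Type*) [Ring S] [Algebra k S] where
  ι : KLR Q n →ₐ[k] S
  z : S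
  z_comm : ∀ a, Commute z (ι a)
  w : Fin n → S
  w_mul : ∀ l, w l * (z - ι (KLR.x Q l)) = 1
  mul_w : ∀ l, (z - ι (KLR.x Q l)) * w l = 1

namespace SpectralRing

open KLR

variable {Q : KLRDatum C 𝓀} {n : ℕ} {S : Type*} [Ring S] [Algebra k S] (D : SpectralRing Q n S)

/-- The image of `x_l`. -/
noncomputable def xs (l : Fin n) : S := D.ι (x Q l)

/-- The image of `τ_l`. -/
noncomputable def ts (l : ℕ) (h : l + 1 < n) : S := D.ι (τ Q l h)

/-- The image of `e(ν)`. -/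
noncomputable def es (ν : Fin n → I) : S := D.ι (e Q ν)

theorem ext_es {a b : S} (h : ∀ ν, a * D.es ν = b * D.es ν) : a = b := ext_e Q D.ι.toRingHom h

/-- `w l` is a two-sided inverse of z - x_l, so it commutes with whatever z - x_l commutes with. -/
theorem comm_w {y : S} {l : Fin n} (hz : Commute D.z y) (hx : Commute (D.xs l) y) :
    Commute (D.w l) y := by
  have h : (D.z - D.xs l) * y = y * (D.z - D.xs l) := (hz.sub_left hx).eq
  have h1 : D.w l * y = D.w l * (y * (D.z - D.xs l)) * D.w l := by
    rw [mul_assoc, mul_assoc, xs, D.mul_w, mul_one]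
  rw [Commute, SemiconjBy, h1, ← h, ← mul_assoc, xs, D.w_mul, one_mul]

theorem xs_comm (l m : Fin n) : Commute (D.xs l) (D.xs m) := by
  have := congrArg D.ι (x_comm Q l m); rwa [map_mul, map_mul] at this

theorem w_comm_z (l : Fin n) : Commute (D.w l) D.z := D.comm_w rfl (D.z_comm _).symm

theorem w_comm_xs (l m : Fin n) : Commute (D.w l) (D.xs m) := D.comm_w (D.z_comm _) (D.xs_comm l m)

theorem w_comm_w (l m : Fin n) : Commute (D.w l) (D.w m) :=
  D.comm_w (D.w_comm_z m).symm (D.w_comm_xs m l).symm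

theorem xs_comm_eSum (l : Fin n) (s : Finset (Fin n → I)) : Commute (D.xs l) (D.ι (eSum Q s)) := by
  have := congrArg D.ι (x_mul_eSum Q l s); rwa [map_mul, map_mul] at this

theorem w_comm_eSum (l : Fin n) (s : Finset (Fin n → I)) : Commute (D.w l) (D.ι (eSum Q s)) :=
  D.comm_w (D.z_comm _) (D.xs_comm_eSum l s)

theorem es_eq (ν : Fin n → I) : D.es ν = D.ι (eSum Q {ν}) := by
  rw [es, eSum, Finset.sum_singleton]

theorem xs_comm_es (l : Fin n) (ν : Fin n → I) : Commute (D.xs l) (D.es ν) := by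
  rw [es_eq]; exact D.xs_comm_eSum l _

theorem w_comm_es (l : Fin n) (ν : Fin n → I) : Commute (D.w l) (D.es ν) := by
  rw [es_eq]; exact D.w_comm_eSum l _

theorem es_comm (ν ν' : Fin n → I) : Commute (D.es ν) (D.es ν') := by
  rw [es_eq, es_eq]; exact (eSum_comm Q _ _).map D.ι

theorem es_mul (ν ν' : Fin n → I) : D.es ν * D.es ν' = if ν = ν' then D.es ν else 0 := by
  rw [es, es, ← map_mul, e_mul, apply_ite D.ι, map_zero]

theorem sum_es : ∑ ν, D.es ν = 1 := by
  simp only [es]; rw [← map_sum, sum_e, map_one]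

theorem ts_es (l : ℕ) (h : l + 1 < n) (ν : Fin n → I) :
    D.ts l h * D.es ν = D.es (ν ∘ sSwap l h) * D.ts l h := by
  rw [es, ts, es, ← map_mul, τ_e, map_mul]

/-- `∑_ν f_ν e(ν)`. -/
noncomputable def diag (f : (Fin n → I) → S) : S := ∑ ν, f ν * D.es ν

theorem diag_mul_es (f : (Fin n → I) → S) (ν : Fin n → I) : D.diag f * D.es ν = f ν * D.es ν := by
  simp only [diag, Finset.sum_mul, mul_assoc, es_mul]
  simp

theorem diag_comm {f : (Fin n → I) → S} {y : S} (h : ∀ ν, Commute (f ν) y)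
    (h' : ∀ ν, Commute (D.es ν) y) : Commute (D.diag f) y :=
  Commute.sum_left _ _ _ fun ν _ => (h ν).mul_left (h' ν)

variable (j : I)

/-- `1 / (z - x_l)` on the words with letter `j` at position `l`. -/
noncomputable def us (l : Fin n) : S := D.w l * D.ι (eAt Q l j)

/-- `Q_{ν_l, j}(x_l, z)`. -/
noncomputable def qs (l : Fin n) : S := D.diag fun ν => evalTwo (Q.t (ν l) j) (D.xs l) D.z

/-- `(Q_{b, j}(x_l, z) - Q_{b, j}(x_{l + 1}, z)) / (x_l - x_{l + 1})` on the words with `b` at the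
positions `l` and `l + 1`. -/
noncomputable def ds (l : ℕ) (h : l + 1 < n) : S := D.diag fun ν =>
  if ν (pos l (Nat.lt_of_succ_lt h)) = ν (pos (l + 1) h) then
    evalDivDiff (Q.t (ν (pos l (Nat.lt_of_succ_lt h))) j) (D.xs (pos l (Nat.lt_of_succ_lt h))) D.z
      (D.xs (pos (l + 1) h)) else 0

theorem evalTwo_comm (f : ℕ × ℕ →₀ k) {a b y : S} (ha : Commute a y) (hb : Commute b y) :
    Commute (evalTwo f a b) y :=
  Commute.sum_left _ _ _ fun p _ =>
    ((ha.pow_left p.1).mul_left (hb.pow_left p.2)).smul_left (f p)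

theorem evalDivDiff_comm (f : ℕ × ℕ →₀ k) {a b c y : S} (ha : Commute a y) (hb : Commute b y)
    (hc : Commute c y) : Commute (evalDivDiff f a b c) y :=
  Commute.sum_left _ _ _ fun p _ => ((Commute.sum_left _ _ _ fun q _ =>
    (ha.pow_left q).mul_left (hc.pow_left _)).mul_left (hb.pow_left p.2)).smul_left (f p)

/-- Elements commuting with `z`, all `x_l` and all `e(ν)`. -/
def IsDiag (y : S) : Prop :=
  Commute D.z y ∧ (∀ l, Commute (D.xs l) y) ∧ ∀ ν, Commute (D.es ν) y

theorem isDiag_z : D.IsDiag D.z :=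
  ⟨rfl, fun _ => (D.z_comm _).symm, fun _ => (D.z_comm _).symm⟩

theorem isDiag_xs (l : Fin n) : D.IsDiag (D.xs l) :=
  ⟨D.z_comm _, fun m => D.xs_comm m l, fun ν => (D.xs_comm_es l ν).symm⟩

theorem isDiag_es (ν : Fin n → I) : D.IsDiag (D.es ν) :=
  ⟨D.z_comm _, fun m => D.xs_comm_es m ν, fun ν' => D.es_comm ν' ν⟩

variable {D}

theorem IsDiag.mul {y y' : S} (h : D.IsDiag y) (h' : D.IsDiag y') : D.IsDiag (y * y') :=
  ⟨h.1.mul_right h'.1, fun l => (h.2.1 l).mul_right (h'.2.1 l),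
    fun l => (h.2.2 l).mul_right (h'.2.2 l)⟩

/-- `us`, `qs` and `ds` are built from z, the x_l, the inverses `w l` and the e(ν), so they commute
with every diagonal element. Applied to z, x_m and e(ν), this makes them diagonal themselves
(`isDiag_us` and its companions), and therefore they commute with each other. -/
theorem IsDiag.us_comm {y : S} (h : D.IsDiag y) (l : Fin n) : Commute (D.us j l) y := by
  refine (D.comm_w h.1 (h.2.1 l)).mul_left ?_
  rw [eAt, eSum, map_sum]
  exact Commute.sum_left _ _ _ fun ν _ => h.2.2 ν

theorem IsDiag.qs_comm {y : S} (h : D.IsDiag y) (l : Fin n) : Commute (D.qs j l) y :=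
  D.diag_comm (fun _ => evalTwo_comm _ (h.2.1 l) h.1) h.2.2

theorem IsDiag.ds_comm {y : S} (h : D.IsDiag y) (l : ℕ) (hl : l + 1 < n) :
    Commute (D.ds j l hl) y :=
  D.diag_comm (fun _ => by
    split_ifs
    · exact evalDivDiff_comm _ (h.2.1 _) h.1 (h.2.1 _)
    · exact Commute.zero_left _) h.2.2

variable (D)

theorem isDiag_us (l : Fin n) : D.IsDiag (D.us j l) :=
  ⟨((D.isDiag_z).us_comm j l).symm, fun m => ((D.isDiag_xs m).us_comm j l).symm,
    fun ν => ((D.isDiag_es ν).us_comm j l).symm⟩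

theorem isDiag_qs (l : Fin n) : D.IsDiag (D.qs j l) :=
  ⟨((D.isDiag_z).qs_comm j l).symm, fun m => ((D.isDiag_xs m).qs_comm j l).symm,
    fun ν => ((D.isDiag_es ν).qs_comm j l).symm⟩

theorem isDiag_ds (l : ℕ) (h : l + 1 < n) : D.IsDiag (D.ds j l h) :=
  ⟨((D.isDiag_z).ds_comm j l h).symm, fun m => ((D.isDiag_xs m).ds_comm j l h).symm,
    fun ν => ((D.isDiag_es ν).ds_comm j l h).symm⟩

theorem ts_x_left (l : ℕ) (h : l + 1 < n) :
    D.ts l h * D.xs (pos l (Nat.lt_of_succ_lt h)) =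
      D.xs (pos (l + 1) h) * D.ts l h - D.ι (eEq Q l h) := by
  rw [ts, xs, xs, ← map_mul, τ_x_left, map_sub, map_mul]

theorem ts_x_right (l : ℕ) (h : l + 1 < n) :
    D.ts l h * D.xs (pos (l + 1) h) =
      D.xs (pos l (Nat.lt_of_succ_lt h)) * D.ts l h + D.ι (eEq Q l h) := by
  rw [ts, xs, xs, ← map_mul, τ_x_right, map_add, map_mul]

/-- This is (z - x_{l+1}) τ_l = τ_l (z - x_l) - e, with e the idempotent of equal letters,
multiplied by the two inverses on the outside. -/
theorem ts_w_left (l : ℕ) (h : l + 1 < n) :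
    D.w (pos (l + 1) h) * D.ts l h = D.ts l h * D.w (pos l (Nat.lt_of_succ_lt h)) +
      D.w (pos (l + 1) h) * D.ι (eEq Q l h) * D.w (pos l (Nat.lt_of_succ_lt h)) := by
  have h1 : (D.z - D.xs (pos (l + 1) h)) * D.ts l h =
      D.ts l h * (D.z - D.xs (pos l (Nat.lt_of_succ_lt h))) - D.ι (eEq Q l h) := by
    rw [sub_mul, mul_sub, ts_x_left, show D.z * D.ts l h = D.ts l h * D.z from D.z_comm _]
    abel
  have h2 := congrArg (fun y => D.w (pos (l + 1) h) * y * D.w (pos l (Nat.lt_of_succ_lt h))) h1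
  beta_reduce at h2
  rw [← mul_assoc, xs, D.w_mul, one_mul, mul_sub, sub_mul, mul_assoc, mul_assoc, xs, D.mul_w,
    mul_one] at h2
  rw [h2, sub_add_cancel]

theorem ts_w_right (l : ℕ) (h : l + 1 < n) :
    D.w (pos l (Nat.lt_of_succ_lt h)) * D.ts l h = D.ts l h * D.w (pos (l + 1) h) -
      D.w (pos l (Nat.lt_of_succ_lt h)) * D.ι (eEq Q l h) * D.w (pos (l + 1) h) := by
  have h1 : (D.z - D.xs (pos l (Nat.lt_of_succ_lt h))) * D.ts l h =
      D.ts l h * (D.z - D.xs (pos (l + 1) h)) + D.ι (eEq Q l h) := by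
    rw [sub_mul, mul_sub, ts_x_right, show D.z * D.ts l h = D.ts l h * D.z from D.z_comm _]
    abel
  have h2 := congrArg (fun y => D.w (pos l (Nat.lt_of_succ_lt h)) * y * D.w (pos (l + 1) h)) h1
  simp only [mul_add, add_mul] at h2
  rw [← mul_assoc, xs, D.w_mul, one_mul, mul_assoc, mul_assoc, xs, D.mul_w, mul_one] at h2
  rw [h2, add_sub_cancel_right]

theorem eAt_ts (l : ℕ) (h : l + 1 < n) (m : Fin n) (j : I) :
    D.ι (eAt Q (sSwap l h m) j) * D.ts l h = D.ts l h * D.ι (eAt Q m j) := by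
  rw [ts, ← map_mul, ← map_mul, τ_mul_eAt]

end SpectralRing

theorem KLRDatum.evalTwo_symm (Q : KLRDatum C 𝓀) {A : Type*} [Ring A] [Algebra k A] (i j : I)
    {x y : A} (h : Commute x y) : evalTwo (Q.t i j) x y = evalTwo (Q.t j i) y x := by
  refine Finset.sum_nbij' Prod.swap Prod.swap ?_ ?_ (fun _ _ => rfl) (fun _ _ => rfl) ?_
  · rintro ⟨p, q⟩ hp
    rw [Finsupp.mem_support_iff] at hp ⊢
    rwa [Prod.swap, ← Q.t_symm]
  · rintro ⟨p, q⟩ hp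
    rw [Finsupp.mem_support_iff] at hp ⊢
    rwa [Prod.swap, ← Q.t_symm]
  · rintro ⟨p, q⟩ _
    simp only [Prod.swap]
    rw [Q.t_symm i j p q, (h.pow_pow p q).eq]

namespace SpectralRing

open KLR

variable {Q : KLRDatum C 𝓀} {n : ℕ} {S : Type*} [Ring S] [Algebra k S] (D : SpectralRing Q n S)
  (j : I)

theorem xs_comm_eEq (l : Fin n) (m : ℕ) (h : m + 1 < n) : Commute (D.xs l) (D.ι (eEq Q m h)) :=
  D.xs_comm_eSum l _

theorem w_comm_eEq (l : Fin n) (m : ℕ) (h : m + 1 < n) : Commute (D.w l) (D.ι (eEq Q m h)) :=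
  D.w_comm_eSum l _

theorem w_comm_eAt (l m : Fin n) (j : I) : Commute (D.w l) (D.ι (eAt Q m j)) :=
  D.w_comm_eSum l _

/-- Every factor x_l that passes τ_l leaves one copy of the idempotent of equal letters. The copies
add up to the complete symmetric sum, formally (x_l^p - x_{l+1}^p)/(x_l - x_{l+1}). As it is
symmetric, the same sum occurs in `ts_pow_right` with the opposite sign. -/
theorem ts_pow_left (l : ℕ) (h : l + 1 < n) (p : ℕ) :
    D.ts l h * D.xs (pos l (Nat.lt_of_succ_lt h)) ^ p =
      D.xs (pos (l + 1) h) ^ p * D.ts l h - D.ι (eEq Q l h) *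
        ∑ b ∈ Finset.range p, D.xs (pos l (Nat.lt_of_succ_lt h)) ^ b *
          D.xs (pos (l + 1) h) ^ (p - 1 - b) := by
  induction p with
  | zero => simp
  | succ p ih =>
    have hs : ∑ b ∈ Finset.range (p + 1), D.xs (pos l (Nat.lt_of_succ_lt h)) ^ b *
          D.xs (pos (l + 1) h) ^ (p + 1 - 1 - b) =
        D.xs (pos l (Nat.lt_of_succ_lt h)) ^ p + D.xs (pos (l + 1) h) * ∑ b ∈ Finset.range p,
          D.xs (pos l (Nat.lt_of_succ_lt h)) ^ b * D.xs (pos (l + 1) h) ^ (p - 1 - b) := by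
      rw [Finset.sum_range_succ, add_comm, Finset.mul_sum]
      simp only [add_tsub_cancel_right, tsub_self, pow_zero, mul_one]
      congr 1
      refine Finset.sum_congr rfl fun b hb => ?_
      rw [Finset.mem_range] at hb
      rw [← mul_assoc, ((D.xs_comm (pos (l + 1) h) _).pow_right b).eq, mul_assoc, ← pow_succ']
      congr 2
      omega
    rw [hs, pow_succ', ← mul_assoc, ts_x_left, sub_mul, mul_assoc, ih, mul_sub, mul_add, pow_succ',
      ← mul_assoc (D.xs (pos (l + 1) h)) (D.ι _), (D.xs_comm_eEq (pos (l + 1) h) _ _).eq]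
    simp only [mul_assoc]
    abel

theorem ts_pow_right (l : ℕ) (h : l + 1 < n) (p : ℕ) :
    D.ts l h * D.xs (pos (l + 1) h) ^ p =
      D.xs (pos l (Nat.lt_of_succ_lt h)) ^ p * D.ts l h + D.ι (eEq Q l h) *
        ∑ b ∈ Finset.range p, D.xs (pos l (Nat.lt_of_succ_lt h)) ^ b *
          D.xs (pos (l + 1) h) ^ (p - 1 - b) := by
  induction p with
  | zero => simp
  | succ p ih =>
    have hs : ∑ b ∈ Finset.range (p + 1), D.xs (pos l (Nat.lt_of_succ_lt h)) ^ b *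
          D.xs (pos (l + 1) h) ^ (p + 1 - 1 - b) =
        D.xs (pos (l + 1) h) ^ p + D.xs (pos l (Nat.lt_of_succ_lt h)) * ∑ b ∈ Finset.range p,
          D.xs (pos l (Nat.lt_of_succ_lt h)) ^ b * D.xs (pos (l + 1) h) ^ (p - 1 - b) := by
      rw [Finset.sum_range_succ', add_comm, Finset.mul_sum]
      simp only [add_tsub_cancel_right, tsub_zero, pow_zero, one_mul]
      congr 1
      refine Finset.sum_congr rfl fun b hb => ?_
      rw [pow_succ', mul_assoc]
      congr 3
      omega
    rw [hs, pow_succ', ← mul_assoc, ts_x_right, add_mul, mul_assoc, ih, mul_add, mul_add, pow_succ',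
      ← mul_assoc (D.xs (pos l _)) (D.ι _), (D.xs_comm_eEq (pos l _) _ _).eq]
    simp only [mul_assoc]
    abel

theorem ts_comm_z (l : ℕ) (h : l + 1 < n) : Commute D.z (D.ts l h) := D.z_comm _

/-- Monomial by monomial, the symmetric sums of `ts_pow_left` assemble to the divided difference of
f in its first variable. -/
theorem ts_evalTwo_left (l : ℕ) (h : l + 1 < n) (f : ℕ × ℕ →₀ k) :
    D.ts l h * evalTwo f (D.xs (pos l (Nat.lt_of_succ_lt h))) D.z =
      evalTwo f (D.xs (pos (l + 1) h)) D.z * D.ts l h - D.ι (eEq Q l h) *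
        evalDivDiff f (D.xs (pos l (Nat.lt_of_succ_lt h))) D.z (D.xs (pos (l + 1) h)) := by
  simp only [evalTwo, evalDivDiff, Finsupp.sum, Finset.mul_sum, Finset.sum_mul]
  rw [← Finset.sum_sub_distrib]
  refine Finset.sum_congr rfl fun p _ => ?_
  rw [mul_smul_comm, smul_mul_assoc, mul_smul_comm, ← smul_sub, ← mul_assoc, ts_pow_left, sub_mul,
    mul_assoc, mul_assoc _ _ (D.ts l h), ((D.ts_comm_z l h).pow_left p.2).eq, mul_assoc (D.ι _),
    Finset.sum_mul]

theorem ts_evalTwo_right (l : ℕ) (h : l + 1 < n) (f : ℕ × ℕ →₀ k) :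
    D.ts l h * evalTwo f (D.xs (pos (l + 1) h)) D.z =
      evalTwo f (D.xs (pos l (Nat.lt_of_succ_lt h))) D.z * D.ts l h + D.ι (eEq Q l h) *
        evalDivDiff f (D.xs (pos l (Nat.lt_of_succ_lt h))) D.z (D.xs (pos (l + 1) h)) := by
  simp only [evalTwo, evalDivDiff, Finsupp.sum, Finset.mul_sum, Finset.sum_mul]
  rw [← Finset.sum_add_distrib]
  refine Finset.sum_congr rfl fun p _ => ?_
  rw [mul_smul_comm, smul_mul_assoc, mul_smul_comm, ← smul_add, ← mul_assoc, ts_pow_right, add_mul,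
    mul_assoc, mul_assoc _ _ (D.ts l h), ((D.ts_comm_z l h).pow_left p.2).eq, mul_assoc (D.ι _),
    Finset.sum_mul]

theorem eEq_mul_es (l : ℕ) (h : l + 1 < n) (ν : Fin n → I) : D.ι (eEq Q l h) * D.es ν =
    if ν (pos l (Nat.lt_of_succ_lt h)) = ν (pos (l + 1) h) then D.es ν else 0 := by
  rw [es, ← map_mul, eEq_mul_e, apply_ite D.ι, map_zero]

theorem us_mul_es (l : Fin n) (ν : Fin n → I) :
    D.us j l * D.es ν = if ν l = j then D.w l * D.es ν else 0 := by
  rw [us, es, mul_assoc, ← map_mul, eAt_mul_e]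
  split_ifs <;> simp

theorem isDiag_evalDivDiff (f : ℕ × ℕ →₀ k) {a b c : S} (ha : D.IsDiag a) (hb : D.IsDiag b)
    (hc : D.IsDiag c) : D.IsDiag (evalDivDiff f a b c) :=
  ⟨(evalDivDiff_comm f ha.1.symm hb.1.symm hc.1.symm).symm,
    fun l => (evalDivDiff_comm f (ha.2.1 l).symm (hb.2.1 l).symm (hc.2.1 l).symm).symm,
    fun ν => (evalDivDiff_comm f (ha.2.2 ν).symm (hb.2.2 ν).symm (hc.2.2 ν).symm).symm⟩

/-- The relations for u are those of the inverses `w` multiplied by the idempotent of letter j: if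
two neighbouring letters are equal and one of them is j, both are. The relations for q are checked
on each word, where q is a single polynomial. -/
theorem isSpectral (l : ℕ) (h : l + 1 < n) :
    IsSpectral (D.ts l h) (D.us j (pos l (Nat.lt_of_succ_lt h))) (D.us j (pos (l + 1) h))
      (D.qs j (pos l (Nat.lt_of_succ_lt h))) (D.qs j (pos (l + 1) h)) (D.ds j l h) where
  u'_T := by
    have h1 := congrArg (· * D.ι (eAt Q (pos l (Nat.lt_of_succ_lt h)) j)) (D.ts_w_left l h)
    beta_reduce at h1
    rw [mul_assoc, ← D.eAt_ts l h (pos l _), sSwap_left, ← mul_assoc, add_mul, mul_assoc (D.ts l h)]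
      at h1
    rw [us, h1, us]
    congr 1
    have h2 := congrArg D.ι (eEq_mul_eAt Q l h j)
    rw [map_mul, map_mul] at h2
    rw [mul_assoc, mul_assoc, ← mul_assoc (D.ι _), ← (D.w_comm_eEq _ _ _).eq, mul_assoc (D.w _), h2,
      ← mul_assoc, (D.w_comm_w _ _).eq, mul_assoc, ← mul_assoc (D.w _) (D.ι _),
      (D.w_comm_eAt _ _ _).eq]
    simp only [mul_assoc]
  u_T := by
    have h1 := congrArg (· * D.ι (eAt Q (pos (l + 1) h) j)) (D.ts_w_right l h)
    beta_reduce at h1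
    have h2 : eEq Q l h * eAt Q (pos (l + 1) h) j =
        eAt Q (pos l (Nat.lt_of_succ_lt h)) j * eAt Q (pos (l + 1) h) j := by
      rw [← eEq_mul_eAt]
      refine ext_e Q (RingHom.id _) fun ν => ?_
      simp only [RingHom.id_apply]
      rw [mul_assoc, mul_assoc, eAt_mul_e, eAt_mul_e]
      by_cases hν : ν (pos l (Nat.lt_of_succ_lt h)) = ν (pos (l + 1) h)
      · rw [hν]
      · split_ifs <;> simp [eEq_mul_e, hν]
    rw [mul_assoc, ← D.eAt_ts l h (pos (l + 1) _), sSwap_right, ← mul_assoc, sub_mul,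
      mul_assoc (D.ts l h)] at h1
    rw [us, h1, us]
    congr 1
    have h3 := congrArg D.ι h2
    rw [map_mul, map_mul] at h3
    rw [mul_assoc, mul_assoc, ← mul_assoc (D.ι _), ← (D.w_comm_eEq _ _ _).eq, mul_assoc (D.w _), h3,
      ← mul_assoc (D.w _) (D.ι _), (D.w_comm_eAt _ _ _).eq]
    simp only [mul_assoc]
  q'_T := by
    refine D.ext_es fun ν => ?_
    rw [add_mul, mul_assoc, mul_assoc, ts_es, ← mul_assoc, qs, diag_mul_es, qs, diag_mul_es, ds,
      diag_mul_es, mul_assoc, ← ts_es, ← mul_assoc, ← mul_assoc, ts_evalTwo_left, Function.comp_apply,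
      sSwap_right, sub_mul, mul_assoc (D.ι _),
      ((isDiag_evalDivDiff D _ (D.isDiag_xs _) D.isDiag_z (D.isDiag_xs _)).2.2 ν).symm.eq,
      ← mul_assoc (D.ι _), eEq_mul_es]
    split_ifs
    · rw [((isDiag_evalDivDiff D _ (D.isDiag_xs _) D.isDiag_z (D.isDiag_xs _)).2.2 ν).eq,
        sub_add_cancel]
    · simp
  q_T := by
    refine D.ext_es fun ν => ?_
    rw [sub_mul, mul_assoc, mul_assoc, ts_es, ← mul_assoc, qs, diag_mul_es, qs, diag_mul_es, ds,
      diag_mul_es, mul_assoc, ← ts_es, ← mul_assoc, ← mul_assoc, ts_evalTwo_right,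
      Function.comp_apply, sSwap_left, add_mul, mul_assoc (D.ι _),
      ((isDiag_evalDivDiff D _ (D.isDiag_xs _) D.isDiag_z (D.isDiag_xs _)).2.2 ν).symm.eq,
      ← mul_assoc (D.ι _), eEq_mul_es]
    split_ifs with hν
    · rw [((isDiag_evalDivDiff D _ (D.isDiag_xs _) D.isDiag_z (D.isDiag_xs _)).2.2 ν).eq, hν,
        add_sub_cancel_right]
    · simp
  uu' := (D.isDiag_us j _).us_comm j _
  uq := (D.isDiag_qs j _).us_comm j _
  uq' := (D.isDiag_qs j _).us_comm j _
  u'q := (D.isDiag_qs j _).us_comm j _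
  u'q' := (D.isDiag_qs j _).us_comm j _
  qq' := (D.isDiag_qs j _).qs_comm j _
  uD := (D.isDiag_ds j l h).us_comm j _
  u'D := (D.isDiag_ds j l h).us_comm j _
  qD := (D.isDiag_ds j l h).qs_comm j _
  q'D := (D.isDiag_ds j l h).qs_comm j _

theorem ts_sq (l : ℕ) (h : l + 1 < n) (ν : Fin n → I) : D.ts l h * D.ts l h * D.es ν =
    evalTwo (Q.t (ν (pos l (Nat.lt_of_succ_lt h))) (ν (pos (l + 1) h)))
      (D.xs (pos l (Nat.lt_of_succ_lt h))) (D.xs (pos (l + 1) h)) * D.es ν := by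
  have := congrArg D.ι (τ_sq Q l h ν)
  rwa [map_mul, map_mul, map_mul, map_evalTwo] at this

theorem z_comm_xs (l : Fin n) : Commute D.z (D.xs l) := D.z_comm _

/-- The factor u' restricts to words with ν_{l+1} = j. There q - τ_l² is Q_{j,ν_l}(z, x_l) -
Q_{j,ν_l}(x_{l+1}, x_l), and u' divides it by z - x_{l+1}. The quotient is what the braid relation
demands when the extra strand is the first of three. -/
theorem braid_error_left (l : ℕ) (h : l + 1 < n) (ν : Fin n → I) :
    (D.qs j (pos l (Nat.lt_of_succ_lt h)) - D.ts l h * D.ts l h) * D.us j (pos (l + 1) h) * D.es ν =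
      if j = ν (pos (l + 1) h) then
        evalDivDiff (Q.t j (ν (pos l (Nat.lt_of_succ_lt h)))) D.z
          (D.xs (pos l (Nat.lt_of_succ_lt h))) (D.xs (pos (l + 1) h)) * D.es ν else 0 := by
  rw [mul_assoc, us_mul_es]
  by_cases hν : ν (pos (l + 1) h) = j
  · rw [if_pos hν, if_pos hν.symm, (D.w_comm_es _ _).eq, ← mul_assoc, sub_mul, qs, diag_mul_es, ts_sq,
      hν, Q.evalTwo_symm _ _ (D.z_comm_xs _).symm, Q.evalTwo_symm _ j (D.xs_comm _ _), ← sub_mul,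
      ← evalDivDiff_mul_sub _ (D.z_comm_xs _) (D.z_comm_xs _) (D.xs_comm _ _), mul_assoc _ (D.es ν),
      ← (D.w_comm_es _ _).eq, ← mul_assoc, mul_assoc _ _ (D.w _), xs, xs, D.mul_w, mul_one]
  · rw [if_neg hν, if_neg fun h => hν h.symm, mul_zero]

/-- Here the extra strand is the last of three: u restricts to ν_l = j and divides by z - x_l. The
signs of numerator and denominator are both reversed, to match the order of the variables in the
braid relation. -/
theorem braid_error_right (l : ℕ) (h : l + 1 < n) (ν : Fin n → I) :
    (D.qs j (pos (l + 1) h) - D.ts l h * D.ts l h) * D.us j (pos l (Nat.lt_of_succ_lt h)) * D.es ν =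
      if ν (pos l (Nat.lt_of_succ_lt h)) = j then
        evalDivDiff (Q.t (ν (pos l (Nat.lt_of_succ_lt h))) (ν (pos (l + 1) h)))
          (D.xs (pos l (Nat.lt_of_succ_lt h))) (D.xs (pos (l + 1) h)) D.z * D.es ν else 0 := by
  rw [mul_assoc, us_mul_es]
  split_ifs with hν
  · rw [(D.w_comm_es _ _).eq, ← mul_assoc, sub_mul, qs, diag_mul_es, ts_sq,
      hν, Q.evalTwo_symm _ _ (D.z_comm_xs _).symm, ← sub_mul, ← neg_sub,
      ← evalDivDiff_mul_sub _ (D.z_comm_xs _).symm (D.xs_comm _ _) (D.z_comm_xs _).symm,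
      mul_assoc _ (D.es ν), ← (D.w_comm_es _ _).eq, ← mul_assoc, ← mul_neg, neg_sub,
      mul_assoc _ _ (D.w _), xs, xs, D.mul_w, mul_one]
  · rw [mul_zero]

end SpectralRing

/-! ### Inserting a spectral strand: deletion of a letter and the action of the generators -/

theorem sSwap_val {n : ℕ} (l : ℕ) (h : l + 1 < n) (m : Fin n) :
    (sSwap l h m : ℕ) = if m.1 = l then l + 1 else if m.1 = l + 1 then l else m.1 := by
  rw [sSwap, Equiv.swap_apply_def]
  simp only [Fin.ext_iff]
  split_ifs <;> simp

/-- The word `ν` without its letter at position `c`. -/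
def delW {J : Type*} {n : ℕ} (c : Fin (n + 1)) (ν : Fin (n + 1) → J) : Fin n → J :=
  fun m => ν (c.succAbove m)

section Words

variable {J : Type*} {n : ℕ} (ν : Fin (n + 1) → J)

theorem succAbove_val (c : Fin (n + 1)) (m : Fin n) :
    (c.succAbove m : ℕ) = if m.1 < c.1 then m.1 else m.1 + 1 := by
  rw [Fin.succAbove]
  simp only [Fin.lt_def, Fin.val_castSucc]
  split_ifs <;> simp

theorem delW_below {c m : ℕ} (hc : c < n + 1) (hm : m < n) (h : m < c) :
    delW (pos c hc) ν (pos m hm) = ν (pos m (by omega)) :=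
  congrArg ν (Fin.ext (by rw [succAbove_val, if_pos h]))

theorem delW_above {c m : ℕ} (hc : c < n + 1) (hm : m < n) (h : c ≤ m) :
    delW (pos c hc) ν (pos m hm) = ν (pos (m + 1) (by omega)) :=
  congrArg ν (Fin.ext (by rw [succAbove_val, if_neg (by simpa using h)]))

theorem delW_swap_above {c l : ℕ} (hc : c < n + 1) (h : l + 1 + 1 < n + 1) (hl : c ≤ l) :
    delW (pos c hc) (ν ∘ sSwap (l + 1) h) = delW (pos c hc) ν ∘ sSwap l (by omega) :=
  funext fun m => congrArg ν (Fin.ext (by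
    rw [sSwap_val, succAbove_val, succAbove_val, sSwap_val]
    dsimp only
    split_ifs <;> omega))

theorem delW_swap_below {c l : ℕ} (hc : c < n + 1) (h : l + 1 < n + 1) (hl : l + 1 < c) :
    delW (pos c hc) (ν ∘ sSwap l h) = delW (pos c hc) ν ∘ sSwap l (by omega) :=
  funext fun m => congrArg ν (Fin.ext (by
    rw [sSwap_val, succAbove_val, succAbove_val, sSwap_val]
    dsimp only
    split_ifs <;> omega))

theorem delW_swap_left {l : ℕ} (h : l + 1 < n + 1) :
    delW (pos l (by omega)) (ν ∘ sSwap l h) = delW (pos (l + 1) h) ν :=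
  funext fun m => congrArg ν (Fin.ext (by
    rw [sSwap_val, succAbove_val, succAbove_val]
    dsimp only
    split_ifs <;> omega))

theorem delW_swap_right {l : ℕ} (h : l + 1 < n + 1) :
    delW (pos (l + 1) h) (ν ∘ sSwap l h) = delW (pos l (by omega)) ν :=
  funext fun m => congrArg ν (Fin.ext (by
    rw [sSwap_val, succAbove_val, succAbove_val]
    dsimp only
    split_ifs <;> omega))

theorem delW_inj {ν ν' : Fin (n + 1) → J} (c : Fin (n + 1)) :
    ν = ν' ↔ ν c = ν' c ∧ delW c ν = delW c ν' := by
  refine ⟨fun h => by rw [h]; exact ⟨rfl, rfl⟩, fun h => ?_⟩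
  funext m
  rcases Fin.eq_self_or_eq_succAbove c m with rfl | ⟨m, rfl⟩
  · exact h.1
  · exact congrFun h.2 m

end Words

namespace SpectralRing

open KLR

variable {Q : KLRDatum C 𝓀} {n : ℕ} {S : Type*} [Ring S] [Algebra k S] (D : SpectralRing Q n S)
  (j : I)

/-- The variable at position `l` when the spectral strand is at position `c`. -/
noncomputable def posVar (c l : Fin (n + 1)) : S :=
  if h : l.1 < c.1 then D.xs ⟨l, by omega⟩
  else if h' : l.1 = c.1 then D.z else D.xs ⟨l - 1, by omega⟩

theorem posVar_below {c l : ℕ} (hc : c < n + 1) (hl : l < n + 1) (h : l < c) :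
    D.posVar (pos c hc) (pos l hl) = D.xs (pos l (by omega)) := by
  rw [posVar, dif_pos h]

theorem posVar_self (c : Fin (n + 1)) : D.posVar c c = D.z := by
  rw [posVar, dif_neg (lt_irrefl _), dif_pos rfl]

theorem posVar_above {c l : ℕ} (hc : c < n + 1) (hl : l + 1 < n + 1) (h : c ≤ l) :
    D.posVar (pos c hc) (pos (l + 1) hl) = D.xs (pos l (by omega)) := by
  rw [posVar, dif_neg (by dsimp only; omega), dif_neg (by dsimp only; omega)]
  rfl

theorem isDiag_posVar (c l : Fin (n + 1)) : D.IsDiag (D.posVar c l) := by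
  rw [posVar]
  split_ifs
  exacts [D.isDiag_xs _, D.isDiag_z, D.isDiag_xs _]

/-- The crossing of the positions `l` and `l + 1`, where `f c` is the coefficient of the basis
vector with the spectral strand at position `c`. -/
noncomputable def crossing (l : ℕ) (h : l + 1 < n + 1) : Module.End k (Fin (n + 1) → S) where
  toFun f c :=
    if h1 : c.1 < l then D.ts (l - 1) (by omega) * f c
    else if h2 : c.1 = l then -(D.us j (pos l (by omega)) * f c) + f (pos (l + 1) h)
    else if h3 : c.1 = l + 1 then
      (D.qs j (pos l (by omega)) - D.us j (pos l (by omega)) * D.us j (pos l (by omega))) *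
        f (pos l (by omega)) + D.us j (pos l (by omega)) * f c
    else D.ts l (by omega) * f c
  map_add' f g := by
    funext c
    dsimp only [Pi.add_apply]
    split_ifs <;> simp only [mul_add] <;> abel
  map_smul' r f := by
    funext c
    dsimp only [Pi.smul_apply, RingHom.id_apply]
    split_ifs <;> simp [smul_add]

/-- To the right of the extra strand the strands of R(n) are shifted by one, so the crossing l + 1
acts as the crossing l of R(n). -/
theorem crossing_above {c l : ℕ} (hc : c < n + 1) (h : l + 1 + 1 < n + 1) (hl : c ≤ l)
    (f : Fin (n + 1) → S) :
    D.crossing j (l + 1) h f (pos c hc) = D.ts l (by omega) * f (pos c hc) := by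
  change (if h1 : c < l + 1 then _ else _) = _
  rw [dif_pos (by omega)]
  rfl

theorem crossing_left {l : ℕ} (h : l + 1 < n + 1) (f : Fin (n + 1) → S) :
    D.crossing j l h f (pos l (by omega)) =
      -(D.us j (pos l (by omega)) * f (pos l (by omega))) + f (pos (l + 1) h) := by
  change (if h1 : l < l then _ else _) = _
  rw [dif_neg (by omega), dif_pos rfl]

theorem crossing_right {l : ℕ} (h : l + 1 < n + 1) (f : Fin (n + 1) → S) :
    D.crossing j l h f (pos (l + 1) h) =
      (D.qs j (pos l (by omega)) - D.us j (pos l (by omega)) * D.us j (pos l (by omega))) *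
        f (pos l (by omega)) + D.us j (pos l (by omega)) * f (pos (l + 1) h) := by
  change (if h1 : l + 1 < l then _ else _) = _
  rw [dif_neg (by omega), dif_neg (by dsimp only; omega), dif_pos rfl]

theorem crossing_below {c l : ℕ} (hc : c < n + 1) (h : l + 1 < n + 1) (hl : l + 1 < c)
    (f : Fin (n + 1) → S) :
    D.crossing j l h f (pos c hc) = D.ts l (by omega) * f (pos c hc) := by
  change (if h1 : c < l then _ else _) = _
  rw [dif_neg (by omega), dif_neg (by dsimp only; omega), dif_neg (by dsimp only; omega)]

/-- The action of the generators. -/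
noncomputable def rep₀ : FreeAlgebra k (KLRGen I (n + 1)) →ₐ[k] Module.End k (Fin (n + 1) → S) :=
  FreeAlgebra.lift k fun g =>
    match g with
    | .e ν => Algebra.lmul k (Fin (n + 1) → S) fun c => if ν c = j then D.es (delW c ν) else 0
    | .x l => Algebra.lmul k (Fin (n + 1) → S) fun c => D.posVar c l
    | .τ l h => D.crossing j l h

theorem rep₀_e (ν : Fin (n + 1) → I) (f : Fin (n + 1) → S) (c : Fin (n + 1)) :
    D.rep₀ j (gE k ν) f c = (if ν c = j then D.es (delW c ν) else 0) * f c := by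
  rw [rep₀, gE, FreeAlgebra.lift_ι_apply]
  rfl

theorem rep₀_x' (l : Fin (n + 1)) : D.rep₀ j (gX I k l) =
    Algebra.lmul k (Fin (n + 1) → S) fun c => D.posVar c l := by
  rw [rep₀, gX, FreeAlgebra.lift_ι_apply]

theorem rep₀_x (l : Fin (n + 1)) (f : Fin (n + 1) → S) (c : Fin (n + 1)) :
    D.rep₀ j (gX I k l) f c = D.posVar c l * f c := by
  rw [rep₀_x']
  rfl

theorem rep₀_τ (l : ℕ) (h : l + 1 < n + 1) : D.rep₀ j (gT I k l h) = D.crossing j l h := by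
  rw [rep₀, gT, FreeAlgebra.lift_ι_apply]

theorem rep₀_evalTwo (t : ℕ × ℕ →₀ k) (l m : Fin (n + 1)) (f : Fin (n + 1) → S)
    (c : Fin (n + 1)) : D.rep₀ j (evalTwo t (gX I k l) (gX I k m)) f c =
      evalTwo t (D.posVar c l) (D.posVar c m) * f c := by
  rw [map_evalTwo, rep₀_x', rep₀_x', ← map_evalTwo]
  change (Pi.evalAlgHom k (fun _ => S) c) (evalTwo t _ _) * f c = _
  rw [map_evalTwo]
  rfl

theorem rep₀_evalDivDiff (t : ℕ × ℕ →₀ k) (l m r : Fin (n + 1)) (f : Fin (n + 1) → S)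
    (c : Fin (n + 1)) : D.rep₀ j (evalDivDiff t (gX I k l) (gX I k m) (gX I k r)) f c =
      evalDivDiff t (D.posVar c l) (D.posVar c m) (D.posVar c r) * f c := by
  rw [map_evalDivDiff, rep₀_x', rep₀_x', rep₀_x', ← map_evalDivDiff]
  change (Pi.evalAlgHom k (fun _ => S) c) (evalDivDiff t _ _ _) * f c = _
  rw [map_evalDivDiff]
  rfl

theorem ts_comm (l m : ℕ) (hl : l + 1 < n) (hm : m + 1 < n) (hlm : l + 1 < m ∨ m + 1 < l) :
    D.ts l hl * D.ts m hm = D.ts m hm * D.ts l hl := by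
  rw [ts, ts, ← map_mul, τ_comm Q l m hl hm hlm, map_mul]

theorem ts_comm_xs (l : ℕ) (hl : l + 1 < n) (m : Fin n) (h1 : m.1 ≠ l) (h2 : m.1 ≠ l + 1) :
    Commute (D.ts l hl) (D.xs m) := by
  have := congrArg D.ι (τ_x_of_ne Q l hl m h1 h2)
  rwa [map_mul, map_mul] at this

theorem ts_comm_us (l : ℕ) (hl : l + 1 < n) (m : Fin n) (h1 : m.1 ≠ l) (h2 : m.1 ≠ l + 1) :
    Commute (D.ts l hl) (D.us j m) := by
  refine Commute.mul_right (D.comm_w (D.ts_comm_z l hl) (D.ts_comm_xs l hl m h1 h2).symm).symm ?_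
  have h := D.eAt_ts l hl m j
  rw [show sSwap l hl m = m from sSwap_of_ne l hl m.1 m.2 h1 h2] at h
  exact h.symm

theorem ts_comm_qs (l : ℕ) (hl : l + 1 < n) (m : Fin n) (h1 : m.1 ≠ l) (h2 : m.1 ≠ l + 1) :
    Commute (D.ts l hl) (D.qs j m) := by
  refine D.ext_es fun ν => ?_
  rw [mul_assoc, mul_assoc, ts_es, qs, diag_mul_es, ← mul_assoc (D.diag _), diag_mul_es, mul_assoc,
    ← ts_es, Function.comp_apply, show sSwap l hl m = m from sSwap_of_ne l hl m.1 m.2 h1 h2,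
    ← mul_assoc, ← mul_assoc,
    (evalTwo_comm _ (D.ts_comm_xs l hl m h1 h2).symm (D.ts_comm_z l hl)).eq]

/-- On the two basis vectors with the extra strand at l and l + 1 the crossing has rows (-u, 1) and
(q - u², u). The entries commute and the trace is zero, so the square is the scalar u² + (q - u²) =
q. The entry 1 is a normalization: the basis vector at l is τ_l - u applied to the one at l + 1. -/
theorem crossing_sq_left {l : ℕ} (h : l + 1 < n + 1) (f : Fin (n + 1) → S) :
    D.crossing j l h (D.crossing j l h f) (pos l (by omega)) =
      D.qs j (pos l (by omega)) * f (pos l (by omega)) := by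
  rw [crossing_left, crossing_left, crossing_right]
  noncomm_ring

theorem crossing_sq_right {l : ℕ} (h : l + 1 < n + 1) (f : Fin (n + 1) → S) :
    D.crossing j l h (D.crossing j l h f) (pos (l + 1) h) =
      D.qs j (pos l (by omega)) * f (pos (l + 1) h) := by
  rw [crossing_right, crossing_left, crossing_right]
  have h1 : D.qs j (pos l (by omega)) * D.us j (pos l (by omega)) =
    D.us j (pos l (by omega)) * D.qs j (pos l (by omega)) :=
      ((D.isDiag_us j _).qs_comm j (pos l (by omega))).eq
  simp only [mul_add, sub_mul, mul_neg, mul_assoc, mul_sub]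
  rw [← mul_assoc (D.qs j _) (D.us j _), h1]
  noncomm_ring

/-- The difference of the two sides of the braid relation. -/
noncomputable def braidDiff (l : ℕ) (h : l + 2 < n + 1) : Module.End k (Fin (n + 1) → S) :=
  D.crossing j (l + 1) h * D.crossing j l (by omega) * D.crossing j (l + 1) h -
    D.crossing j l (by omega) * D.crossing j (l + 1) h * D.crossing j l (by omega)

theorem braidDiff_apply {l : ℕ} (h : l + 2 < n + 1) (f : Fin (n + 1) → S) (c : Fin (n + 1)) :
    D.braidDiff j l h f c =
      D.crossing j (l + 1) h (D.crossing j l (by omega) (D.crossing j (l + 1) h f)) c -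
      D.crossing j l (by omega) (D.crossing j (l + 1) h (D.crossing j l (by omega) f)) c := rfl

/-- In the first row of the 3 × 3 matrix the coefficient of f (l + 1) vanishes by `braid_entries`,
and f (l + 2) enters both triple products with the same coefficient. -/
theorem braidDiff_left {l : ℕ} (h : l + 2 < n + 1) (f : Fin (n + 1) → S) :
    D.braidDiff j l h f (pos l (by omega)) =
      (D.qs j (pos l (by omega)) - D.ts l (by omega) * D.ts l (by omega)) *
        D.us j (pos (l + 1) (by omega)) * f (pos l (by omega)) := by
  obtain ⟨e11, e12, -, -, -, -, -, -⟩ := (D.isSpectral j l (by omega)).braid_entries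
  rw [braidDiff_apply, crossing_above _ _ _ _ le_rfl, crossing_left, crossing_above _ _ _ _ le_rfl,
    crossing_left (l := l + 1), crossing_left (l := l), crossing_above _ _ _ _ le_rfl,
    crossing_left (l := l + 1), crossing_left (l := l), crossing_right (l := l),
    crossing_below (c := l + 1 + 1) _ _ _ _ (by omega), ← e11]
  have e := congrArg (· * f (pos (l + 1) (by omega))) e12
  beta_reduce at e
  rw [zero_mul] at e
  rw [← sub_eq_zero, ← e]
  noncomm_ring

theorem braidDiff_mid {l : ℕ} (h : l + 2 < n + 1) (f : Fin (n + 1) → S) :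
    D.braidDiff j l h f (pos (l + 1) (by omega)) =
      D.ds j l (by omega) * f (pos (l + 1) (by omega)) := by
  obtain ⟨-, -, e21, e22, e23, -, -, -⟩ := (D.isSpectral j l (by omega)).braid_entries
  rw [braidDiff_apply, crossing_left (l := l + 1), crossing_right (l := l),
    crossing_below (c := l + 1 + 1) _ _ _ _ (by omega),
    crossing_above _ _ _ _ le_rfl, crossing_left (l := l + 1), crossing_right (l := l + 1),
    crossing_right (l := l), crossing_above _ _ _ _ le_rfl, crossing_left (l := l + 1),
    crossing_left (l := l), crossing_right (l := l),
    crossing_below (c := l + 1 + 1) _ _ _ _ (by omega), ← e22]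
  have e := congrArg (· * f (pos l (by omega))) e21
  have e' := congrArg (· * f (pos (l + 2) (by omega))) e23
  beta_reduce at e e'
  rw [zero_mul] at e e'
  -- The right-hand side is written as 0 + 0 so that each zero can be replaced by one vanishing
  -- off-diagonal entry; an identity of free noncommutative rings remains.
  rw [← sub_eq_zero, ← add_zero (0 : S)]
  nth_rewrite 1 [← e]
  rw [← e']
  noncomm_ring

theorem braidDiff_right {l : ℕ} (h : l + 2 < n + 1) (f : Fin (n + 1) → S) :
    D.braidDiff j l h f (pos (l + 2) h) =
      (D.qs j (pos (l + 1) (by omega)) - D.ts l (by omega) * D.ts l (by omega)) *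
        D.us j (pos l (by omega)) * f (pos (l + 2) h) := by
  obtain ⟨-, -, -, -, -, e31, e32, e33⟩ := (D.isSpectral j l (by omega)).braid_entries
  rw [braidDiff_apply, crossing_right (l := l + 1), crossing_right (l := l),
    crossing_below (c := l + 1 + 1) _ _ _ _ (by omega),
    crossing_above _ _ _ _ le_rfl, crossing_left (l := l + 1), crossing_right (l := l + 1),
    crossing_below (c := l + 2) _ _ _ _ (by omega), crossing_right (l := l + 1),
    crossing_right (l := l), crossing_below (c := l + 1 + 1) _ _ _ _ (by omega), ← e33]
  have e := congrArg (· * f (pos l (by omega))) e31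
  have e' := congrArg (· * f (pos (l + 1) (by omega))) e32
  beta_reduce at e e'
  rw [zero_mul] at e e'
  rw [← sub_eq_zero, ← add_zero (0 : S)]
  nth_rewrite 1 [← e]
  rw [← e']
  noncomm_ring

end SpectralRing

theorem delW_eq_of_eq {J : Type*} {n : ℕ} (ν : Fin (n + 1) → J) {l : ℕ} (h : l + 1 < n + 1)
    (hν : ν (pos l (by omega)) = ν (pos (l + 1) h)) :
    delW (pos l (by omega)) ν = delW (pos (l + 1) h) ν := by
  funext m
  rcases lt_trichotomy m.1 l with hm | hm | hm
  · exact (delW_below ν _ m.2 hm).trans (delW_below ν _ m.2 (by omega)).symm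
  · refine (delW_above ν _ m.2 hm.ge).trans ((delW_below ν _ m.2 (by omega)).trans ?_).symm
    simpa only [hm] using hν
  · exact (delW_above ν _ m.2 (by omega)).trans (delW_above ν _ m.2 (by omega)).symm

/-- The extra strand at c lies to the left of the crossing, at its left end, at its right end, or to
its right. In the first case the crossing has index l - 1 in R(n), which is why l is presented as a
successor. -/
theorem position_cases (c l : ℕ) :
    (∃ l', l = l' + 1 ∧ c ≤ l') ∨ c = l ∨ c = l + 1 ∨ l + 1 < c := by
  by_cases h : c < l
  · exact Or.inl ⟨l - 1, by omega, by omega⟩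
  · omega

namespace SpectralRing

open KLR

variable {Q : KLRDatum C 𝓀} {n : ℕ} {S : Type*} [Ring S] [Algebra k S] (D : SpectralRing Q n S)
  (j : I)

/-- The component of the action of `e(ν)` at position `c`. -/
noncomputable def eComp (c : Fin (n + 1)) (ν : Fin (n + 1) → I) : S :=
  if ν c = j then D.es (delW c ν) else 0

theorem rep₀_eComp (ν : Fin (n + 1) → I) (f : Fin (n + 1) → S) (c : Fin (n + 1)) :
    D.rep₀ j (gE k ν) f c = D.eComp j c ν * f c := D.rep₀_e j ν f c

theorem eComp_comm {y : S} (hy : D.IsDiag y) (c : Fin (n + 1)) (ν : Fin (n + 1) → I) :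
    Commute (D.eComp j c ν) y := by
  rw [eComp]
  split_ifs
  · exact hy.2.2 _
  · exact Commute.zero_left _

/-- u is nonzero only where the neighbour of the extra strand has letter j as well. In that case
deleting either of the two equal letters leaves the same word. -/
theorem us_eComp {l : ℕ} (h : l + 1 < n + 1) (ν : Fin (n + 1) → I) :
    D.us j (pos l (by omega)) * D.eComp j (pos l (by omega)) ν =
      D.eComp j (pos (l + 1) h) ν * D.us j (pos l (by omega)) := by
  rw [(D.eComp_comm j (D.isDiag_us j _) _ _).eq, eComp, eComp]
  split_ifs with h1 h2 h2
  · rw [delW_eq_of_eq ν h (h1.trans h2.symm)]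
  · rw [us_mul_es, if_neg, mul_zero]
    rwa [delW_above _ _ _ le_rfl]
  · rw [us_mul_es, if_neg, mul_zero]
    rwa [delW_below _ _ _ (by omega)]
  · rw [mul_zero]

theorem ts_braid {l : ℕ} (h : l + 2 < n) (ν : Fin n → I) :
    (D.ts (l + 1) h * D.ts l (by omega) * D.ts (l + 1) h -
      D.ts l (by omega) * D.ts (l + 1) h * D.ts l (by omega)) * D.es ν =
    if ν (pos l (by omega)) = ν (pos (l + 2) h) then
      evalDivDiff (Q.t (ν (pos l (by omega))) (ν (pos (l + 1) (by omega))))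
        (D.xs (pos l (by omega))) (D.xs (pos (l + 1) (by omega))) (D.xs (pos (l + 2) h)) * D.es ν
      else 0 := by
  have := congrArg D.ι (braid Q l h ν)
  rw [map_mul, map_sub, map_mul, map_mul, map_mul, map_mul, apply_ite D.ι, map_mul,
    map_evalDivDiff, map_zero] at this
  exact this

theorem rep₀_rel_τ_e (l : ℕ) (h : l + 1 < n + 1) (ν : Fin (n + 1) → I) (f : Fin (n + 1) → S)
    (c : ℕ) (hc : c < n + 1) : D.crossing j l h (D.rep₀ j (gE k ν) f) (pos c hc) =
      D.rep₀ j (gE k (ν ∘ sSwap l h)) (D.crossing j l h f) (pos c hc) := by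
  rcases position_cases c l with ⟨l, rfl, hl⟩ | rfl | rfl | hl
  · rw [crossing_above _ _ _ _ hl, rep₀_e, rep₀_e, crossing_above _ _ _ _ hl, Function.comp_apply,
      sSwap_of_ne (l + 1) h c hc (by omega) (by omega), delW_swap_above _ _ _ hl, ← mul_assoc,
      ← mul_assoc]
    split_ifs <;> simp [ts_es]
  · rw [crossing_left, rep₀_eComp, rep₀_eComp, rep₀_e, crossing_left, Function.comp_apply,
      sSwap_left, delW_swap_left]
    change _ = D.eComp j (pos (c + 1) h) ν * _
    rw [← mul_assoc, D.us_eComp j h]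
    noncomm_ring
  · rw [crossing_right, rep₀_eComp, rep₀_eComp, rep₀_e, crossing_right, Function.comp_apply,
      sSwap_right, delW_swap_right]
    change _ = D.eComp j (pos l (by omega)) ν * _
    rw [← mul_assoc (D.us j _), ← (D.eComp_comm j (D.isDiag_us j _) _ _).eq, ← us_eComp,
      ← (D.eComp_comm j (D.isDiag_us j _) _ _).eq, mul_add, ← mul_assoc, ← mul_assoc, mul_sub,
      sub_mul, (D.eComp_comm j (D.isDiag_qs j _) _ _).eq,
      (D.eComp_comm j ((D.isDiag_us j _).mul (D.isDiag_us j _)) _ _).eq, ← mul_assoc]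
  · rw [crossing_below _ _ _ _ hl, rep₀_e, rep₀_e, crossing_below _ _ _ _ hl, Function.comp_apply,
      sSwap_of_ne l h c hc (by omega) (by omega), delW_swap_below _ _ _ hl, ← mul_assoc,
      ← mul_assoc]
    split_ifs <;> simp [ts_es]

/-- At most one of two distant crossings touches the extra strand. The other acts as a crossing of
R(n), which commutes with u and q of a strand it does not move. -/
theorem crossing_comm_aux {l m : ℕ} (hl : l + 1 < n + 1) (hm : m + 1 < n + 1) (hlm : l + 1 < m)
    (f : Fin (n + 1) → S) (c : ℕ) (hc : c < n + 1) :
    D.crossing j l hl (D.crossing j m hm f) (pos c hc) =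
      D.crossing j m hm (D.crossing j l hl f) (pos c hc) := by
  obtain ⟨m, rfl⟩ : ∃ m', m = m' + 1 := ⟨m - 1, by omega⟩
  have e1 : ∀ i (hi : i < n), i < l ∨ l + 1 < i →  ∀ y, D.ts l (by omega) *
      (D.us j (pos i hi) * y) = D.us j (pos i hi) * (D.ts l (by omega) * y) := by
    intro i hi h y
    rw [← mul_assoc, (D.ts_comm_us j l (by omega) (pos i hi) (by dsimp only; omega)
      (by dsimp only; omega)).eq, mul_assoc]
  have e2 : ∀ i (hi : i < n), i < l ∨ l + 1 < i →  ∀ y, D.ts l (by omega) *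
      (D.qs j (pos i hi) * y) = D.qs j (pos i hi) * (D.ts l (by omega) * y) := by
    intro i hi h y
    rw [← mul_assoc, (D.ts_comm_qs j l (by omega) (pos i hi) (by dsimp only; omega)
      (by dsimp only; omega)).eq, mul_assoc]
  have e3 : ∀ i (hi : i < n), i < m →  ∀ y, D.ts m (by omega) *
      (D.us j (pos i hi) * y) = D.us j (pos i hi) * (D.ts m (by omega) * y) := by
    intro i hi h y
    rw [← mul_assoc, (D.ts_comm_us j m (by omega) (pos i hi) (by dsimp only; omega)
      (by dsimp only; omega)).eq, mul_assoc]
  have e4 : ∀ i (hi : i < n), i < m →  ∀ y, D.ts m (by omega) *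
      (D.qs j (pos i hi) * y) = D.qs j (pos i hi) * (D.ts m (by omega) * y) := by
    intro i hi h y
    rw [← mul_assoc, (D.ts_comm_qs j m (by omega) (pos i hi) (by dsimp only; omega)
      (by dsimp only; omega)).eq, mul_assoc]
  rcases position_cases c l with ⟨l, rfl, hcl⟩ | rfl | rfl | hcl
  · rw [crossing_above _ _ _ _ hcl, crossing_above _ _ _ _ (by omega), crossing_above _ _ _ _ (by omega),
      crossing_above _ _ _ _ hcl, ← mul_assoc, ← mul_assoc, ts_comm _ _ _ _ _ (by omega)]
  · rw [crossing_left, crossing_above _ _ _ _ (by omega), crossing_above _ _ _ _ (by omega),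
      crossing_above _ _ _ _ (by omega), crossing_left, mul_add, mul_neg, e3 _ _ (by omega)]
  · rw [crossing_right, crossing_above _ _ _ _ (by omega), crossing_above _ _ _ _ (by omega),
      crossing_above _ _ _ _ (by omega), crossing_right, mul_add, sub_mul, sub_mul, mul_sub,
      e3 _ _ (by omega), e4 _ _ (by omega), mul_assoc, mul_assoc, e3 _ _ (by omega),
      e3 _ _ (by omega)]
  · rcases position_cases c (m + 1) with ⟨m', hm', hcm⟩ | rfl | rfl | hcm
    · obtain rfl : m = m' := by omega
      rw [crossing_below _ _ _ _ hcl, crossing_above _ _ _ _ hcm, crossing_above _ _ _ _ hcm,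
        crossing_below _ _ _ _ hcl, ← mul_assoc, ← mul_assoc, ts_comm _ _ _ _ _ (by omega)]
    · rw [crossing_below _ _ _ _ hcl, crossing_left, crossing_left, crossing_below _ _ _ _ hcl,
        crossing_below _ _ _ _ (by omega), mul_add, mul_neg, e1 _ _ (by omega)]
    · rw [crossing_below _ _ _ _ hcl, crossing_right, crossing_right, crossing_below _ _ _ _ hcl,
        crossing_below _ _ _ _ (by omega), mul_add, sub_mul, sub_mul, mul_sub, mul_assoc, mul_assoc,
        e1 _ _ (by omega), e1 _ _ (by omega), e1 _ _ (by omega), e2 _ _ (by omega)]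
    · rw [crossing_below _ _ _ _ hcl, crossing_below _ _ _ _ hcm, crossing_below _ _ _ _ hcm,
        crossing_below _ _ _ _ hcl, ← mul_assoc, ← mul_assoc, ts_comm _ _ _ _ _ (by omega)]

/-- Away from the extra strand this is the quadratic relation of R(n). At the extra strand the
square is q, which on a given word is the polynomial Q evaluated at x and z. -/
theorem rep₀_rel_τ_sq (l : ℕ) (h : l + 1 < n + 1) (ν : Fin (n + 1) → I) (f : Fin (n + 1) → S)
    (c : ℕ) (hc : c < n + 1) :
    D.crossing j l h (D.crossing j l h (D.rep₀ j (gE k ν) f)) (pos c hc) =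
      D.rep₀ j (evalTwo (Q.t (ν (pos l (Nat.lt_of_succ_lt h))) (ν (pos (l + 1) h)))
        (gX I k (pos l (Nat.lt_of_succ_lt h))) (gX I k (pos (l + 1) h)))
          (D.rep₀ j (gE k ν) f) (pos c hc) := by
  rw [rep₀_evalTwo]
  rcases position_cases c l with ⟨l, rfl, hl⟩ | rfl | rfl | hl
  · rw [crossing_above _ _ _ _ hl, crossing_above _ _ _ _ hl, rep₀_e, posVar_above _ _ _ hl,
      posVar_above _ _ _ (by omega)]
    split_ifs
    · have := D.ts_sq l (by omega) (delW (pos c hc) ν)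
      rw [delW_above _ _ _ hl, delW_above _ _ _ (by omega)] at this
      rw [← mul_assoc, ← mul_assoc, this, mul_assoc]
    · simp
  · rw [crossing_sq_left, rep₀_e, posVar_self, posVar_above _ _ _ le_rfl]
    split_ifs with hj
    · rw [← mul_assoc, qs, diag_mul_es, delW_above _ _ _ le_rfl,
        Q.evalTwo_symm _ _ (D.z_comm_xs _).symm, hj, mul_assoc]
    · simp
  · rw [crossing_sq_right, rep₀_e, posVar_self, posVar_below _ _ _ (by omega)]
    split_ifs with hj
    · rw [← mul_assoc, qs, diag_mul_es, delW_below _ _ _ (by omega), hj, mul_assoc]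
    · simp
  · rw [crossing_below _ _ _ _ hl, crossing_below _ _ _ _ hl, rep₀_e, posVar_below _ _ _ hl,
      posVar_below _ _ _ (by omega)]
    split_ifs
    · have := D.ts_sq l (by omega) (delW (pos c hc) ν)
      rw [delW_below _ _ _ hl, delW_below _ _ _ (by omega)] at this
      rw [← mul_assoc, ← mul_assoc, this, mul_assoc]
    · simp

/-- If the extra strand is not among the three strands, this is the braid relation of R(n).
Otherwise the diagonal entries of `braidDiff` are the divided differences of Q with z as the first,
middle or last variable. -/
theorem rep₀_rel_braid (l : ℕ) (h : l + 2 < n + 1) (ν : Fin (n + 1) → I) (f : Fin (n + 1) → S)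
    (c : ℕ) (hc : c < n + 1) :
    D.braidDiff j l h (D.rep₀ j (gE k ν) f) (pos c hc) =
      if ν (pos l (by omega)) = ν (pos (l + 2) h) then
        D.rep₀ j (evalDivDiff (Q.t (ν (pos l (by omega))) (ν (pos (l + 1) (by omega))))
          (gX I k (pos l (by omega))) (gX I k (pos (l + 1) (by omega)))
          (gX I k (pos (l + 2) h))) (D.rep₀ j (gE k ν) f) (pos c hc) else 0 := by
  rw [rep₀_evalDivDiff]
  rcases position_cases c l with ⟨l, rfl, hl⟩ | rfl | rfl | hl
  · rw [braidDiff_apply]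
    simp only [crossing_above _ _ hc _ hl, crossing_above _ _ hc (l := l + 1) _ (Nat.le_succ_of_le hl),
      posVar_above _ hc _ hl, posVar_above _ hc (l := l + 1) _ (Nat.le_succ_of_le hl),
      posVar_above _ hc (l := l + 2) _ (Nat.le_add_right_of_le hl), ← mul_assoc, ← sub_mul, rep₀_e]
    by_cases hj : ν (pos c hc) = j
    · have := D.ts_braid (l := l) (by omega) (delW (pos c hc) ν)
      rw [delW_above _ _ _ hl, delW_above _ _ _ (by omega), delW_above _ _ _ (by omega)] at this
      rw [if_pos hj, this, ite_mul, zero_mul]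
    · simp only [if_neg hj, mul_zero, zero_mul, ite_self]
  · rw [braidDiff_left, rep₀_e, posVar_self, posVar_above _ _ _ le_rfl,
      posVar_above _ _ _ (by omega)]
    by_cases hj : ν (pos c hc) = j
    · rw [if_pos hj, ← mul_assoc, braid_error_left, delW_above _ _ _ le_rfl,
        delW_above _ _ _ (by omega), hj, ite_mul, zero_mul, mul_assoc]
    · simp only [if_neg hj, mul_zero, zero_mul, ite_self]
  · rw [braidDiff_mid, rep₀_e, posVar_self, posVar_below _ _ _ (by omega),
      posVar_above _ _ _ le_rfl]
    by_cases hj : ν (pos (l + 1) hc) = j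
    · rw [if_pos hj, ← mul_assoc, ds, diag_mul_es, delW_above _ _ _ le_rfl,
        delW_below _ _ _ (by omega), hj, ite_mul, ite_mul, zero_mul, zero_mul, mul_assoc]
    · simp only [if_neg hj, mul_zero, zero_mul, ite_self]
  · obtain rfl | hl := (Nat.succ_le_of_lt hl).eq_or_lt
    · rw [braidDiff_right, rep₀_e, posVar_self, posVar_below _ _ _ (by omega),
        posVar_below _ _ _ (by omega)]
      by_cases hj : ν (pos (l + 2) hc) = j
      · rw [if_pos hj, ← mul_assoc, braid_error_right, delW_below _ _ _ (by omega),
          delW_below _ _ _ (by omega), ite_mul, zero_mul, mul_assoc, hj]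
      · simp only [if_neg hj, mul_zero, zero_mul, ite_self]
    · have h0 : l + 1 < c := by omega
      rw [braidDiff_apply]
      simp only [crossing_below _ _ hc (l := l) _ h0, crossing_below _ _ hc (l := l + 1) _ hl,
        posVar_below _ hc (l := l) _ (by omega), posVar_below _ hc (l := l + 1) _ h0,
        posVar_below _ hc (l := l + 2) _ hl, ← mul_assoc, ← sub_mul, rep₀_e]
      by_cases hj : ν (pos c hc) = j
      · have := D.ts_braid (l := l) (by omega) (delW (pos c hc) ν)
        rw [delW_below _ _ _ (by omega), delW_below _ _ _ h0, delW_below _ _ _ hl] at this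
        rw [if_pos hj, this, ite_mul, zero_mul]
      · simp only [if_neg hj, mul_zero, zero_mul, ite_self]

end SpectralRing

namespace SpectralRing

open KLR

variable {Q : KLRDatum C 𝓀} {n : ℕ} {S : Type*} [Ring S] [Algebra k S] (D : SpectralRing Q n S)
  (j : I)

theorem posVar_swap (l : ℕ) (h : l + 1 < n + 1) (m : Fin (n + 1)) :
    D.posVar (pos l (by omega)) (sSwap l h m) = D.posVar (pos (l + 1) h) m := by
  obtain ⟨m, hm⟩ := m
  by_cases h1 : m = l
  · subst h1
    rw [show (⟨m, hm⟩ : Fin (n + 1)) = pos m (by omega) from rfl, sSwap_left,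
      posVar_above _ _ _ le_rfl, posVar_below _ _ _ (Nat.lt_succ_self m)]
  by_cases h2 : m = l + 1
  · subst h2
    rw [show (⟨l + 1, hm⟩ : Fin (n + 1)) = pos (l + 1) h from rfl, sSwap_right, posVar_self,
      posVar_self]
  rw [sSwap_of_ne _ _ _ _ h1 h2]
  rcases Nat.lt_or_ge m l with h3 | h3
  · rw [posVar_below _ _ _ h3, posVar_below _ _ _ (by omega)]
  · obtain ⟨m, rfl⟩ : ∃ m', m = m' + 1 := ⟨m - 1, by omega⟩
    rw [posVar_above _ _ _ (by omega), posVar_above _ _ _ (by omega)]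

theorem posVar_swap' (l : ℕ) (h : l + 1 < n + 1) (m : Fin (n + 1)) :
    D.posVar (pos (l + 1) h) (sSwap l h m) = D.posVar (pos l (by omega)) m := by
  rw [← posVar_swap, sSwap_sSwap]

/-- This is the source of the ±1 in the relation between τ_l and x_m. The variables seen with the
extra strand at l and at l + 1 differ only for m = l and m = l + 1, by z - x_l and its negative, and
u cancels this factor. -/
theorem us_posVar {l : ℕ} (h : l + 1 < n + 1) (m : Fin (n + 1)) :
    D.us j (pos l (by omega)) * (D.posVar (pos l (by omega)) m - D.posVar (pos (l + 1) h) m) =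
      if m = pos l (by omega) then D.ι (eAt Q (pos l (by omega)) j)
      else if m = pos (l + 1) h then -D.ι (eAt Q (pos l (by omega)) j) else 0 := by
  have key : D.us j (pos l (by omega)) * (D.z - D.xs (pos l (by omega))) =
      D.ι (eAt Q (pos l (by omega)) j) := by
    rw [((D.isDiag_z.us_comm j _).sub_right ((D.isDiag_xs _).us_comm j _)).eq, us, ← mul_assoc, xs,
      D.mul_w, one_mul]
  split_ifs with h1 h2
  · rw [h1, posVar_self, posVar_below _ _ _ (by omega), key]
  · rw [h2, posVar_self, posVar_above _ _ _ le_rfl, ← key]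
    noncomm_ring
  · rw [← posVar_swap, show sSwap l h m = m from sSwap_of_ne l h m.1 m.2
      (fun h => h1 (Fin.ext h)) (fun h => h2 (Fin.ext h)), sub_self, mul_zero]

theorem eAt_eComp_left {l : ℕ} (h : l + 1 < n + 1) (ν : Fin (n + 1) → I) :
    D.ι (eAt Q (pos l (by omega)) j) * D.eComp j (pos l (by omega)) ν =
      if ν (pos l (by omega)) = ν (pos (l + 1) h) then D.eComp j (pos l (by omega)) ν else 0 := by
  rw [eComp]
  by_cases hj : ν (pos l (by omega)) = j
  · rw [if_pos hj, es, ← map_mul, eAt_mul_e, delW_above _ _ _ le_rfl, hj, apply_ite D.ι, map_zero]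
    simp only [eq_comm]
  · simp only [if_neg hj, mul_zero, ite_self]

theorem eAt_eComp_right {l : ℕ} (h : l + 1 < n + 1) (ν : Fin (n + 1) → I) :
    D.ι (eAt Q (pos l (by omega)) j) * D.eComp j (pos (l + 1) h) ν =
      if ν (pos l (by omega)) = ν (pos (l + 1) h) then D.eComp j (pos (l + 1) h) ν else 0 := by
  rw [eComp]
  by_cases hj : ν (pos (l + 1) h) = j
  · rw [if_pos hj, es, ← map_mul, eAt_mul_e, delW_below _ _ _ (by omega), hj, apply_ite D.ι,
      map_zero]
  · simp only [if_neg hj, mul_zero, ite_self]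

theorem ts_x (l : ℕ) (h : l + 1 < n) (m : Fin n) (ν : Fin n → I) :
    (D.ts l h * D.xs m - D.xs (sSwap l h m) * D.ts l h) * D.es ν =
      if ν (pos l (Nat.lt_of_succ_lt h)) = ν (pos (l + 1) h) then
        (if m = pos l (Nat.lt_of_succ_lt h) then -D.es ν
          else if m = pos (l + 1) h then D.es ν else 0)
        else 0 := by
  have := congrArg D.ι (τ_x Q l h m ν)
  simp only [map_mul, map_sub, apply_ite D.ι, map_neg, map_zero] at this
  exact this

theorem rep₀_rel_τ_x (l : ℕ) (h : l + 1 < n + 1) (m : Fin (n + 1)) (ν : Fin (n + 1) → I)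
    (f : Fin (n + 1) → S) (c : ℕ) (hc : c < n + 1) :
    D.crossing j l h (D.rep₀ j (gX I k m) (D.rep₀ j (gE k ν) f)) (pos c hc) -
      D.rep₀ j (gX I k (sSwap l h m)) (D.crossing j l h (D.rep₀ j (gE k ν) f)) (pos c hc) =
      if ν (pos l (Nat.lt_of_succ_lt h)) = ν (pos (l + 1) h) then
        (if m = pos l (Nat.lt_of_succ_lt h) then -D.rep₀ j (gE k ν) f (pos c hc)
          else if m = pos (l + 1) h then D.rep₀ j (gE k ν) f (pos c hc) else 0) else 0 := by
  have zero : ∀ {p : Prop} [Decidable p] {p' : Prop} [Decidable p'] {q : Prop} [Decidable q] {y : S},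
      ¬p → ¬p' → (if q then (if p then -y else if p' then y else 0) else 0) = 0 := by
    intro p _ p' _ q _ y hp hp'
    rw [if_neg hp, if_neg hp', ite_self]
  rw [rep₀_x]
  obtain ⟨m, hm⟩ := m
  rcases position_cases c l with ⟨l, rfl, hl⟩ | rfl | rfl | hl
  · rw [crossing_above _ _ _ _ hl, crossing_above _ _ _ _ hl, rep₀_x]
    rcases position_cases m c with ⟨c, rfl, hmc⟩ | rfl | h' | h'
    · rw [zero (by simp only [Fin.ext_iff]; omega) (by simp only [Fin.ext_iff]; omega),
        sSwap_of_ne _ _ _ _ (by omega) (by omega), posVar_below _ _ _ (by omega), ← mul_assoc,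
        (D.ts_comm_xs l _ _ (by dsimp only; omega) (by dsimp only; omega)).eq, mul_assoc, sub_self]
    · rw [zero (by simp only [Fin.ext_iff]; omega) (by simp only [Fin.ext_iff]; omega),
        sSwap_of_ne _ _ _ _ (by omega) (by omega), posVar_self, ← mul_assoc, ← mul_assoc,
        (D.ts_comm_z _ _).eq, sub_self]
    all_goals
      obtain ⟨m, rfl⟩ : ∃ m', m = m' + 1 := ⟨m - 1, by omega⟩
      have hs : sSwap (l + 1) h ⟨m + 1, hm⟩ = pos ((sSwap l (n := n) (by omega) (pos m (by omega))).1 + 1)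
          (by omega) := Fin.ext (by
        change _ = (sSwap l _ (pos m _)).1 + 1
        rw [sSwap_val, sSwap_val]
        dsimp only
        split_ifs <;> omega)
      have hcm : c ≤ (sSwap l (n := n) (by omega) (pos m (by omega))).1 := by
        rw [sSwap_val]; dsimp only; split_ifs <;> omega
      rw [hs, posVar_above _ _ _ hcm, posVar_above _ _ _ (by omega), ← mul_assoc, ← mul_assoc,
        ← sub_mul, rep₀_e]
      by_cases hj : ν (pos c hc) = j
      · have := D.ts_x l (by omega) (pos m (by omega)) (delW (pos c hc) ν)
        rw [delW_above _ _ _ hl, delW_above _ _ _ (by omega)] at this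
        rw [if_pos hj, ← mul_assoc]
        refine (congrArg (· * f (pos c hc)) this).trans ?_
        simp only [Fin.ext_iff, ite_mul, zero_mul, neg_mul, Nat.add_right_cancel_iff]
      · simp only [if_neg hj, mul_zero, zero_mul, neg_zero, ite_self]
  · rw [crossing_left, crossing_left, rep₀_x, rep₀_x, posVar_swap]
    -- The upper right entry 1 exchanges the variables exactly, so the terms in position c + 1
    -- cancel and only u times the difference of the variables is left.
    have key : -(D.us j (pos c (by omega)) *
        (D.posVar (pos c hc) ⟨m, hm⟩ - D.posVar (pos (c + 1) h) ⟨m, hm⟩) *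
          D.rep₀ j (gE k ν) f (pos c hc)) =
        -(D.us j (pos c (by omega)) * (D.posVar (pos c hc) ⟨m, hm⟩ * D.rep₀ j (gE k ν) f (pos c hc))) +
          D.posVar (pos (c + 1) h) ⟨m, hm⟩ * D.rep₀ j (gE k ν) f (pos (c + 1) h) -
        D.posVar (pos (c + 1) h) ⟨m, hm⟩ *
          (-(D.us j (pos c (by omega)) * D.rep₀ j (gE k ν) f (pos c hc)) +
            D.rep₀ j (gE k ν) f (pos (c + 1) h)) := by
      rw [mul_add, mul_neg, ← mul_assoc (D.posVar (pos (c + 1) h) ⟨m, hm⟩),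
        ← ((D.isDiag_posVar (pos (c + 1) h) ⟨m, hm⟩).us_comm j _).eq]
      noncomm_ring
    rw [← key, us_posVar, rep₀_eComp]
    have e := D.eAt_eComp_left j h ν
    split_ifs at e ⊢ <;> simp only [neg_mul, zero_mul, neg_zero, neg_neg, ← mul_assoc, e]
  · rw [crossing_right, crossing_right, rep₀_x, rep₀_x, posVar_swap']
    -- The term with q - u² cancels because q and u commute with the variables.
    have key : -(D.us j (pos l (by omega)) *
        (D.posVar (pos l (by omega)) ⟨m, hm⟩ - D.posVar (pos (l + 1) hc) ⟨m, hm⟩) *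
          D.rep₀ j (gE k ν) f (pos (l + 1) hc)) =
        (D.qs j (pos l (by omega)) - D.us j (pos l (by omega)) * D.us j (pos l (by omega))) *
          (D.posVar (pos l (by omega)) ⟨m, hm⟩ * D.rep₀ j (gE k ν) f (pos l (by omega))) +
        D.us j (pos l (by omega)) *
          (D.posVar (pos (l + 1) h) ⟨m, hm⟩ * D.rep₀ j (gE k ν) f (pos (l + 1) h)) -
        D.posVar (pos l (by omega)) ⟨m, hm⟩ *
          ((D.qs j (pos l (by omega)) - D.us j (pos l (by omega)) * D.us j (pos l (by omega))) *
            D.rep₀ j (gE k ν) f (pos l (by omega)) +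
          D.us j (pos l (by omega)) * D.rep₀ j (gE k ν) f (pos (l + 1) h)) := by
      have c1 := ((D.isDiag_posVar (pos l (by omega)) ⟨m, hm⟩).us_comm j (pos l (by omega)))
      have c2 := ((D.isDiag_posVar (pos l (by omega)) ⟨m, hm⟩).qs_comm j (pos l (by omega)))
      rw [mul_add, ← mul_assoc (D.posVar (pos l (by omega)) ⟨m, hm⟩),
        ← mul_assoc (D.posVar (pos l (by omega)) ⟨m, hm⟩), ← c1.eq,
        ← (c2.sub_left (c1.mul_left c1)).eq]
      noncomm_ring
    rw [← key, us_posVar, rep₀_eComp]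
    have e := D.eAt_eComp_right j h ν
    split_ifs at e ⊢ <;> simp only [neg_mul, zero_mul, neg_zero, neg_neg, ← mul_assoc, e]
  · rw [crossing_below _ _ _ _ hl, crossing_below _ _ _ _ hl, rep₀_x]
    rcases position_cases m c with ⟨c, rfl, hmc⟩ | rfl | h' | h'
    · have hs : (sSwap l h ⟨m, hm⟩) = pos (sSwap l (n := n) (by omega) (pos m (by omega))).1
          (by omega) := Fin.ext (by
        change _ = (sSwap l _ (pos m _)).1
        rw [sSwap_val, sSwap_val])
      have hcm : (sSwap l (n := n) (by omega) (pos m (by omega))).1 < c + 1 := by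
        rw [sSwap_val]; dsimp only; split_ifs <;> omega
      rw [hs, posVar_below _ _ _ hcm, posVar_below _ _ _ (by omega), ← mul_assoc, ← mul_assoc,
        ← sub_mul, rep₀_e]
      by_cases hj : ν (pos (c + 1) hc) = j
      · have := D.ts_x l (by omega) (pos m (by omega)) (delW (pos (c + 1) hc) ν)
        rw [delW_below _ _ _ (by omega), delW_below _ _ _ hl] at this
        rw [if_pos hj, ← mul_assoc]
        refine (congrArg (· * f (pos (c + 1) hc)) this).trans ?_
        simp only [Fin.ext_iff, ite_mul, zero_mul, neg_mul]
      · simp only [if_neg hj, mul_zero, zero_mul, neg_zero, ite_self]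
    · rw [zero (by simp only [Fin.ext_iff]; omega) (by simp only [Fin.ext_iff]; omega),
        sSwap_of_ne _ _ _ _ (by omega) (by omega), posVar_self, ← mul_assoc, ← mul_assoc,
        (D.ts_comm_z _ _).eq, sub_self]
    all_goals
      obtain ⟨m, rfl⟩ : ∃ m', m = m' + 1 := ⟨m - 1, by omega⟩
      rw [zero (by simp only [Fin.ext_iff]; omega) (by simp only [Fin.ext_iff]; omega),
        sSwap_of_ne _ _ _ _ (by omega) (by omega), posVar_above _ _ _ (by omega), ← mul_assoc,
        (D.ts_comm_xs l _ _ (by dsimp only; omega) (by dsimp only; omega)).eq, mul_assoc, sub_self]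

theorem IsDiag.posVar_comm {D : SpectralRing Q n S} {y : S} (h : D.IsDiag y) (c m : Fin (n + 1)) :
    Commute y (D.posVar c m) := by
  rw [posVar]
  split_ifs
  exacts [(h.2.1 _).symm, h.1.symm, (h.2.1 _).symm]

/-- Deleting position c identifies the words with letter j there with all words of length n, whose
idempotents add up to 1. -/
theorem sum_eComp (c : Fin (n + 1)) : ∑ ν, D.eComp j c ν = 1 := by
  rw [Fintype.sum_equiv (Fin.insertNthEquiv (fun _ => I) c).symm (fun ν => D.eComp j c ν)
    (fun p : I × (Fin n → I) => if p.1 = j then D.es p.2 else 0) fun ν => rfl,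
    Fintype.sum_prod_type_right, ← D.sum_es]
  exact Finset.sum_congr rfl fun μ _ => by simp

theorem rep₀_rel {a b : FreeAlgebra k (KLRGen I (n + 1))} (h : KLRRel Q (n + 1) a b) :
    D.rep₀ j a = D.rep₀ j b := by
  refine LinearMap.ext fun f => funext fun c => ?_
  obtain ⟨c, hc⟩ := c
  cases h with
  | e_mul ν ν' =>
    rw [map_mul, Module.End.mul_apply, rep₀_e, rep₀_e, apply_ite (D.rep₀ j), map_zero, ← mul_assoc]
    by_cases h : ν = ν'
    · subst h
      rw [if_pos rfl, rep₀_e]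
      split_ifs
      · rw [es_mul, if_pos rfl]
      · rw [mul_zero]
    · rw [if_neg h, LinearMap.zero_apply, Pi.zero_apply]
      split_ifs with h1 h2 h2
      · rw [es_mul, if_neg, zero_mul]
        exact fun h3 => h ((delW_inj _).2 ⟨h1.trans h2.symm, h3⟩)
      all_goals simp
  | sum_e =>
    rw [map_sum, map_one, LinearMap.sum_apply, Finset.sum_apply]
    simp only [rep₀_eComp]
    rw [← Finset.sum_mul, sum_eComp, one_mul]
    rfl
  | x_comm l m =>
    rw [map_mul, map_mul, Module.End.mul_apply, Module.End.mul_apply, rep₀_x, rep₀_x, rep₀_x,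
      rep₀_x, ← mul_assoc, ← mul_assoc]
    rw [((D.isDiag_posVar ⟨c, hc⟩ l).posVar_comm _ _).eq]
  | x_e l ν =>
    rw [map_mul, map_mul, Module.End.mul_apply, Module.End.mul_apply, rep₀_x, rep₀_eComp,
      rep₀_eComp, rep₀_x, ← mul_assoc, ← mul_assoc,
      (D.eComp_comm j (D.isDiag_posVar ⟨c, hc⟩ l) _ ν).eq]
  | τ_e l h ν =>
    rw [map_mul, map_mul, rep₀_τ]
    exact D.rep₀_rel_τ_e j l h ν f c hc
  | τ_comm l m hl hm hlm =>
    rw [map_mul, map_mul, rep₀_τ, rep₀_τ]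
    rcases hlm with h | h
    · exact D.crossing_comm_aux j hl hm h f c hc
    · exact (D.crossing_comm_aux j hm hl h f c hc).symm
  | τ_sq l h ν =>
    rw [map_mul, map_mul, map_mul, rep₀_τ]
    exact D.rep₀_rel_τ_sq j l h ν f c hc
  | τ_x l h m ν =>
    rw [map_mul, map_sub, map_mul, map_mul, rep₀_τ]
    refine (D.rep₀_rel_τ_x j l h m ν f c hc).trans ?_
    split_ifs <;> simp
  | braid l h ν =>
    rw [map_mul, map_sub, map_mul, map_mul, map_mul, map_mul, rep₀_τ, rep₀_τ]
    refine (D.rep₀_rel_braid j l h ν f c hc).trans ?_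
    split_ifs <;> simp

/-- The representation of `R(n + 1)` by insertion of a strand of colour `j` carrying the variable
`z` into the strands of `R(n)`. -/
noncomputable def rep : KLR Q (n + 1) →ₐ[k] Module.End k (Fin (n + 1) → S) :=
  RingQuot.liftAlgHom k ⟨D.rep₀ j, fun _ _ h => D.rep₀_rel j h⟩

theorem rep_mk (a : FreeAlgebra k (KLRGen I (n + 1))) : D.rep j (KLR.mk Q (n + 1) a) = D.rep₀ j a :=
  RingQuot.liftAlgHom_mkAlgHom_apply _ _ _ _

theorem rep_x (l : Fin (n + 1)) (f : Fin (n + 1) → S) (c : Fin (n + 1)) :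
    D.rep j (x Q l) f c = D.posVar c l * f c := by
  rw [x, rep_mk, rep₀_x]

theorem rep_τ (l : ℕ) (h : l + 1 < n + 1) : D.rep j (τ Q l h) = D.crossing j l h := by
  rw [τ, rep_mk, rep₀_τ]

theorem rep_e (ν : Fin (n + 1) → I) (f : Fin (n + 1) → S) (c : Fin (n + 1)) :
    D.rep j (e Q ν) f c = D.eComp j c ν * f c := by
  rw [e, rep_mk, rep₀_eComp]

/-- The vector with component `y` at the last position. -/
noncomputable def lastVec (n : ℕ) (y : S) : Fin (n + 1) → S := Pi.single (Fin.last n) y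

/-- Right multiplication by `y`. -/
noncomputable def rightMulEnd (n : ℕ) (y : S) : Module.End k (Fin (n + 1) → S) where
  toFun f c := f c * y
  map_add' _ _ := funext fun _ => add_mul _ _ _
  map_smul' _ _ := funext fun _ => smul_mul_assoc _ _ _

/-- The generators act by matrices over S multiplying from the left. This is what makes the strand
coefficients right linear. -/
theorem rep_rightMul (a : KLR Q (n + 1)) (y : S) :
    D.rep j a * rightMulEnd (k := k) n y = rightMulEnd n y * D.rep j a := by
  refine commute_induction Q (D.rep j) _ (fun ν => ?_) (fun l => ?_) (fun l h => ?_) a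
  · refine LinearMap.ext fun f => funext fun c => ?_
    change D.rep j (e Q ν) (rightMulEnd (k := k) n y f) c = D.rep j (e Q ν) f c * y
    rw [rep_e, rep_e, mul_assoc]
    rfl
  · refine LinearMap.ext fun f => funext fun c => ?_
    change D.rep j (x Q l) (rightMulEnd (k := k) n y f) c = D.rep j (x Q l) f c * y
    rw [rep_x, rep_x, mul_assoc]
    rfl
  · refine LinearMap.ext fun f => funext fun c => ?_
    rw [rep_τ]
    change D.crossing j l h (rightMulEnd (k := k) n y f) c = D.crossing j l h f c * y
    simp only [crossing, LinearMap.coe_mk, AddHom.coe_mk, rightMulEnd]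
    split_ifs <;> simp only [add_mul, neg_mul, mul_assoc]

/-- No element of R(n) moves the last position, and with the extra strand there the other strands
keep their numbers. -/
theorem rep_incl_lastVec (b : KLR Q n) (y : S) :
    D.rep j (incl Q n b) (lastVec n y) = lastVec n (D.ι b * y) := by
  have hl : ∀ (c : Fin (n + 1)) (y : S), c ≠ Fin.last n → lastVec n y c = 0 := fun c y h => by
    rw [lastVec, Pi.single_eq_of_ne h]
  have hl' : ∀ y : S, lastVec n y (Fin.last n) = y := fun y => by rw [lastVec, Pi.single_eq_same]
  obtain ⟨b, rfl⟩ := KLR.mk_surjective Q n b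
  induction b using FreeAlgebra.induction generalizing y with
  | grade0 r =>
    rw [AlgHom.commutes, AlgHom.commutes, AlgHom.commutes, AlgHom.commutes]
    change r • lastVec n y = _
    rw [lastVec, ← Pi.single_smul, ← Algebra.smul_def]
    rfl
  | grade1 g =>
    funext c
    cases g with
    | e ν =>
      change D.rep j (incl Q n (e Q ν)) _ c = lastVec n (D.es ν * y) c
      rw [incl_e, map_sum, LinearMap.sum_apply, Finset.sum_apply]
      simp only [rep_e]
      by_cases hc : c = Fin.last n
      · subst hc
        rw [hl', hl', ← Finset.sum_mul]
        congr 1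
        have : ∀ i, delW (Fin.last n) (snocW ν i) = ν := fun i => funext fun m => by
          rw [delW, Fin.succAbove_last, snocW_castSucc]
        simp [eComp, this]
      · simp [hl _ _ hc]
    | x l =>
      change D.rep j (incl Q n (x Q l)) _ c = lastVec n (D.xs l * y) c
      rw [incl_x, rep_x]
      by_cases hc : c = Fin.last n
      · subst hc
        rw [hl', hl']
        congr 1
        exact D.posVar_below (Nat.lt_succ_self n) (Nat.lt_succ_of_lt l.2) l.2
      · rw [hl _ _ hc, hl _ _ hc, mul_zero]
    | τ l h =>
      change D.rep j (incl Q n (τ Q l h)) _ c = lastVec n (D.ts l h * y) c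
      rw [incl_τ, rep_τ]
      obtain ⟨c, hc⟩ := c
      have h0 : ∀ (c : ℕ) (hc : c < n + 1) (y : S), c < n → lastVec n y (pos c hc) = 0 :=
        fun c hc y h => hl _ _ (by rw [Ne, Fin.ext_iff, Fin.val_last]; exact h.ne)
      rcases position_cases c l with ⟨l, rfl, hcl⟩ | rfl | rfl | hcl
      · rw [crossing_above _ _ _ _ hcl, h0 _ _ _ (by omega), h0 _ _ _ (by omega), mul_zero]
      · rw [crossing_left, h0 _ _ _ (by omega), h0 _ _ _ (by omega), h0 _ _ _ (by omega), mul_zero,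
          neg_zero, zero_add]
      · rw [crossing_right, h0 _ _ _ (by omega), h0 _ _ _ (by omega), h0 _ _ _ (by omega), mul_zero,
          mul_zero, zero_add]
      · rw [crossing_below _ _ _ _ hcl]
        by_cases hcn : c < n
        · rw [h0 _ _ _ hcn, h0 _ _ _ hcn, mul_zero]
        · obtain rfl : c = n := by omega
          exact (congrArg _ (hl' y)).trans (hl' _).symm
  | mul a b ha hb =>
    rw [map_mul, map_mul, map_mul, Module.End.mul_apply, hb, ha, map_mul, mul_assoc]
  | add a b ha hb =>
    rw [map_add, map_add, map_add, LinearMap.add_apply, ha, hb, map_add, add_mul, lastVec, lastVec,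
      lastVec, Pi.single_add]

end SpectralRing

end KLRAlgebras

/-! ### Laurent series coefficients and triangularity -/

section Ascending

variable {A : Type*} [Monoid A] (t : ℕ → A)

/-- The product `t_a t_{a + 1} ⋯ t_{a + d - 1}`. -/
def ascProd (a d : ℕ) : A := ((List.range' a d).map t).prod

theorem ascProd_zero (a : ℕ) : ascProd t a 0 = 1 := rfl

theorem ascProd_succ (a d : ℕ) : ascProd t a (d + 1) = t a * ascProd t (a + 1) d := by
  rw [ascProd, List.range'_succ, List.map_cons, List.prod_cons, ascProd]

theorem ascProd_succ' (a d : ℕ) : ascProd t a (d + 1) = ascProd t a d * t (a + d) := by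
  rw [ascProd, List.range'_1_concat, List.map_append, List.prod_append, ascProd]
  simp

end Ascending

section KLRAlgebras

variable {I : Type v} [Fintype I] [DecidableEq I] {P : Type*} [AddCommGroup P]
    [Module.Free ℤ P] [Module.Finite ℤ P]
variable {C : CartanDatum I P} {k : Type u} [CommRing k] {𝓀 : ℤ → AddSubgroup k}

namespace KLR

variable (Q : KLRDatum C 𝓀)

/-- The generators `τ_l`, extended by `0`. -/
noncomputable def cross (n l : ℕ) : KLR Q n := if h : l + 1 < n then τ Q l h else 0

theorem cross_eq {n l : ℕ} (h : l + 1 < n) : cross Q n l = τ Q l h := dif_pos h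

end KLR

namespace SpectralRing

open KLR

section

variable {Q : KLRDatum C 𝓀} {n : ℕ} {S : Type*} [Ring S] [Algebra k S] (D : SpectralRing Q n S)
  (j : I)

theorem lastVec_last (y : S) : lastVec n y (Fin.last n) = y := Pi.single_eq_same _ _

theorem lastVec_of_lt (y : S) (c : Fin (n + 1)) (h : c.1 < n) : lastVec n y c = 0 :=
  Pi.single_eq_of_ne (fun h' => by rw [h'] at h; exact lt_irrefl _ h) _

theorem lastVec_ext {f : Fin (n + 1) → S} {y : S} (h : f (Fin.last n) = y)
    (h' : ∀ c : Fin (n + 1), c.1 < n → f c = 0) : f = lastVec n y := by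
  funext c
  rcases eq_or_ne c (Fin.last n) with rfl | hc
  · rw [lastVec_last, h]
  · have : c.1 < n := by
      have := Fin.val_ne_of_ne hc
      rw [Fin.val_last] at this
      omega
    rw [h' c this, lastVec_of_lt _ _ this]

theorem rep_x_lastVec (y : S) : D.rep j (x Q (Fin.last n)) (lastVec n y) = lastVec n (D.z * y) := by
  refine lastVec_ext ?_ fun c hc => ?_
  · rw [rep_x, lastVec_last, posVar_self]
  · rw [rep_x, lastVec_of_lt _ _ hc, mul_zero]

theorem rep_x_pow_lastVec (m : ℕ) (y : S) :
    D.rep j (x Q (Fin.last n) ^ m) (lastVec n y) = lastVec n (D.z ^ m * y) := by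
  induction m with
  | zero => rw [pow_zero, pow_zero, map_one, one_mul]; rfl
  | succ m ih => rw [pow_succ', map_mul, Module.End.mul_apply, ih, rep_x_lastVec, pow_succ', mul_assoc]

theorem rep_eAt_lastVec (i : I) (y : S) : D.rep j (eAt Q (Fin.last n) i) (lastVec n y) =
    if i = j then lastVec n y else 0 := by
  rw [eAt, eSum, map_sum, LinearMap.sum_apply]
  funext c
  rw [Finset.sum_apply]
  simp only [rep_e]
  rcases lt_or_ge c.1 n with hc | hc
  · have : (if i = j then lastVec n y else 0) c = 0 := by
      split_ifs
      · exact lastVec_of_lt y c hc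
      · rfl
    rw [this]
    exact Finset.sum_eq_zero fun ν _ => by rw [lastVec_of_lt y c hc, mul_zero]
  · obtain rfl : c = Fin.last n := Fin.ext (by rw [Fin.val_last]; omega)
    rw [lastVec_last, ← Finset.sum_mul]
    split_ifs with h
    · subst h
      rw [lastVec_last, Finset.sum_subset (Finset.subset_univ _), sum_eComp, one_mul]
      intro ν _ hν
      rw [eComp, if_neg (by simpa using hν)]
    · rw [Finset.sum_eq_zero, zero_mul]
      · rfl
      · intro ν hν
        rw [eComp, if_neg]
        rw [Finset.mem_filter] at hν
        exact fun h' => h (hν.2.symm.trans h')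

/-- By its upper right entry 1, the new leftmost crossing τ_a copies the component at a + 1 to
position a, where there was nothing; further left everything stays zero. This triangularity
separates the products with different starting points. -/
theorem rep_ascProd_lastVec (y : S) (d : ℕ) : ∀ a (h : a + d = n),
    (∀ c : Fin (n + 1), c.1 < a →
      D.rep j (ascProd (cross Q (n + 1)) a d) (lastVec n y) c = 0) ∧
      D.rep j (ascProd (cross Q (n + 1)) a d) (lastVec n y) (pos a (by omega)) = y := by
  induction d with
  | zero =>
    rintro a rfl
    rw [ascProd_zero, map_one]
    exact ⟨fun c hc => lastVec_of_lt y c hc, lastVec_last y⟩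
  | succ d ih =>
    intro a h
    obtain ⟨h1, h2⟩ := ih (a + 1) (by omega)
    have key : D.rep j (ascProd (cross Q (n + 1)) a (d + 1)) (lastVec n y) =
        D.crossing j a (by omega)
          (D.rep j (ascProd (cross Q (n + 1)) (a + 1) d) (lastVec n y)) := by
      rw [ascProd_succ, map_mul, cross_eq Q (show a + 1 < n + 1 by omega), rep_τ]
      rfl
    rw [key]
    refine ⟨?_, ?_⟩
    · rintro ⟨c, hc⟩ hca
      dsimp only at hca
      obtain ⟨a, rfl⟩ : ∃ a', a = a' + 1 := ⟨a - 1, by omega⟩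
      rw [crossing_above _ _ _ _ (by omega), h1 _ (by dsimp only; omega), mul_zero]
    · rw [crossing_left, h1 _ (by dsimp only; omega), h2, mul_zero, neg_zero, zero_add]

end

variable (Q : KLRDatum C 𝓀) (n : ℕ)

/-- The series `(t⁻¹ - a)⁻¹ = ∑ a^m t^(m + 1)`. -/
noncomputable def resolvent {A : Type*} [Ring A] (a : A) : HahnSeries ℤ A :=
  HahnSeries.single 1 1 * HahnSeries.ofPowerSeries ℤ A (PowerSeries.mk fun m => a ^ m)

theorem mul_resolvent {A : Type*} [Ring A] (a : A) :
    (HahnSeries.single (-1 : ℤ) 1 - HahnSeries.C a) * resolvent a = 1 := by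
  -- (t⁻¹ - a) t = 1 - a t, and the geometric series inverts 1 - a t.
  have h1 : (HahnSeries.single (-1 : ℤ) 1 - HahnSeries.C a) * HahnSeries.single 1 1 =
      HahnSeries.ofPowerSeries ℤ A (1 - PowerSeries.C a * PowerSeries.X) := by
    rw [map_sub, map_mul, map_one (HahnSeries.ofPowerSeries ℤ A), HahnSeries.ofPowerSeries_C, HahnSeries.ofPowerSeries_X, sub_mul,
      HahnSeries.single_mul_single, mul_one]
    rfl
  rw [resolvent, ← mul_assoc, h1, ← map_mul]
  refine (congrArg _ ?_).trans (map_one (HahnSeries.ofPowerSeries ℤ A))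
  ext m
  rw [sub_mul, one_mul, map_sub, PowerSeries.coeff_mk, mul_assoc, PowerSeries.coeff_C_mul]
  cases m with
  | zero => simp
  | succ m =>
    rw [PowerSeries.coeff_succ_X_mul, PowerSeries.coeff_mk, ← pow_succ', sub_self]
    simp [PowerSeries.coeff_one]

theorem resolvent_mul {A : Type*} [Ring A] (a : A) :
    resolvent a * (HahnSeries.single (-1 : ℤ) 1 - HahnSeries.C a) = 1 := by
  have hc : ∀ f : HahnSeries ℤ A, HahnSeries.single 1 1 * f = f * HahnSeries.single 1 1 :=
    fun f => by
      ext d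
      rw [HahnSeries.coeff_single_mul, HahnSeries.coeff_mul_single, one_mul, mul_one]
  have h1 : HahnSeries.single 1 1 * (HahnSeries.single (-1 : ℤ) 1 - HahnSeries.C a) =
      HahnSeries.ofPowerSeries ℤ A (1 - PowerSeries.X * PowerSeries.C a) := by
    rw [map_sub, map_mul, map_one (HahnSeries.ofPowerSeries ℤ A), HahnSeries.ofPowerSeries_C, HahnSeries.ofPowerSeries_X, mul_sub,
      HahnSeries.single_mul_single, mul_one]
    rfl
  rw [resolvent, hc, mul_assoc, h1, ← map_mul]
  refine (congrArg _ ?_).trans (map_one (HahnSeries.ofPowerSeries ℤ A))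
  ext m
  rw [mul_sub, mul_one, map_sub, PowerSeries.coeff_mk, ← mul_assoc, PowerSeries.coeff_mul_C]
  cases m with
  | zero => simp
  | succ m =>
    rw [PowerSeries.coeff_succ_mul_X, PowerSeries.coeff_mk, ← pow_succ, sub_self]
    simp [PowerSeries.coeff_one]

/-- The ring `R(n)((t))` with `z = t⁻¹`. -/
noncomputable def laurent : SpectralRing Q n (HahnSeries ℤ (KLR Q n)) where
  ι := { HahnSeries.C with commutes' := fun r => (HahnSeries.algebraMap_apply).symm }
  z := HahnSeries.single (-1) 1
  z_comm a := by
    ext d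
    change (HahnSeries.single (-1 : ℤ) 1 * HahnSeries.single 0 a).coeff d =
      (HahnSeries.single 0 a * HahnSeries.single (-1 : ℤ) 1).coeff d
    rw [HahnSeries.single_mul_single, HahnSeries.single_mul_single, one_mul, mul_one, add_comm]
  w l := resolvent (x Q l)
  w_mul l := resolvent_mul _
  mul_w l := mul_resolvent _

theorem laurent_ι (a : KLR Q n) : (laurent Q n).ι a = HahnSeries.single 0 a := rfl

/-- Distinct powers of z are distinct monomials in t, so the exponent of the last dot can be read
off from the coefficients. -/
theorem laurent_z_pow (m : ℕ) : (laurent Q n).z ^ m = HahnSeries.single (-(m : ℤ)) 1 := by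
  change HahnSeries.single (-1 : ℤ) 1 ^ m = _
  rw [HahnSeries.single_pow, one_pow]
  simp

end SpectralRing

namespace KLR

open SpectralRing

variable (Q : KLRDatum C 𝓀) (n : ℕ) (j : I)

/-- The coefficient of `t^l` at the position `c` of the vector obtained by applying an element of
`R(n + 1)` to the vector with a strand of colour `j` at the last position. -/
noncomputable def strandCoeff (c : Fin (n + 1)) (l : ℤ) : KLR Q (n + 1) →+ KLR Q n where
  toFun r := ((laurent Q n).rep j r (lastVec n 1) c).coeff l
  map_zero' := by rw [map_zero]; rfl
  map_add' r s := by rw [map_add]; rfl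

theorem strandCoeff_apply (c : Fin (n + 1)) (l : ℤ) (r : KLR Q (n + 1)) :
    strandCoeff Q n j c l r = ((laurent Q n).rep j r (lastVec n 1) c).coeff l := rfl

/-- On the last basis vector b acts as left, hence also as right, multiplication by the constant
series b. Right multiplication commutes with the whole action and with taking coefficients. -/
theorem strandCoeff_mul_incl (c : Fin (n + 1)) (l : ℤ) (r : KLR Q (n + 1)) (b : KLR Q n) :
    strandCoeff Q n j c l (r * incl Q n b) = strandCoeff Q n j c l r * b := by
  have h : lastVec n ((laurent Q n).ι b * 1) =
      rightMulEnd (k := k) n ((laurent Q n).ι b) (lastVec n 1) := by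
    symm
    refine lastVec_ext ?_ fun c hc => ?_
    · change lastVec n (1 : HahnSeries ℤ (KLR Q n)) (Fin.last n) * _ = _
      rw [lastVec_last, one_mul, mul_one]
    · change lastVec n (1 : HahnSeries ℤ (KLR Q n)) c * _ = _
      rw [lastVec_of_lt _ _ hc, zero_mul]
  rw [strandCoeff_apply, map_mul, Module.End.mul_apply, rep_incl_lastVec, h, ← Module.End.mul_apply,
    rep_rightMul]
  change ((laurent Q n).rep j r (lastVec n 1) c * (laurent Q n).ι b).coeff l = _
  rw [laurent_ι, HahnSeries.coeff_mul_single, sub_zero]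
  rfl

/-- The extra strand sits in the last place and has colour j. -/
theorem strandCoeff_mul_eAt (c : Fin (n + 1)) (l : ℤ) (r : KLR Q (n + 1)) (i : I) :
    strandCoeff Q n j c l (r * eAt Q (Fin.last n) i) =
      if i = j then strandCoeff Q n j c l r else 0 := by
  rw [strandCoeff_apply, map_mul, Module.End.mul_apply, rep_eAt_lastVec]
  split_ifs
  · rfl
  · rw [map_zero]; rfl

theorem strandCoeff_ascProd_of_lt (c : Fin (n + 1)) (l : ℤ) {a d : ℕ} (h : a + d = n)
    (hc : c.1 < a) (m : ℕ) :
    strandCoeff Q n j c l (ascProd (cross Q (n + 1)) a d * x Q (Fin.last n) ^ m) = 0 := by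
  rw [strandCoeff_apply, map_mul, Module.End.mul_apply, rep_x_pow_lastVec,
    ((laurent Q n).rep_ascProd_lastVec j _ d a h).1 c hc]
  rfl

theorem strandCoeff_ascProd (l : ℤ) {a d : ℕ} (h : a + d = n) (m : ℕ) :
    strandCoeff Q n j (pos a (by omega)) l
      (ascProd (cross Q (n + 1)) a d * x Q (Fin.last n) ^ m) = if l = -m then 1 else 0 := by
  rw [strandCoeff_apply, map_mul, Module.End.mul_apply, rep_x_pow_lastVec,
    ((laurent Q n).rep_ascProd_lastVec j _ d a h).2, mul_one, laurent_z_pow,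
    HahnSeries.coeff_single]
  split_ifs <;> rfl

end KLR

end KLRAlgebras

/-! ### Spanning sets modelled on cosets of symmetric groups -/

section Spanning

open MulOpposite

/-- Elements `t_l` of a ring, `l < N`, which satisfy the relations of the symmetric group up to
terms involving a subring `X`. -/
structure IsCrossing {A : Type*} [Ring A] (t : ℕ → A) (X : Subring A) (N : ℕ) : Prop where
  move_right : ∀ l < N, ∀ p ∈ X, ∃ p' ∈ X, ∃ q ∈ X, p * t l = t l * p' + q
  move_left : ∀ l < N, ∀ p ∈ X, ∃ p' ∈ X, ∃ q ∈ X, t l * p = p' * t l + q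
  sq_mem : ∀ l < N, t l * t l ∈ X
  far : ∀ l m, l < N → m < N → l + 1 < m → t l * t m = t m * t l
  braid_mem : ∀ l, l + 1 < N → t (l + 1) * t l * t (l + 1) - t l * t (l + 1) * t l ∈ X

namespace IsCrossing

variable {A : Type*} [Ring A] (t : ℕ → A) (X : Subring A) (N : ℕ)

/-- The subring generated by `X` and all `t_l` except `t_{N - 1}`. -/
def parabolic : Subring A := Subring.closure (X ∪ t '' {l | l + 1 < N})

/-- The sum of the subgroups `t_a t_{a + 1} ⋯ t_{N - 1} C` with `a ≥ b`, where `C` is generated by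
`X` and all `t_l` except `t_{N - 1}`. -/
def filtration (b : ℕ) : AddSubgroup A :=
  AddSubgroup.closure {y | ∃ a d, ∃ c ∈ parabolic t X N, b ≤ a ∧ a + d = N ∧ y = ascProd t a d * c}

variable {t X N}

theorem mem_parabolic {p : A} (hp : p ∈ X) : p ∈ parabolic t X N :=
  Subring.subset_closure (Or.inl hp)

theorem t_mem_parabolic {l : ℕ} (hl : l + 1 < N) : t l ∈ parabolic t X N :=
  Subring.subset_closure (Or.inr ⟨l, hl, rfl⟩)

theorem ascProd_mul_mem {a b d : ℕ} (hb : b ≤ a) (hd : a + d = N) {c : A}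
    (hc : c ∈ parabolic t X N) : ascProd t a d * c ∈ filtration t X N b :=
  AddSubgroup.subset_closure ⟨a, d, c, hc, hb, hd, rfl⟩

theorem ascProd_mem {a b d : ℕ} (hb : b ≤ a) (hd : a + d = N) :
    ascProd t a d ∈ filtration t X N b := by
  simpa using ascProd_mul_mem (X := X) hb hd (one_mem (parabolic t X N))

theorem filtration_mono {b b' : ℕ} (h : b' ≤ b) : filtration t X N b ≤ filtration t X N b' :=
  AddSubgroup.closure_mono fun _ ⟨a, d, c, hc, hb, hd, hy⟩ => ⟨a, d, c, hc, h.trans hb, hd, hy⟩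

theorem filtration_mul_mem {b : ℕ} {y c : A} (hy : y ∈ filtration t X N b)
    (hc : c ∈ parabolic t X N) : y * c ∈ filtration t X N b := by
  refine AddSubgroup.closure_induction (p := fun y _ => y * c ∈ filtration t X N b) ?_ ?_ ?_ ?_ hy
  · rintro _ ⟨a, d, c', hc', hb, hd, rfl⟩
    rw [mul_assoc]
    exact ascProd_mul_mem hb hd (mul_mem hc' hc)
  · rw [zero_mul]; exact zero_mem _
  · intro x y _ _ hx hy; rw [add_mul]; exact add_mem hx hy
  · intro x _ hx; rw [neg_mul]; exact neg_mem hx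

/-- A criterion for left stability. -/
theorem mul_filtration_mem {b b' : ℕ} {s : A} (h : ∀ a d, b ≤ a → a + d = N →
    s * ascProd t a d ∈ filtration t X N b') {y : A} (hy : y ∈ filtration t X N b) :
    s * y ∈ filtration t X N b' := by
  refine AddSubgroup.closure_induction (p := fun y _ => s * y ∈ filtration t X N b') ?_ ?_ ?_ ?_ hy
  · rintro _ ⟨a, d, c, hc, hb, hd, rfl⟩
    rw [← mul_assoc]
    exact filtration_mul_mem (h a d hb hd) hc
  · rw [mul_zero]; exact zero_mem _
  · intro x y _ _ hx hy; rw [mul_add]; exact add_mem hx hy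
  · intro x _ hx; rw [mul_neg]; exact neg_mem hx

variable (H : IsCrossing t X N)
include H

theorem ascProd_comm_of_lt (l : ℕ) (d : ℕ) : ∀ a, l + 1 < a → a + d = N →
    t l * ascProd t a d = ascProd t a d * t l := by
  induction d with
  | zero => intro a _ _; rw [ascProd_zero, mul_one, one_mul]
  | succ d ih =>
    intro a hl hd
    rw [ascProd_succ, ← mul_assoc, H.far l a (by omega) (by omega) hl, mul_assoc,
      ih (a + 1) (by omega) (by omega), mul_assoc]

theorem comm_ascProd_of_lt (l a d : ℕ) (h : a + d < l) (hl : l < N) :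
    t l * ascProd t a d = ascProd t a d * t l := by
  induction d with
  | zero => rw [ascProd_zero, mul_one, one_mul]
  | succ d ih =>
    rw [ascProd_succ', ← mul_assoc, ih (by omega), mul_assoc, mul_assoc,
      H.far (a + d) l (by omega) hl (by omega)]

theorem t_mul_mem_of_lt {l b : ℕ} (h : l + 1 < b) {y : A} (hy : y ∈ filtration t X N b) :
    t l * y ∈ filtration t X N b :=
  mul_filtration_mem (fun a d ha hd => by
    rw [H.ascProd_comm_of_lt l d a (by omega) hd]
    exact ascProd_mul_mem ha hd (t_mem_parabolic (by omega))) hy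

/-- Either t_l lengthens a product that starts at l + 1, or it commutes past one that starts later
and joins the factor in C. -/
theorem t_mul_mem_pred {l : ℕ} {y : A} (hy : y ∈ filtration t X N (l + 1)) :
    t l * y ∈ filtration t X N l :=
  mul_filtration_mem (fun a d ha hd => by
    rcases ha.eq_or_lt with rfl | ha
    · rw [← ascProd_succ]
      exact ascProd_mem le_rfl (by omega)
    · rw [H.ascProd_comm_of_lt l d a ha hd]
      exact ascProd_mul_mem (by omega) hd (t_mem_parabolic (by omega))) hy

/-- Moving an element of X past the first crossing costs a term in which this crossing is missing;
it starts later and so lies deeper in the filtration. -/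
theorem mul_ascProd_mem (d : ℕ) : ∀ a, a + d = N → ∀ p ∈ X,
    p * ascProd t a d ∈ filtration t X N a := by
  induction d with
  | zero =>
    intro a ha p hp
    rw [ascProd_zero, mul_one]
    simpa [ascProd_zero] using ascProd_mul_mem (t := t) le_rfl ha (mem_parabolic (t := t) (N := N) hp)
  | succ d ih =>
    intro a ha p hp
    obtain ⟨p', hp', q, hq, h⟩ := H.move_right a (by omega) p hp
    rw [ascProd_succ, ← mul_assoc, h, add_mul, mul_assoc]
    exact add_mem (H.t_mul_mem_pred (ih (a + 1) (by omega) p' hp'))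
      (filtration_mono (Nat.le_succ a) (ih (a + 1) (by omega) q hq))

theorem mul_mem_filtration {p : A} (hp : p ∈ X) {b : ℕ} {y : A} (hy : y ∈ filtration t X N b) :
    p * y ∈ filtration t X N b :=
  mul_filtration_mem (fun a d ha hd => filtration_mono ha (H.mul_ascProd_mem d a hd p hp)) hy

theorem ascProd_mul_mem_of_lt {a b : ℕ} (d : ℕ) (h : a + d < b) {y : A}
    (hy : y ∈ filtration t X N b) : ascProd t a d * y ∈ filtration t X N b := by
  induction d generalizing a with
  | zero => rwa [ascProd_zero, one_mul]
  | succ d ih =>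
    rw [ascProd_succ, mul_assoc]
    exact H.t_mul_mem_of_lt (by omega) (ih (by omega))

/-- A crossing to the right of `a` passes through `t_a ⋯ t_{N - 1}`. -/
theorem t_mul_ascProd_sub_mem {a d l : ℕ} (hd : a + d = N) (hal : a ≤ l) (hl : l + 1 < N) :
    t (l + 1) * ascProd t a d - ascProd t a d * t l ∈ filtration t X N (l + 2) := by
  obtain ⟨c, rfl⟩ : ∃ c, l = a + c := ⟨l - a, by omega⟩
  obtain ⟨e, rfl⟩ : ∃ e, d = c + (e + 2) := ⟨d - c - 2, by omega⟩
  -- This isolates the pair t_l t_{l+1} inside the product, with l = a + c, to which the braid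
  -- relation applies.
  have hs : ∀ c a, ascProd t a (c + (e + 2)) =
      ascProd t a c * (t (a + c) * t (a + c + 1) * ascProd t (a + c + 2) e) := by
    intro c
    induction c with
    | zero =>
      intro a
      rw [ascProd_zero, one_mul, Nat.zero_add, ascProd_succ, ascProd_succ, mul_assoc]
      rfl
    | succ c ih =>
      intro a
      rw [Nat.add_right_comm c 1, ascProd_succ, ih, ascProd_succ, ← mul_assoc,
        show a + 1 + c = a + (c + 1) by omega]
  set p := t (a + c + 1) * t (a + c) * t (a + c + 1) - t (a + c) * t (a + c + 1) * t (a + c) with hp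
  have hpX : p ∈ X := H.braid_mem (a + c) hl
  have key : t (a + c + 1) * ascProd t a (c + (e + 2)) - ascProd t a (c + (e + 2)) * t (a + c) =
      ascProd t a c * (p * ascProd t (a + c + 2) e) := by
    have h1 := H.comm_ascProd_of_lt (a + c + 1) a c (by omega) (by omega)
    have h2 := H.ascProd_comm_of_lt (a + c) e (a + c + 2) (by omega) (by omega)
    rw [hs, ← mul_assoc, h1, mul_assoc, mul_assoc (ascProd t a c), ← mul_sub, mul_assoc _ _ (t (a + c)),
      ← h2, hp, sub_mul]
    simp only [mul_assoc]
  rw [key]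
  exact H.ascProd_mul_mem_of_lt _ (by omega)
    (H.mul_mem_filtration hpX (ascProd_mem le_rfl (by omega)))

/-- Against t_a ⋯ t_{N-1} there are four cases: for l + 1 < a the factor commutes past, for l + 1 =
a it lengthens the product, for l = a the square t_a² lies in X, and for l > a the braid relation
turns t_l into t_{l-1} on the right, up to deeper terms. -/
theorem t_mul_mem_filtration {l : ℕ} (hl : l < N) {y : A} (hy : y ∈ filtration t X N 0) :
    t l * y ∈ filtration t X N 0 := by
  refine mul_filtration_mem (fun a d _ hd => ?_) hy
  rcases lt_trichotomy (l + 1) a with h | rfl | h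
  · exact filtration_mono (Nat.zero_le a) (H.t_mul_mem_of_lt h (ascProd_mem le_rfl hd))
  · exact filtration_mono (Nat.zero_le l) (H.t_mul_mem_pred (ascProd_mem le_rfl hd))
  · rcases (Nat.lt_succ_iff.1 h).eq_or_lt with rfl | h'
    · obtain ⟨d, rfl⟩ : ∃ d', d = d' + 1 := ⟨d - 1, by omega⟩
      rw [ascProd_succ, ← mul_assoc]
      exact filtration_mono (Nat.zero_le _)
        (H.mul_mem_filtration (H.sq_mem a hl) (ascProd_mem (b := a + 1) le_rfl (by omega)))
    · obtain ⟨l, rfl⟩ : ∃ l', l = l' + 1 := ⟨l - 1, by omega⟩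
      have := H.t_mul_ascProd_sub_mem hd (by omega) hl
      rw [← sub_add_cancel (t (l + 1) * ascProd t a d) (ascProd t a d * t l)]
      exact add_mem (filtration_mono (Nat.zero_le _) this)
        (ascProd_mul_mem (Nat.zero_le _) hd (t_mem_parabolic hl))

/-- The products t_a ⋯ t_{N-1} play the role of the minimal coset representatives of S_{N+1} modulo
S_N. Their span over C contains 1, the empty product with a = N, and it is stable under left
multiplication by all generators. -/
theorem mem_filtration (htop : Subring.closure (X ∪ t '' {l | l < N}) = ⊤) (r : A) :
    r ∈ filtration t X N 0 := by
  have h : ∀ s ∈ Subring.closure (X ∪ t '' {l | l < N}), ∀ y ∈ filtration t X N 0,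
      s * y ∈ filtration t X N 0 := by
    intro s hs
    induction hs using Subring.closure_induction with
    | mem s hs =>
      intro y hy
      rcases hs with hs | ⟨l, hl, rfl⟩
      · exact H.mul_mem_filtration hs hy
      · exact H.t_mul_mem_filtration hl hy
    | zero => intro y _; rw [zero_mul]; exact zero_mem _
    | one => intro y hy; rwa [one_mul]
    | add s s' _ _ h h' => intro y hy; rw [add_mul]; exact add_mem (h y hy) (h' y hy)
    | neg s _ h => intro y hy; rw [neg_mul]; exact neg_mem (h y hy)
    | mul s s' _ _ h h' => intro y hy; rw [mul_assoc]; exact h _ (h' y hy)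
  have := h r (htop ▸ Subring.mem_top r) (ascProd t N 0) (ascProd_mem (Nat.zero_le _) rfl)
  rwa [ascProd_zero, mul_one] at this

theorem op : IsCrossing (fun l => op (t l)) X.op N where
  move_right l hl p hp := by
    obtain ⟨p', hp', q, hq, h⟩ := H.move_left l hl p.unop hp
    exact ⟨_, Subring.mem_op.2 hp', _, Subring.mem_op.2 hq, unop_injective h⟩
  move_left l hl p hp := by
    obtain ⟨p', hp', q, hq, h⟩ := H.move_right l hl p.unop hp
    exact ⟨_, Subring.mem_op.2 hp', _, Subring.mem_op.2 hq, unop_injective h⟩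
  sq_mem l hl := H.sq_mem l hl
  far l m hl hm h := unop_injective (H.far l m hl hm h).symm
  braid_mem l hl := by
    have := H.braid_mem l hl
    rw [Subring.mem_op]
    simpa only [MulOpposite.unop_sub, MulOpposite.unop_mul, MulOpposite.unop_op, mul_assoc] using this

end IsCrossing

/-- The product `t_{a + d - 1} ⋯ t_{a + 1} t_a`. -/
def descProd {A : Type*} [Monoid A] (t : ℕ → A) (a d : ℕ) : A :=
  unop (ascProd (fun l => MulOpposite.op (t l)) a d)

theorem descProd_zero {A : Type*} [Monoid A] (t : ℕ → A) (a : ℕ) : descProd t a 0 = 1 := rfl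

theorem descProd_succ {A : Type*} [Monoid A] (t : ℕ → A) (a d : ℕ) :
    descProd t a (d + 1) = descProd t (a + 1) d * t a := by
  rw [descProd, ascProd_succ]; rfl

/-- The hypotheses are invariant under reversal of products, so the opposite ring gives a spanning
set with the coset representatives on the right. -/
theorem IsCrossing.exists_descProd {A : Type*} [Ring A] {t : ℕ → A} {X : Subring A} {N : ℕ}
    (H : IsCrossing t X N) (htop : Subring.closure (X ∪ t '' {l | l < N}) = ⊤) (r : A) :
    r ∈ AddSubgroup.closure {y | ∃ a d, ∃ c ∈ IsCrossing.parabolic t X N, a + d = N ∧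
      y = c * descProd t a d} := by
  have hset : ∀ S : Set ℕ, (MulOpposite.unop ⁻¹' ((X : Set A) ∪ t '' S)) =
      (X.op : Set Aᵐᵒᵖ) ∪ (fun l => MulOpposite.op (t l)) '' S := by
    intro S
    ext y
    simp only [Set.mem_preimage, Set.mem_union, Set.mem_image, SetLike.mem_coe, Subring.mem_op]
    refine or_congr Iff.rfl (exists_congr fun l => and_congr Iff.rfl ?_)
    exact ⟨fun h => unop_injective h, fun h => congrArg unop h⟩
  have hcl : ∀ S : Set ℕ, Subring.closure ((X.op : Set Aᵐᵒᵖ) ∪ (fun l => MulOpposite.op (t l)) '' S) =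
      (Subring.closure ((X : Set A) ∪ t '' S)).op := fun S => by
    rw [← hset, Subring.op_closure]
  have h := H.op.mem_filtration (by rw [hcl, htop, Subring.op_top]) (MulOpposite.op r)
  refine AddSubgroup.closure_induction (p := fun y _ => unop y ∈ _) ?_ (zero_mem _)
    (fun _ _ _ _ hx hy => add_mem hx hy) (fun _ _ hx => neg_mem hx) h
  rintro _ ⟨a, d, c, hc, -, hd, rfl⟩
  refine AddSubgroup.subset_closure ⟨a, d, unop c, ?_, hd, rfl⟩
  rw [IsCrossing.parabolic, hcl] at hc
  exact hc

end Spanning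

/-! ### Normal forms in R(n + 1) -/

section KLRAlgebras

variable {I : Type v} [Fintype I] [DecidableEq I] {P : Type*} [AddCommGroup P]
    [Module.Free ℤ P] [Module.Finite ℤ P]
variable {C : CartanDatum I P} {k : Type u} [CommRing k] {𝓀 : ℤ → AddSubgroup k}

theorem evalTwo_mem {A : Type*} [Ring A] [Algebra k A] (X : Subalgebra k A) (f : ℕ × ℕ →₀ k)
    {x y : A} (hx : x ∈ X) (hy : y ∈ X) : evalTwo f x y ∈ X :=
  sum_mem fun _ _ => X.smul_mem (mul_mem (pow_mem hx _) (pow_mem hy _)) _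

theorem evalDivDiff_mem {A : Type*} [Ring A] [Algebra k A] (X : Subalgebra k A) (f : ℕ × ℕ →₀ k)
    {x y z : A} (hx : x ∈ X) (hy : y ∈ X) (hz : z ∈ X) : evalDivDiff f x y z ∈ X :=
  sum_mem fun _ _ => X.smul_mem (mul_mem (sum_mem fun _ _ => mul_mem (pow_mem hx _)
    (pow_mem hz _)) (pow_mem hy _)) _

namespace KLR

variable (Q : KLRDatum C 𝓀) (n : ℕ)

/-- The subalgebra of `R(n)` generated by all `e(ν)` and `x_l`. -/
noncomputable def polys : Subalgebra k (KLR Q n) :=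
  Algebra.adjoin k (Set.range (e Q) ∪ Set.range (x Q))

variable {Q n}

theorem e_mem_polys (ν : Fin n → I) : e Q ν ∈ polys Q n :=
  Algebra.subset_adjoin (Or.inl ⟨ν, rfl⟩)

theorem x_mem_polys (l : Fin n) : x Q l ∈ polys Q n :=
  Algebra.subset_adjoin (Or.inr ⟨l, rfl⟩)

theorem eSum_mem_polys (s : Finset (Fin n → I)) : eSum Q s ∈ polys Q n :=
  sum_mem fun ν _ => e_mem_polys ν

theorem mem_polys_of_mul_e {r : KLR Q n} (h : ∀ ν, r * e Q ν ∈ polys Q n) : r ∈ polys Q n := by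
  rw [← mul_one r, ← sum_e, Finset.mul_sum]
  exact sum_mem fun ν _ => h ν

theorem polys_mul_τ {l : ℕ} (h : l + 1 < n) {p : KLR Q n} (hp : p ∈ polys Q n) :
    ∃ p' ∈ polys Q n, ∃ q ∈ polys Q n, p * τ Q l h = τ Q l h * p' + q := by
  induction hp using Algebra.adjoin_induction with
  | mem p hp =>
    rcases hp with ⟨ν, rfl⟩ | ⟨m, rfl⟩
    · refine ⟨e Q (ν ∘ sSwap l h), e_mem_polys _, 0, zero_mem _, ?_⟩
      rw [τ_e, add_zero]
      congr 2
      funext m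
      simp only [Function.comp_apply, sSwap_sSwap]
    · by_cases h1 : m.1 = l
      · obtain rfl : m = pos l (Nat.lt_of_succ_lt h) := Fin.ext h1
        refine ⟨_, x_mem_polys (pos (l + 1) h), -eEq Q l h, neg_mem (eSum_mem_polys _), ?_⟩
        rw [τ_x_right]; abel
      by_cases h2 : m.1 = l + 1
      · obtain rfl : m = pos (l + 1) h := Fin.ext h2
        refine ⟨_, x_mem_polys (pos l (Nat.lt_of_succ_lt h)), eEq Q l h, eSum_mem_polys _, ?_⟩
        rw [τ_x_left]; abel
      · refine ⟨_, x_mem_polys m, 0, zero_mem _, ?_⟩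
        rw [τ_x_of_ne Q l h m h1 h2, add_zero]
  | algebraMap c =>
    exact ⟨_, (polys Q n).algebraMap_mem c, 0, zero_mem _, by rw [Algebra.commutes, add_zero]⟩
  | add p p' _ _ hp hp' =>
    obtain ⟨a, ha, b, hb, h1⟩ := hp
    obtain ⟨a', ha', b', hb', h2⟩ := hp'
    refine ⟨a + a', add_mem ha ha', b + b', add_mem hb hb', ?_⟩
    rw [add_mul, h1, h2, mul_add]; abel
  | mul p p' hpm _ hp hp' =>
    obtain ⟨a, ha, b, hb, h1⟩ := hp
    obtain ⟨a', ha', b', hb', h2⟩ := hp'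
    refine ⟨a * a', mul_mem ha ha', b * a' + p * b', add_mem (mul_mem hb ha') (mul_mem hpm hb'), ?_⟩
    rw [mul_assoc, h2, mul_add, ← mul_assoc, h1, add_mul, mul_assoc]; abel

theorem τ_mul_polys {l : ℕ} (h : l + 1 < n) {p : KLR Q n} (hp : p ∈ polys Q n) :
    ∃ p' ∈ polys Q n, ∃ q ∈ polys Q n, τ Q l h * p = p' * τ Q l h + q := by
  induction hp using Algebra.adjoin_induction with
  | mem p hp =>
    rcases hp with ⟨ν, rfl⟩ | ⟨m, rfl⟩
    · exact ⟨_, e_mem_polys (ν ∘ sSwap l h), 0, zero_mem _, by rw [τ_e, add_zero]⟩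
    · by_cases h1 : m.1 = l
      · obtain rfl : m = pos l (Nat.lt_of_succ_lt h) := Fin.ext h1
        refine ⟨_, x_mem_polys (pos (l + 1) h), -eEq Q l h, neg_mem (eSum_mem_polys _), ?_⟩
        rw [τ_x_left]; abel
      by_cases h2 : m.1 = l + 1
      · obtain rfl : m = pos (l + 1) h := Fin.ext h2
        exact ⟨_, x_mem_polys (pos l (Nat.lt_of_succ_lt h)), eEq Q l h, eSum_mem_polys _,
          τ_x_right Q l h⟩
      · refine ⟨_, x_mem_polys m, 0, zero_mem _, ?_⟩
        rw [τ_x_of_ne Q l h m h1 h2, add_zero]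
  | algebraMap c =>
    exact ⟨_, (polys Q n).algebraMap_mem c, 0, zero_mem _, by rw [Algebra.commutes, add_zero]⟩
  | add p p' _ _ hp hp' =>
    obtain ⟨a, ha, b, hb, h1⟩ := hp
    obtain ⟨a', ha', b', hb', h2⟩ := hp'
    refine ⟨a + a', add_mem ha ha', b + b', add_mem hb hb', ?_⟩
    rw [mul_add, h1, h2, add_mul]; abel
  | mul p p' _ hpm hp hp' =>
    obtain ⟨a, ha, b, hb, h1⟩ := hp
    obtain ⟨a', ha', b', hb', h2⟩ := hp'
    refine ⟨a * a', mul_mem ha ha', a * b' + b * p', add_mem (mul_mem ha hb') (mul_mem hb hpm), ?_⟩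
    rw [← mul_assoc, h1, add_mul, mul_assoc, h2, mul_add, ← mul_assoc]; abel

variable (Q n)

/-- Squares of crossings and differences of braid words are polynomial in the x_l and e(ν), so
modulo polynomials the crossings behave like simple transpositions. R(n + 1) has n of them. -/
theorem isCrossing : IsCrossing (cross Q (n + 1)) (polys Q (n + 1)).toSubring n where
  move_right l hl p hp := by
    rw [cross_eq Q (Nat.succ_lt_succ hl)]
    exact polys_mul_τ _ hp
  move_left l hl p hp := by
    rw [cross_eq Q (Nat.succ_lt_succ hl)]
    exact τ_mul_polys _ hp
  sq_mem l hl := by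
    rw [cross_eq Q (Nat.succ_lt_succ hl)]
    refine mem_polys_of_mul_e fun ν => ?_
    rw [τ_sq]
    exact mul_mem (evalTwo_mem _ _ (x_mem_polys _) (x_mem_polys _)) (e_mem_polys ν)
  far l m hl hm h := by
    rw [cross_eq Q (Nat.succ_lt_succ hl), cross_eq Q (Nat.succ_lt_succ hm)]
    exact τ_comm Q l m _ _ (Or.inl h)
  braid_mem l hl := by
    rw [cross_eq Q (Nat.succ_lt_succ hl), cross_eq Q (Nat.lt_succ_of_lt hl)]
    refine mem_polys_of_mul_e fun ν => ?_
    rw [braid Q l (Nat.succ_lt_succ hl)]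
    split_ifs
    · exact mul_mem (evalDivDiff_mem _ _ (x_mem_polys _) (x_mem_polys _) (x_mem_polys _))
        (e_mem_polys ν)
    · exact zero_mem _

theorem closure_eq_top :
    Subring.closure (((polys Q (n + 1)).toSubring : Set (KLR Q (n + 1))) ∪
      cross Q (n + 1) '' {l | l < n}) = ⊤ := by
  rw [eq_top_iff]
  rintro r -
  obtain ⟨w, rfl⟩ := mk_surjective Q (n + 1) r
  induction w using FreeAlgebra.induction with
  | grade0 c =>
    rw [AlgHom.commutes]
    exact Subring.subset_closure (Or.inl ((polys Q (n + 1)).algebraMap_mem c))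
  | grade1 g =>
    cases g with
    | e ν => exact Subring.subset_closure (Or.inl (e_mem_polys ν))
    | x l => exact Subring.subset_closure (Or.inl (x_mem_polys l))
    | τ l h =>
      exact Subring.subset_closure (Or.inr ⟨l, Nat.lt_of_succ_lt_succ h, cross_eq Q h⟩)
  | mul a b ha hb => rw [map_mul]; exact mul_mem ha hb
  | add a b ha hb => rw [map_add]; exact add_mem ha hb

variable {n}

/-- The idempotent `∑ e(ν)` over the words with last letter `j`. -/
noncomputable abbrev eLast (j : I) : KLR Q (n + 1) := eAt Q (Fin.last n) j

theorem incl_comm_x_last (b : KLR Q n) :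
    incl Q n b * x Q (Fin.last n) = x Q (Fin.last n) * incl Q n b := by
  refine commute_induction Q (incl Q n) _ (fun ν => ?_) (fun l => ?_) (fun l h => ?_) b
  · rw [incl_e, Finset.sum_mul, Finset.mul_sum]
    exact Finset.sum_congr rfl fun i _ => (x_e Q _ _).symm
  · rw [incl_x, x_comm]
  · rw [incl_τ, τ_x_of_ne]
    · simp only [Fin.val_last]; omega
    · simp only [Fin.val_last]; omega

theorem eAt_comm_e (l : Fin n) (j : I) (ν : Fin n → I) :
    e Q ν * eAt Q l j = eAt Q l j * e Q ν := e_comm_eSum Q _ _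

theorem eAt_comm_x (l m : Fin n) (j : I) : x Q m * eAt Q l j = eAt Q l j * x Q m :=
  x_comm_eSum Q _ _

theorem eAt_comm_eAt (l m : Fin n) (i j : I) : eAt Q m i * eAt Q l j = eAt Q l j * eAt Q m i :=
  eSum_comm Q _ _

theorem incl_comm_eLast (b : KLR Q n) (j : I) :
    incl Q n b * eLast Q j = eLast Q j * incl Q n b := by
  refine commute_induction Q (incl Q n) _ (fun ν => ?_) (fun l => ?_) (fun l h => ?_) b
  · rw [incl_e, Finset.sum_mul, Finset.mul_sum]
    exact Finset.sum_congr rfl fun i _ => eAt_comm_e Q _ _ _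
  · rw [incl_x, eAt_comm_x]
  · rw [incl_τ, τ_mul_eAt]
    congr 2
    exact sSwap_of_ne l _ n (Nat.lt_succ_self n) (by omega) (by omega)

theorem incl_comm_x_pow (b : KLR Q n) (m : ℕ) :
    incl Q n b * x Q (Fin.last n) ^ m = x Q (Fin.last n) ^ m * incl Q n b :=
  (Commute.pow_right (incl_comm_x_last Q b) m).eq

theorem x_pow_comm_eAt (l m : Fin n) (j : I) (p : ℕ) :
    x Q m ^ p * eAt Q l j = eAt Q l j * x Q m ^ p :=
  (Commute.pow_left (eAt_comm_x Q l m j) p).eq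

theorem incl_e_mul_e (μ : Fin n → I) (ν : Fin (n + 1) → I) :
    incl Q n (e Q μ) * e Q ν = if (fun l => ν l.castSucc) = μ then e Q ν else 0 := by
  rw [incl_e, Finset.sum_mul]
  simp only [e_mul]
  split_ifs with h
  · subst h
    rw [Finset.sum_eq_single (ν (Fin.last n)), snocW_init, if_pos rfl]
    · intro i _ hi
      rw [if_neg]
      intro h
      exact hi (by rw [← h, snocW_last])
    · simp
  · refine Finset.sum_eq_zero fun i _ => if_neg fun h' => h ?_
    rw [← h']
    exact funext fun l => snocW_castSucc _ _ _

theorem incl_eSum_mul_e (s : Finset (Fin n → I)) (ν : Fin (n + 1) → I) :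
    incl Q n (eSum Q s) * e Q ν = if (fun l => ν l.castSucc) ∈ s then e Q ν else 0 := by
  rw [eSum, map_sum, Finset.sum_mul]
  simp only [incl_e_mul_e]
  exact Finset.sum_ite_eq s _ _

theorem incl_eAt (l : Fin n) (j : I) : incl Q n (eAt Q l j) = eAt Q l.castSucc j := by
  refine ext_e Q (RingHom.id _) fun ν => ?_
  simp only [RingHom.id_apply]
  rw [eAt_mul_e, eAt, incl_eSum_mul_e]
  simp

/-- The elements `∑ x_{n + 1}^m b e(*, j)` with `b ∈ R(n)`. -/
noncomputable def lastSpan (n : ℕ) (j : I) : AddSubgroup (KLR Q (n + 1)) :=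
  AddSubgroup.closure {y | ∃ m b, y = x Q (Fin.last n) ^ m * incl Q n b * eLast Q j}

variable {Q}

/-- Without its last crossing R(n + 1) is generated by R(n), the last dot and the idempotents of the
last letter. Dots and idempotents of the last strand commute with R(n), so all of them can be
collected in the required order. -/
theorem parabolic_mul_eLast {c : KLR Q (n + 1)}
    (hc : c ∈ IsCrossing.parabolic (cross Q (n + 1)) (polys Q (n + 1)).toSubring n) (j : I) :
    c * eLast Q j ∈ lastSpan Q n j := by
  have stable : ∀ s : KLR Q (n + 1), (∀ m b, s * (x Q (Fin.last n) ^ m * incl Q n b * eLast Q j) ∈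
      lastSpan Q n j) → ∀ y ∈ lastSpan Q n j, s * y ∈ lastSpan Q n j := by
    intro s hs y hy
    refine AddSubgroup.closure_induction (p := fun y _ => s * y ∈ lastSpan Q n j) ?_ ?_ ?_ ?_ hy
    · rintro _ ⟨m, b, rfl⟩
      exact hs m b
    · rw [mul_zero]; exact zero_mem _
    · intro x y _ _ hx hy; rw [mul_add]; exact add_mem hx hy
    · intro x _ hx; rw [mul_neg]; exact neg_mem hx
  have hincl : ∀ (a : KLR Q n) (y) (_ : y ∈ lastSpan Q n j), incl Q n a * y ∈ lastSpan Q n j :=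
    fun a => stable _ fun m b => AddSubgroup.subset_closure ⟨m, a * b, by
      rw [map_mul, ← mul_assoc, ← mul_assoc, incl_comm_x_pow, ← mul_assoc]⟩
  have hx : ∀ y ∈ lastSpan Q n j, x Q (Fin.last n) * y ∈ lastSpan Q n j :=
    stable _ fun m b => AddSubgroup.subset_closure ⟨m + 1, b, by
      rw [← mul_assoc, ← mul_assoc, pow_succ']⟩
  have he : ∀ i, ∀ y ∈ lastSpan Q n j, eLast Q i * y ∈ lastSpan Q n j := by
    refine fun i => stable _ fun m b => ?_
    have : eLast Q i * (x Q (Fin.last n) ^ m * incl Q n b * eLast Q j) =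
        if i = j then x Q (Fin.last n) ^ m * incl Q n b * eLast Q j else 0 := by
      rw [← mul_assoc, ← mul_assoc, ← x_pow_comm_eAt, mul_assoc (_ ^ m), ← incl_comm_eLast, mul_assoc,
        mul_assoc, eAt_mul_eAt, ← mul_assoc]
      split_ifs with h
      · rw [h]
      · rw [mul_zero]
    rw [this]
    split_ifs
    · exact AddSubgroup.subset_closure ⟨m, b, rfl⟩
    · exact zero_mem _
  have hpoly : ∀ p ∈ polys Q (n + 1), ∀ y ∈ lastSpan Q n j, p * y ∈ lastSpan Q n j := by
    intro p hp
    induction hp using Algebra.adjoin_induction with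
    | mem p hp =>
      rcases hp with ⟨ν, rfl⟩ | ⟨l, rfl⟩
      -- e(ν) is the product of the idempotent of its first n letters, which comes from R(n), and
      -- that of its last letter.
      · have : e Q ν = incl Q n (e Q fun l => ν l.castSucc) * eLast Q (ν (Fin.last n)) := by
          refine ext_e Q (RingHom.id _) fun ν' => ?_
          simp only [RingHom.id_apply]
          rw [mul_assoc, eAt_mul_e, e_mul]
          by_cases h : ν = ν'
          · subst h
            rw [if_pos rfl, if_pos rfl, incl_e_mul_e, if_pos rfl]
          · rw [if_neg h]
            split_ifs with h'
            · rw [incl_e_mul_e, if_neg]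
              intro h''
              exact h (by rw [← snocW_init ν, ← snocW_init ν', h', h''])
            · rw [mul_zero]
        intro y hy
        rw [this, mul_assoc]
        exact hincl _ _ (he _ y hy)
      · intro y hy
        refine Fin.lastCases ?_ (fun l => ?_) l
        · exact hx y hy
        · rw [← incl_x]; exact hincl _ y hy
    | algebraMap c =>
      intro y hy
      rw [← (incl Q n).commutes]
      exact hincl _ y hy
    | add p p' _ _ h h' => intro y hy; rw [add_mul]; exact add_mem (h y hy) (h' y hy)
    | mul p p' _ _ h h' => intro y hy; rw [mul_assoc]; exact h _ (h' y hy)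
  have h : ∀ y ∈ lastSpan Q n j, c * y ∈ lastSpan Q n j := by
    induction hc using Subring.closure_induction with
    | mem s hs =>
      rcases hs with hs | ⟨l, hl, rfl⟩
      · exact hpoly s hs
      · intro y hy
        have hl' : l + 1 < n := hl
        rw [cross_eq Q (Nat.lt_succ_of_lt hl'), ← incl_τ Q l hl']
        exact hincl _ y hy
    | zero => intro y _; rw [zero_mul]; exact zero_mem _
    | one => intro y hy; rwa [one_mul]
    | add s s' _ _ h h' => intro y hy; rw [add_mul]; exact add_mem (h y hy) (h' y hy)
    | neg s _ h => intro y hy; rw [neg_mul]; exact neg_mem (h y hy)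
    | mul s s' _ _ h h' => intro y hy; rw [mul_assoc]; exact h _ (h' y hy)
  have h1 : eLast Q j ∈ lastSpan Q n j :=
    AddSubgroup.subset_closure ⟨0, 1, by rw [pow_zero, map_one, one_mul, one_mul]⟩
  exact h _ h1

end KLR

end KLRAlgebras

/-! ### Maps out of the induced module, computed with elements of R(n + 1) -/

namespace GrMod.CornerHom

variable {A : Type w} [Ring A] {𝒜 : ℤ → AddSubgroup A} {B : Type w} [Ring B]
  {ℬ : ℤ → AddSubgroup B} (φ : CornerHom 𝒜 ℬ) {M : Type*} [AddCommGroup M] [Module A M]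

theorem tmk_add_left (y y' : φ.leftIdeal) (m : M) :
    φ.tmk (y + y') m = φ.tmk y m + φ.tmk y' m := by
  rw [tmk, TensorProduct.add_tmul, map_add]
  rfl

theorem tmk_add_right (y : φ.leftIdeal) (m m' : M) :
    φ.tmk y (m + m') = φ.tmk y m + φ.tmk y m' := by
  rw [tmk, TensorProduct.tmul_add, map_add]
  rfl

theorem smul_tmk (b : B) (y : φ.leftIdeal) (m : M) : b • φ.tmk y m = φ.tmk (b • y) m := rfl

theorem tmk_rightMul (y : φ.leftIdeal) (c : A) (m : M) :
    φ.tmk (φ.rightMul y c) m = φ.tmk y (c • m) := by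
  rw [← sub_eq_zero, tmk, tmk, ← map_sub]
  exact (Submodule.Quotient.mk_eq_zero _).2 (Submodule.subset_span ⟨y, c, m, rfl⟩)

/-- Additive maps out of `B e ⊗_A M`. -/
theorem exists_tens_lift {N : Type*} [AddCommGroup N] (f : B →+ M →+ N)
    (hf : ∀ (b : B) (c : A) (m : M), b * φ.idem = b → f (b * φ.toHom c) m = f b (c • m)) :
    ∃ F : φ.Tens M →+ N, ∀ (y : φ.leftIdeal) (m : M), F (φ.tmk y m) = f y.1 m := by
  let f' : φ.leftIdeal ⊗[ℤ] M →+ N :=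
    TensorProduct.liftAddHom (f.comp φ.leftIdeal.subtype.toAddMonoidHom)
      fun r y m => by rw [map_zsmul, AddMonoidHom.zsmul_apply, map_zsmul]
  have hker : (φ.balancing M).mkQ.toAddMonoidHom.ker ≤ f'.ker := by
    intro z hz
    have hz' : z ∈ φ.balancing M := (Submodule.Quotient.mk_eq_zero _).1 hz
    rw [AddMonoidHom.mem_ker]
    refine Submodule.closure_induction (p := fun z _ => f' z = 0) (map_zero _)
      (fun x y _ _ hx hy => by rw [map_add, hx, hy, add_zero]) ?_ hz'
    rintro b _ ⟨y, c, m, rfl⟩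
    rw [smul_sub, TensorProduct.smul_tmul', TensorProduct.smul_tmul', map_sub, sub_eq_zero]
    change f (b * (y.1 * φ.toHom c)) m = f (b • y).1 _
    rw [← mul_assoc]
    exact hf _ c m (b • y).2
  refine ⟨(φ.balancing M).mkQ.toAddMonoidHom.liftOfSurjective
    (Submodule.mkQ_surjective _) ⟨f', hker⟩, fun y m => ?_⟩
  exact AddMonoidHom.liftOfRightInverse_comp_apply (φ.balancing M).mkQ.toAddMonoidHom _
    (Function.rightInverse_surjInv (Submodule.mkQ_surjective _)) ⟨f', hker⟩ _

theorem mem_closure_tmk (z : φ.Tens M) :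
    z ∈ AddSubgroup.closure {x | ∃ (y : φ.leftIdeal) (m : M), x = φ.tmk y m} := by
  obtain ⟨z, rfl⟩ := (φ.balancing M).mkQ_surjective z
  induction z using TensorProduct.induction_on with
  | zero => rw [map_zero]; exact zero_mem _
  | add x y hx hy => rw [map_add]; exact add_mem hx hy
  | tmul y m => exact AddSubgroup.subset_closure ⟨y, m, rfl⟩

end GrMod.CornerHom

section KLRAlgebras

variable {I : Type v} [Fintype I] [DecidableEq I] {P : Type*} [AddCommGroup P]
    [Module.Free ℤ P] [Module.Finite ℤ P]
variable {C : CartanDatum I P} {k : Type u} [CommRing k] {𝓀 : ℤ → AddSubgroup k}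

namespace CycKLR

open KLR

section Proj

variable (Q : KLRDatum C 𝓀) {Λ : P} (a : CyclotomicDatum C 𝓀 Λ) (n : ℕ) (β : P)

/-- The projection `R(n) → R^Λ(β)`. -/
noncomputable def proj : KLR Q n →+* CycKLR Q a n β :=
  (mk Q a n β).comp
    { toFun := KLRβ.proj Q β
      map_one' := KLRβ.val_injective Q (by
        rw [KLRβ.val_proj, mul_one, KLRβ.val_one, eβ_idem])
      map_mul' := fun r s => KLRβ.val_injective Q (by
        have hp : ∀ r, eβ Q n β * r * eβ Q n β = r * eβ Q n β := fun r => by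
          rw [← eβ_central, mul_assoc, (eβ_idem Q n β).eq]
        rw [KLRβ.val_mul, KLRβ.val_proj, KLRβ.val_proj, KLRβ.val_proj, hp, hp, hp, mul_assoc r (eβ Q n β),
          ← mul_assoc (eβ Q n β) s, hp, mul_assoc])
      map_zero' := KLRβ.val_injective Q (by
        rw [KLRβ.val_proj, mul_zero, zero_mul, KLRβ.val_zero])
      map_add' := fun r s => KLRβ.val_injective Q (by
        rw [KLRβ.val_add, KLRβ.val_proj, KLRβ.val_proj, KLRβ.val_proj, mul_add, add_mul]) }

theorem proj_apply (r : KLR Q n) : proj Q a n β r = mk Q a n β (KLRβ.proj Q β r) := rfl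

theorem proj_surjective : Function.Surjective (proj Q a n β) := fun y => by
  obtain ⟨y, rfl⟩ := mk_surjective Q a n β y
  exact ⟨KLRβ.val Q y, by rw [proj_apply, KLRβ.proj_val]⟩

theorem proj_eβ : proj Q a n β (eβ Q n β) = 1 := by
  rw [← map_one (mk Q a n β), proj_apply]
  congr 1
  apply KLRβ.val_injective Q
  rw [KLRβ.val_proj, KLRβ.val_one, eβ_idem, eβ_idem]

theorem eβi_eq (j : I) : eβi Q n β j = eβ Q (n + 1) β * eLast Q j := by
  classical
  rw [eβi, eβ, eLast, eAt, eSum_mul]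
  congr 1
  ext ν
  simp

/-- On words ending in j, the first n letters have weight β exactly when the whole word has weight β
+ α_j. This allows weight idempotents to be dropped in computations with R(n + 1). -/
theorem incl_eβ_mul_eLast (j : I) {β β' : P} (h : β + C.α j = β') :
    KLR.incl Q n (eβ Q n β) * eLast Q j = eβ Q (n + 1) β' * eLast Q j := by
  refine ext_e Q (RingHom.id _) fun ν => ?_
  simp only [RingHom.id_apply]
  rw [mul_assoc, mul_assoc, eAt_mul_e]
  split_ifs with hν
  · rw [eβ, eβ, incl_eSum_mul_e, eSum_mul_e]
    refine if_congr ?_ rfl rfl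
    simp only [words, Finset.mem_filter, Finset.mem_univ, true_and]
    rw [Fin.sum_univ_castSucc, hν, ← h, add_left_inj]
  · rw [mul_zero, mul_zero]

theorem proj_eβi (j : I) : proj Q a (n + 1) β (eβi Q n β j) = proj Q a (n + 1) β (eLast Q j) := by
  rw [eβi_eq, map_mul, proj_eβ, one_mul]

theorem proj_cyc : proj Q a (n + 1) β (cyc Q a 0) = 0 := by
  rw [proj_apply, mk_eq_zero]
  exact TwoSidedIdeal.subset_span ⟨Nat.succ_pos n, rfl⟩

theorem incl_proj (j : I) {β β' : P} (h : β + C.α j = β') (b : KLR Q n) :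
    incl Q a j n β β' (proj Q a n β b) = proj Q a (n + 1) β' (KLR.incl Q n b * eLast Q j) := by
  rw [map_mul, ← proj_eβi, ← map_mul, proj_apply, proj_apply, incl_mk]
  congr 1
  apply KLRβ.val_injective Q
  rw [KLRβ.val_incl, KLRβ.val_proj, KLRβ.val_proj, ← eβ_central, mul_assoc b, (eβ_idem Q n β).eq,
    map_mul, mul_assoc, incl_eβ_mul_eβi Q β β' j h, ← eβ_central, mul_assoc, mul_assoc,
    (eβ_idem Q (n + 1) β').eq, eβi_mul_eβ]

variable {n β} in
-- The generators of the cyclotomic ideal of R(β) are s x[1] t cut by e(β) on both sides of x[1]. As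
-- e(β) is central and fixes s and t, it disappears, and plain products in R(n + 1) remain.
theorem eβ_mul_mem_of_proj_eq_zero {r : KLR Q (n + 1)} (h : proj Q a (n + 1) β r = 0) :
    eβ Q (n + 1) β * r ∈ AddSubgroup.closure {y | ∃ s t, y = s * cyc Q a 0 * t} := by
  rw [proj_apply, mk_eq_zero, KLRβ.cycIdeal, TwoSidedIdeal.mem_span_iff_mem_addSubgroup_closure] at h
  have : eβ Q (n + 1) β * r = KLRβ.valHom Q (n + 1) β (KLRβ.proj Q β r) := by
    change _ = KLRβ.val Q _
    rw [KLRβ.val_proj, mul_assoc, eβ_central, ← mul_assoc, (eβ_idem Q (n + 1) β).eq]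
  rw [this]
  refine AddSubgroup.closure_induction (p := fun y _ => KLRβ.valHom Q (n + 1) β y ∈ _) ?_ ?_ ?_ ?_ h
  · rintro _ ⟨_, ⟨s, -, _, ⟨h, rfl⟩, rfl⟩, t, -, rfl⟩
    refine AddSubgroup.subset_closure ⟨KLRβ.val Q s, KLRβ.val Q t, ?_⟩
    change KLRβ.val Q _ = _
    rw [KLRβ.val_mul, KLRβ.val_mul, KLRβ.val_proj, ← eβ_central, mul_assoc (cyc Q a _),
      (eβ_idem Q (n + 1) β).eq, mul_assoc, mul_assoc, KLRβ.eβ_mul_val, ← mul_assoc]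
    rfl
  · rw [map_zero]; exact zero_mem _
  · intro x y _ _ hx hy; rw [map_add]; exact add_mem hx hy
  · intro x _ hx; rw [map_neg]; exact neg_mem hx

end Proj

section Ten

variable {Q : KLRDatum C 𝓀} {Λ : P} (a : CyclotomicDatum C 𝓀 Λ) {n : ℕ} {β β' : P} {j : I}
  (h : β + C.α j = β')

theorem cornerHom_proj (b : KLR Q n) : (cornerHom Q a j n h).toHom (proj Q a n β b) =
    proj Q a (n + 1) β' (KLR.incl Q n b * eLast Q j) := incl_proj Q a n j h b

theorem cornerHom_idem : (cornerHom Q a j n h).idem = proj Q a (n + 1) β' (eLast Q j) := by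
  rw [GrMod.CornerHom.idem, ← map_one (proj Q a n β), cornerHom_proj, map_one, one_mul]

variable {M : Type*} [AddCommGroup M] [Module (CycKLR Q a n β) M]

/-- The element `r e(*, j)` of `R^Λ(β + α_j) e(β, j)`, where `r ∈ R(n + 1)`. -/
noncomputable def projLeft (r : KLR Q (n + 1)) : (cornerHom Q a j n h).leftIdeal :=
  ⟨proj Q a (n + 1) β' (r * eLast Q j), by
    rw [GrMod.CornerHom.mem_leftIdeal, cornerHom_idem, ← map_mul, mul_assoc, eAt_mul_eAt,
      if_pos rfl]⟩

theorem projLeft_val (r : KLR Q (n + 1)) :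
    (projLeft a h r).1 = proj Q a (n + 1) β' (r * eLast Q j) := rfl

theorem projLeft_eq {r : KLR Q (n + 1)} {y : (cornerHom Q a j n h).leftIdeal}
    (hy : proj Q a (n + 1) β' r = y.1) : projLeft a h r = y := by
  apply Subtype.ext
  rw [projLeft_val, map_mul, hy, ← cornerHom_idem a h]
  exact y.2

/-- The element `r e(*, j) ⊗ m` of `R^Λ(β + α_j) e(β, j) ⊗ M`, where `r ∈ R(n + 1)`. -/
noncomputable def ten (r : KLR Q (n + 1)) (m : M) : (cornerHom Q a j n h).Tens M :=
  (cornerHom Q a j n h).tmk (projLeft a h r) m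

theorem ten_add (r s : KLR Q (n + 1)) (m : M) : ten a h (r + s) m = ten a h r m + ten a h s m := by
  have : projLeft a h (r + s) = projLeft a h r + projLeft a h s := by
    apply Subtype.ext
    rw [Submodule.coe_add, projLeft_val, projLeft_val, projLeft_val, add_mul, map_add]
  rw [ten, this, GrMod.CornerHom.tmk_add_left, ← ten, ← ten]

theorem ten_add_right (r : KLR Q (n + 1)) (m m' : M) :
    ten a h r (m + m') = ten a h r m + ten a h r m' :=
  GrMod.CornerHom.tmk_add_right _ _ _ _

theorem ten_mul_eLast (r : KLR Q (n + 1)) (m : M) : ten a h (r * eLast Q j) m = ten a h r m := by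
  have : projLeft a h (r * eLast Q j) = projLeft a h r := by
    apply Subtype.ext
    rw [projLeft_val, projLeft_val, mul_assoc, eAt_mul_eAt, if_pos rfl]
  rw [ten, this, ← ten]

theorem proj_smul_ten (s r : KLR Q (n + 1)) (m : M) :
    proj Q a (n + 1) β' s • ten a h r m = ten a h (s * r) m := by
  have : projLeft a h (s * r) = proj Q a (n + 1) β' s • projLeft a h r := by
    apply Subtype.ext
    rw [Submodule.coe_smul, smul_eq_mul, projLeft_val, projLeft_val, mul_assoc, map_mul]
  rw [ten, ten, GrMod.CornerHom.smul_tmk, this]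

theorem ten_mul_incl (r : KLR Q (n + 1)) (b : KLR Q n) (m : M) :
    ten a h (r * KLR.incl Q n b) m = ten a h r (proj Q a n β b • m) := by
  have : projLeft a h (r * KLR.incl Q n b) =
      (cornerHom Q a j n h).rightMul (projLeft a h r) (proj Q a n β b) := by
    apply Subtype.ext
    change _ = (projLeft a h r).1 * (cornerHom Q a j n h).toHom (proj Q a n β b)
    rw [cornerHom_proj, projLeft_val, projLeft_val, ← map_mul, mul_assoc, mul_assoc,
      ← mul_assoc (eLast Q j), ← incl_comm_eLast, mul_assoc (KLR.incl Q n b), eAt_mul_eAt, if_pos rfl]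
  rw [ten, ten, this, GrMod.CornerHom.tmk_rightMul]

theorem ten_mul_cyc (r s : KLR Q (n + 1)) (m : M) : ten a h (r * cyc Q a 0 * s) m = 0 := by
  rw [← proj_smul_ten, map_mul, proj_cyc, mul_zero, zero_smul]

/-- The map `(r, m) ↦ r e(*, j) ⊗ m` as a biadditive map. -/
noncomputable def tenHom : KLR Q (n + 1) →+ M →+ (cornerHom Q a j n h).Tens M :=
  AddMonoidHom.mk' (fun r => AddMonoidHom.mk' (ten a h r) (ten_add_right a h r))
    fun r s => AddMonoidHom.ext fun m => ten_add a h r s m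

theorem tenHom_apply (r : KLR Q (n + 1)) (m : M) : tenHom a h r m = ten a h r m := rfl

theorem mem_closure_ten (z : (cornerHom Q a j n h).Tens M) :
    z ∈ AddSubgroup.closure {y | ∃ (r : KLR Q (n + 1)) (m : M), y = ten a h r m} := by
  refine AddSubgroup.closure_mono ?_ (GrMod.CornerHom.mem_closure_tmk _ z)
  rintro _ ⟨y, m, rfl⟩
  obtain ⟨r, hr⟩ := proj_surjective Q a (n + 1) β' y.1
  exact ⟨r, m, by rw [ten, projLeft_eq a h hr]⟩

/-- The universal property of `R^Λ(β + α_j) e(β, j) ⊗ M`. -/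
theorem exists_lift {N : Type*} [AddCommGroup N] (f : KLR Q (n + 1) →+ M →+ N)
    (h1 : ∀ r b m, f (r * KLR.incl Q n b) m = f r (proj Q a n β b • m))
    (h2 : ∀ r s m, f (r * cyc Q a 0 * s) m = 0) (h3 : ∀ r m, f (r * eLast Q j) m = f r m) :
    ∃ F : (cornerHom Q a j n h).Tens M →+ N, ∀ r m, F (ten a h r m) = f r m := by
  -- e(β') is moved to the right of r, where next to e_j it equals the image of e(β), and this acts
  -- as the identity on `M`. So f automatically ignores the other weights.
  have hβ : ∀ r m, f (eβ Q (n + 1) β' * r) m = f r m := by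
    intro r m
    rw [← eβ_central, ← h3, mul_assoc, ← incl_eβ_mul_eLast Q n j h, ← mul_assoc, h3, h1, proj_eβ,
      one_smul]
  have hker : (proj Q a (n + 1) β').toAddMonoidHom.ker ≤ f.ker := by
    intro r hr
    have hr' := eβ_mul_mem_of_proj_eq_zero Q a (β := β') hr
    rw [AddMonoidHom.mem_ker]
    ext m
    rw [← hβ]
    refine AddSubgroup.closure_induction (p := fun y _ => f y m = 0) ?_ ?_ ?_ ?_ hr'
    · rintro _ ⟨s, t, rfl⟩; exact h2 s t m
    · rw [map_zero]; rfl
    · intro x y _ _ hx hy; rw [map_add, AddMonoidHom.add_apply, hx, hy, add_zero]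
    · intro x _ hx; rw [map_neg, AddMonoidHom.neg_apply, hx, neg_zero]
  let f' : CycKLR Q a (n + 1) β' →+ M →+ N :=
    (proj Q a (n + 1) β').toAddMonoidHom.liftOfSurjective (proj_surjective Q a (n + 1) β') ⟨f, hker⟩
  have hf' : ∀ r, f' (proj Q a (n + 1) β' r) = f r := fun r =>
    AddMonoidHom.liftOfRightInverse_comp_apply (proj Q a (n + 1) β').toAddMonoidHom _
      (Function.rightInverse_surjInv (proj_surjective Q a (n + 1) β')) ⟨f, hker⟩ r
  obtain ⟨F, hF⟩ := GrMod.CornerHom.exists_tens_lift (cornerHom Q a j n h) f' (by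
    intro y b m hy
    obtain ⟨b, rfl⟩ := proj_surjective Q a n β b
    obtain ⟨r, rfl⟩ := proj_surjective Q a (n + 1) β' y
    rw [cornerHom_proj, ← map_mul, hf', hf', ← mul_assoc, h3, h1])
  refine ⟨F, fun r m => ?_⟩
  rw [ten, hF, projLeft_val, hf', h3]

end Ten

end CycKLR

end KLRAlgebras

theorem pow_mul_of_mul {A : Type*} [Ring A] {x y t ε : A} (h : x * (t * ε) = t * (y * ε))
    (hc : Commute y ε) (p : ℕ) : x ^ p * (t * ε) = t * (y ^ p * ε) := by
  induction p with
  | zero => rw [pow_zero, pow_zero, one_mul, one_mul]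
  | succ p ih =>
    rw [pow_succ', mul_assoc, ih, (hc.pow_left p).eq, ← mul_assoc t, ← mul_assoc, h, pow_succ',
      mul_assoc y, (hc.pow_left p).eq]
    simp only [mul_assoc]

/-! ### Sliding past the last crossing, and the cyclotomic element -/

section KLRAlgebras

variable {I : Type v} [Fintype I] [DecidableEq I] {P : Type*} [AddCommGroup P]
    [Module.Free ℤ P] [Module.Finite ℤ P]
variable {C : CartanDatum I P} {k : Type u} [CommRing k] {𝓀 : ℤ → AddSubgroup k}

namespace KLR

variable (Q : KLRDatum C 𝓀) {n : ℕ}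

/-- The crossing `τ_n` of the last two strands in `R(n + 2)`. -/
noncomputable abbrev τLast (n : ℕ) : KLR Q (n + 2) := τ Q n (Nat.lt_succ_self (n + 1))

theorem eLast_mul_τLast (i : I) :
    eLast Q i * τLast Q n = τLast Q n * incl Q (n + 1) (eLast Q i) := by
  rw [incl_eAt, τ_mul_eAt]
  congr 1
  exact (congrArg (fun l => eAt Q l i) (sSwap_left n (Nat.lt_succ_self (n + 1)))).symm

theorem incl_eLast_mul_τLast (j : I) :
    incl Q (n + 1) (eLast Q j) * τLast Q n = τLast Q n * eLast Q j := by
  rw [incl_eAt, τ_mul_eAt]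
  congr 1
  exact (congrArg (fun l => eAt Q l j) (sSwap_right n (Nat.lt_succ_self (n + 1)))).symm

theorem incl_incl_e (ν : Fin n → I) : incl Q (n + 1) (incl Q n (e Q ν)) =
    eSum Q (Finset.univ.filter fun μ : Fin (n + 2) → I => (fun l => μ l.castSucc.castSucc) = ν) := by
  have h : incl Q n (e Q ν) =
      eSum Q (Finset.univ.filter fun μ : Fin (n + 1) → I => (fun l => μ l.castSucc) = ν) := by
    refine ext_e Q (RingHom.id _) fun μ => ?_
    simp only [RingHom.id_apply]
    rw [incl_e_mul_e, eSum_mul_e]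
    simp
  refine ext_e Q (RingHom.id _) fun μ => ?_
  simp only [RingHom.id_apply]
  rw [h, incl_eSum_mul_e, eSum_mul_e]
  simp

/-- R(n) and the last crossing of R(n + 2) involve disjoint sets of strands. -/
theorem incl_incl_comm_τLast (b : KLR Q n) :
    incl Q (n + 1) (incl Q n b) * τLast Q n = τLast Q n * incl Q (n + 1) (incl Q n b) := by
  refine commute_induction Q ((incl Q (n + 1)).comp (incl Q n)) (τLast Q n) (fun ν => ?_)
    (fun l => ?_) (fun l h => ?_) b
  · rw [AlgHom.comp_apply, incl_incl_e]
    refine (τ_mul_eSum Q _ _ _ fun μ hμ => ?_).symm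
    simp only [Finset.mem_filter, Finset.mem_univ, true_and] at hμ ⊢
    rw [← hμ]
    funext l
    exact congrArg μ (sSwap_of_ne n _ l.1 (by omega) (by omega) (by omega))
  · rw [AlgHom.comp_apply, incl_x, incl_x, τ_x_of_ne]
    · simp only [Fin.val_castSucc]; omega
    · simp only [Fin.val_castSucc]; omega
  · rw [AlgHom.comp_apply, incl_τ, incl_τ]
    exact τ_comm Q _ _ _ _ (Or.inl (by omega))

theorem incl_cross {l : ℕ} (h : l + 1 < n + 1) :
    incl Q (n + 1) (cross Q (n + 1) l) = cross Q (n + 2) l := by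
  rw [cross_eq Q h, cross_eq Q (Nat.lt_succ_of_lt h), incl_τ]

theorem incl_ascProd {a d : ℕ} (h : a + d ≤ n) :
    incl Q (n + 1) (ascProd (cross Q (n + 1)) a d) = ascProd (cross Q (n + 2)) a d := by
  induction d with
  | zero => rw [ascProd_zero, ascProd_zero, map_one]
  | succ d ih => rw [ascProd_succ', ascProd_succ', map_mul, ih (by omega), incl_cross Q (by omega)]

theorem ascProd_eq {a d : ℕ} (h : a + d = n) :
    ascProd (cross Q (n + 2)) a (d + 1) =
      incl Q (n + 1) (ascProd (cross Q (n + 1)) a d) * τLast Q n := by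
  subst h
  rw [ascProd_succ', incl_ascProd Q le_rfl, cross_eq Q (Nat.lt_succ_self (a + d + 1))]

theorem eAt_mul_ascProd (i : I) (d : ℕ) : ∀ a (h : a + d < n),
    eAt Q (pos a (by omega)) i * ascProd (cross Q n) a d =
      ascProd (cross Q n) a d * eAt Q (pos (a + d) h) i := by
  induction d with
  | zero => intro a h; rw [ascProd_zero, mul_one, one_mul]; rfl
  | succ d ih =>
    intro a h
    have h1 : a + 1 < n := by omega
    have h2 : eAt Q (pos a (by omega)) i * cross Q n a = cross Q n a * eAt Q (pos (a + 1) h1) i := by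
      rw [cross_eq Q h1, τ_mul_eAt, sSwap_right]
    have h3 := ih (a + 1) (by omega)
    rw [ascProd_succ, ← mul_assoc, h2, mul_assoc, h3, ← mul_assoc]
    congr 2
    exact Fin.ext (by simp only; omega)

theorem eAt_mul_descProd (i : I) (d : ℕ) : ∀ a (h : a + d < n),
    eAt Q (pos (a + d) h) i * descProd (cross Q n) a d =
      descProd (cross Q n) a d * eAt Q (pos a (by omega)) i := by
  induction d with
  | zero => intro a h; rw [descProd_zero, mul_one, one_mul]; rfl
  | succ d ih =>
    intro a h
    have h1 : a + 1 < n := by omega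
    have h2 : eAt Q (pos (a + 1) h1) i * cross Q n a = cross Q n a * eAt Q (pos a (by omega)) i := by
      rw [cross_eq Q h1, τ_mul_eAt, sSwap_left]
    have h3 := ih (a + 1) (by omega)
    have h4 : (pos (a + (d + 1)) h : Fin n) = pos (a + 1 + d) (by omega) :=
      Fin.ext (by simp only; omega)
    rw [descProd_succ, ← mul_assoc, h4, h3, mul_assoc, h2, ← mul_assoc]

section

variable {i j : I} (hij : i ≠ j)
include hij

/-- The correction in the relation between τ_n and a dot is supported on equal letters, hence it
vanishes when the last two letters are i ≠ j. The sliding rules that follow rest on this. -/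
theorem eEq_mul_eq_zero : eEq Q n (Nat.lt_succ_self (n + 1)) *
    (incl Q (n + 1) (eLast Q i) * eLast Q j) = 0 := by
  rw [incl_eAt]
  have h := eEq_mul_eAt Q n (Nat.lt_succ_self (n + 1)) i
  rw [← mul_assoc]
  refine (congrArg (· * eLast Q j) h).trans ?_
  change eAt Q _ i * eAt Q (Fin.last (n + 1)) i * eAt Q (Fin.last (n + 1)) j = 0
  rw [mul_assoc, eAt_mul_eAt, if_neg hij, mul_zero]

theorem x_last_mul_τLast : x Q (Fin.last (n + 1)) * (τLast Q n *
    (incl Q (n + 1) (eLast Q i) * eLast Q j)) =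
      τLast Q n * (incl Q (n + 1) (x Q (Fin.last n)) * (incl Q (n + 1) (eLast Q i) * eLast Q j)) := by
  have h := τ_x_left Q n (Nat.lt_succ_self (n + 1))
  have h0 := eEq_mul_eq_zero Q (n := n) hij
  have h1 := congrArg (· * (incl Q (n + 1) (eLast Q i) * eLast Q j)) h
  rw [sub_mul, h0, sub_zero, mul_assoc, mul_assoc] at h1
  rw [incl_x]
  exact h1.symm

theorem incl_x_mul_τLast : incl Q (n + 1) (x Q (Fin.last n)) * (τLast Q n *
    (incl Q (n + 1) (eLast Q i) * eLast Q j)) =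
      τLast Q n * (x Q (Fin.last (n + 1)) * (incl Q (n + 1) (eLast Q i) * eLast Q j)) := by
  have h := τ_x_right Q n (Nat.lt_succ_self (n + 1))
  have h0 := eEq_mul_eq_zero Q (n := n) hij
  have h1 := congrArg (· * (incl Q (n + 1) (eLast Q i) * eLast Q j)) h
  rw [add_mul, h0, add_zero, mul_assoc, mul_assoc] at h1
  rw [incl_x]
  exact h1.symm

theorem x_last_pow_mul_τLast (p : ℕ) : x Q (Fin.last (n + 1)) ^ p * (τLast Q n *
    (incl Q (n + 1) (eLast Q i) * eLast Q j)) =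
      τLast Q n *
        (incl Q (n + 1) (x Q (Fin.last n) ^ p) * (incl Q (n + 1) (eLast Q i) * eLast Q j)) := by
  have hc : incl Q (n + 1) (x Q (Fin.last n)) * (incl Q (n + 1) (eLast Q i) * eLast Q j) =
      incl Q (n + 1) (eLast Q i) * eLast Q j * incl Q (n + 1) (x Q (Fin.last n)) := by
    rw [mul_assoc, ← incl_comm_eLast, ← mul_assoc, ← mul_assoc, ← map_mul, ← map_mul, eAt_comm_x]
  rw [map_pow]
  exact pow_mul_of_mul (x_last_mul_τLast Q hij) hc p

theorem incl_x_pow_mul_τLast (p : ℕ) : incl Q (n + 1) (x Q (Fin.last n) ^ p) * (τLast Q n *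
    (incl Q (n + 1) (eLast Q i) * eLast Q j)) =
      τLast Q n *
        (x Q (Fin.last (n + 1)) ^ p * (incl Q (n + 1) (eLast Q i) * eLast Q j)) := by
  have hc : x Q (Fin.last (n + 1)) * (incl Q (n + 1) (eLast Q i) * eLast Q j) =
      incl Q (n + 1) (eLast Q i) * eLast Q j * x Q (Fin.last (n + 1)) := by
    rw [mul_assoc, ← eAt_comm_x, ← mul_assoc, ← mul_assoc, incl_comm_x_last]
  rw [map_pow]
  exact pow_mul_of_mul (incl_x_mul_τLast Q hij) hc p

end

section Cyc

variable {Λ : P} (a : CyclotomicDatum C 𝓀 Λ)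

/-- x[l] depends on a word only through its letter at l, so an element commutes with it as soon as
it commutes with x_l and with the idempotents of this letter. For l = 0, every crossing other than
τ_0 does so. -/
theorem cyc_eq (l : Fin n) : cyc Q a l = ∑ i, a.eval i (x Q l) * eAt Q l i := by
  refine ext_e Q (RingHom.id _) fun ν => ?_
  simp only [RingHom.id_apply]
  have h1 : cyc Q a l * e Q ν = a.eval (ν l) (x Q l) * e Q ν := by
    rw [cyc, Finset.sum_mul, Finset.sum_eq_single ν]
    · rw [mul_assoc, e_idem]
    · intro μ _ hμ
      rw [mul_assoc, e_mul, if_neg hμ, mul_zero]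
    · simp
  have h2 : (∑ i, a.eval i (x Q l) * eAt Q l i) * e Q ν = a.eval (ν l) (x Q l) * e Q ν := by
    rw [Finset.sum_mul, Finset.sum_eq_single (ν l)]
    · rw [mul_assoc, eAt_mul_e, if_pos rfl]
    · intro i _ hi
      rw [mul_assoc, eAt_mul_e, if_neg hi.symm, mul_zero]
    · simp
  rw [h1, h2]

theorem commute_cyc {l : Fin n} {y : KLR Q n} (hx : Commute y (x Q l))
    (he : ∀ i, Commute y (eAt Q l i)) : Commute y (cyc Q a l) := by
  rw [cyc_eq]
  refine Commute.sum_right _ _ _ fun i _ => Commute.mul_right ?_ (he i)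
  exact Commute.sum_right _ _ _ fun p _ => (hx.pow_right _).smul_right _

theorem eAt_mul_cyc (l m : Fin n) (i : I) : Commute (eAt Q l i) (cyc Q a m) :=
  commute_cyc Q a (eAt_comm_x Q l m i).symm fun j => eAt_comm_eAt Q m l i j

theorem cross_mul_cyc {l : ℕ} (hl : 0 < l) :
    Commute (cross Q (n + 1) l) (cyc Q a 0) := by
  by_cases h : l + 1 < n + 1
  · rw [cross_eq Q h]
    refine commute_cyc Q a (τ_x_of_ne Q l h 0 hl.ne (by simp)) fun i => ?_
    refine (τ_mul_eAt Q l h 0 i).trans ?_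
    congr 2
    exact sSwap_of_ne l h 0 (Nat.succ_pos n) hl.ne (by simp)
  · rw [cross, dif_neg h]
    exact Commute.zero_left _

theorem ascProd_mul_cyc {b : ℕ} (d : ℕ) (hb : 0 < b) :
    Commute (ascProd (cross Q (n + 1)) b d) (cyc Q a 0) := by
  induction d generalizing b with
  | zero => exact Commute.one_left _
  | succ d ih =>
    rw [ascProd_succ]
    exact (cross_mul_cyc Q a hb).mul_left (ih (Nat.succ_pos b))

theorem incl_cyc_zero : incl Q (n + 1) (cyc Q a 0) = cyc Q a 0 := incl_cyc Q a 0

/-- Only the last crossing moves the last letter. -/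
theorem parabolic_comm_eLast {c : KLR Q (n + 1)}
    (hc : c ∈ IsCrossing.parabolic (cross Q (n + 1)) (polys Q (n + 1)).toSubring n) (i : I) :
    Commute c (eLast Q i) := by
  induction hc using Subring.closure_induction with
  | mem s hs =>
    rcases hs with hs | ⟨l, hl, rfl⟩
    · induction hs using Algebra.adjoin_induction with
      | mem p hp =>
        rcases hp with ⟨ν, rfl⟩ | ⟨l, rfl⟩
        · exact eAt_comm_e Q _ _ _
        · exact eAt_comm_x Q _ _ _
      | algebraMap c => exact Algebra.commutes _ _
      | add p p' _ _ h h' => exact h.add_left h'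
      | mul p p' _ _ h h' => exact h.mul_left h'
    · have hl' : l + 1 < n := hl
      rw [cross_eq Q (Nat.lt_succ_of_lt hl'), ← incl_τ Q l hl']
      exact incl_comm_eLast Q _ i
  | zero => exact Commute.zero_left _
  | one => exact Commute.one_left _
  | add s s' _ _ h h' => exact h.add_left h'
  | neg s _ h => exact h.neg_left
  | mul s s' _ _ h h' => exact h.mul_left h'

end Cyc

end KLR

/-! ### Strand coefficients with values in a module -/

namespace CycKLR

open KLR

section StrandVec

variable {Q : KLRDatum C 𝓀} {Λ : P} (a : CyclotomicDatum C 𝓀 Λ) {n : ℕ} (β : P) (j : I)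
  (M : Type*) [AddCommGroup M] [Module (CycKLR Q a (n + 1) β) M]

/-- The family of all strand coefficients of an element of `R(n + 2)`, acting on `m ∈ M`. -/
noncomputable def strandVec : KLR Q (n + 2) →+ M →+ (Fin (n + 2) × ℤ → M) :=
  AddMonoidHom.mk' (fun r => AddMonoidHom.mk'
      (fun m p => proj Q a (n + 1) β (strandCoeff Q (n + 1) j p.1 p.2 r) • m)
      fun m m' => funext fun p => smul_add _ m m')
    fun r s => AddMonoidHom.ext fun m => funext fun p => by
      change proj Q a (n + 1) β (strandCoeff Q (n + 1) j p.1 p.2 (r + s)) • m =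
        proj Q a (n + 1) β (strandCoeff Q (n + 1) j p.1 p.2 r) • m +
          proj Q a (n + 1) β (strandCoeff Q (n + 1) j p.1 p.2 s) • m
      rw [map_add, map_add, add_smul]

variable {M}

theorem strandVec_apply (r : KLR Q (n + 2)) (m : M) (p : Fin (n + 2) × ℤ) :
    strandVec a β j M r m p = proj Q a (n + 1) β (strandCoeff Q (n + 1) j p.1 p.2 r) • m := rfl

theorem strandVec_mul_incl (r : KLR Q (n + 2)) (b : KLR Q (n + 1)) (m : M) :
    strandVec a β j M (r * KLR.incl Q (n + 1) b) m =
      strandVec a β j M r (proj Q a (n + 1) β b • m) := by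
  funext p
  rw [strandVec_apply, strandVec_apply, strandCoeff_mul_incl, map_mul, mul_smul]

theorem strandVec_mul_eLast (r : KLR Q (n + 2)) (m : M) :
    strandVec a β j M (r * eLast Q j) m = strandVec a β j M r m := by
  funext p
  rw [strandVec_apply, strandVec_apply, strandCoeff_mul_eAt, if_pos rfl]

theorem strandVec_mul_eLast_of_ne {i : I} (h : i ≠ j) (r : KLR Q (n + 2)) (m : M) :
    strandVec a β j M (r * eLast Q i) m = 0 := by
  funext p
  rw [strandVec_apply, strandCoeff_mul_eAt, if_neg h, map_zero, zero_smul]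
  rfl

/-- Additive maps that are balanced in the sense of `exists_lift` are determined by the powers of
`x_{n + 1}` on the elements of `R(n + 2)` that do not involve the last crossing. -/
theorem apply_mul_parabolic_mem {n : ℕ} {Q : KLRDatum C 𝓀} {a : CyclotomicDatum C 𝓀 Λ}
    {M : Type*} [AddCommGroup M] [Module (CycKLR Q a n β) M] {N : Type*} [AddCommGroup N]
    (f : KLR Q (n + 1) →+ M →+ N)
    (h1 : ∀ r b m, f (r * KLR.incl Q n b) m = f r (proj Q a n β b • m))
    (h3 : ∀ r m, f (r * eLast Q j) m = f r m) {c : KLR Q (n + 1)}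
    (hc : c ∈ IsCrossing.parabolic (cross Q (n + 1)) (polys Q (n + 1)).toSubring n)
    (G : AddSubgroup N) (r : KLR Q (n + 1)) (m : M)
    (hG : ∀ (p : ℕ) (b : KLR Q n), f (r * x Q (Fin.last n) ^ p) (proj Q a n β b • m) ∈ G) :
    f (r * c) m ∈ G := by
  rw [← h3, mul_assoc]
  refine AddSubgroup.closure_induction (p := fun y _ => f (r * y) m ∈ G) ?_ ?_ ?_ ?_
    (parabolic_mul_eLast hc j)
  · rintro _ ⟨p, b, rfl⟩
    rw [← mul_assoc, ← mul_assoc, h3, h1]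
    exact hG p b
  · rw [mul_zero, map_zero]; exact zero_mem _
  · intro x y _ _ hx hy
    rw [mul_add, map_add]; exact add_mem hx hy
  · intro x _ hx
    rw [mul_neg, map_neg]; exact neg_mem hx

/-- A product τ_b ⋯ τ_n with b > 0 does not touch the first strand, so x[1] passes it and the power
of the last dot. Being an element of R(n + 1), it is then absorbed by `M`, on which it is zero. -/
theorem strandVec_mul_cyc_mul {y : KLR Q (n + 2)}
    (hy : y ∈ IsCrossing.filtration (cross Q (n + 2)) (polys Q (n + 2)).toSubring (n + 1) 1)
    (r : KLR Q (n + 2)) (m : M) : strandVec a β j M (r * cyc Q a 0 * y) m = 0 := by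
  refine AddSubgroup.closure_induction
    (p := fun y _ => strandVec a β j M (r * cyc Q a 0 * y) m = 0) ?_ ?_ ?_ ?_ hy
  · rintro _ ⟨b, d, c, hc, hb, hd, rfl⟩
    rw [← mul_assoc, ← AddSubgroup.mem_bot]
    refine apply_mul_parabolic_mem β j (strandVec a β j M) (strandVec_mul_incl a β j)
      (strandVec_mul_eLast a β j) hc ⊥ _ m fun p b' => ?_
    rw [mul_assoc r, ← (ascProd_mul_cyc Q a d hb).eq, ← incl_cyc_zero Q a, mul_assoc, mul_assoc,
      incl_comm_x_pow, ← mul_assoc, ← mul_assoc, strandVec_mul_incl, proj_cyc, zero_smul, map_zero]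
    exact zero_mem _
  · rw [mul_zero, map_zero]; rfl
  · intro x y _ _ hx hy
    rw [mul_add, map_add, AddMonoidHom.add_apply, hx, hy, add_zero]
  · intro x _ hx
    rw [mul_neg, map_neg, AddMonoidHom.neg_apply, hx, neg_zero]

theorem x_pow_mem_parabolic (l : Fin (n + 1)) (p : ℕ) :
    x Q l ^ p ∈ IsCrossing.parabolic (cross Q (n + 1)) (polys Q (n + 1)).toSubring n :=
  pow_mem (IsCrossing.mem_parabolic (x_mem_polys l)) p

/-- A crossing passes through `cyc · τ_0 ⋯ τ_n` modulo terms which vanish on `M`. -/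
theorem strandVec_mul_descProd (d : ℕ) : ∀ (b : ℕ), 0 < b → b + d = n + 1 →
    ∀ (r : KLR Q (n + 2)) (p : ℕ) (m : M), ∃ m' : M,
      strandVec a β j M (r * descProd (cross Q (n + 2)) b d * cyc Q a 0 *
        ascProd (cross Q (n + 2)) 0 (n + 1) * x Q (Fin.last (n + 1)) ^ p) m =
      strandVec a β j M (r * cyc Q a 0 *
        ascProd (cross Q (n + 2)) 0 (n + 1) * x Q (Fin.last (n + 1)) ^ p) m' := by
  induction d with
  | zero =>
    intro b _ _ r p m
    exact ⟨m, by rw [descProd_zero, mul_one]⟩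
  | succ d ih =>
    intro b hb hd r p m
    obtain ⟨b, rfl⟩ : ∃ b', b = b' + 1 := ⟨b - 1, by omega⟩
    -- The rightmost factor of the descending product, τ_{b+1}, will emerge on the right as τ_b of
    -- R(n + 1) and act on m; the other factors are handled by induction.
    obtain ⟨m', hm'⟩ := ih (b + 1 + 1) (by omega) (by omega) r p
      (proj Q a (n + 1) β (cross Q (n + 1) b) • m)
    refine ⟨m', ?_⟩
    have H := isCrossing Q (n + 1)
    -- τ_{b+1} passes τ_0 ⋯ τ_n as τ_b, up to products that start at b + 2 or later; behind x[1]
    -- these contribute zero.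
    have hmem := H.t_mul_ascProd_sub_mem (a := 0) (d := n + 1) (l := b) (Nat.zero_add _)
      (Nat.zero_le _) (by omega)
    have hmem' := IsCrossing.filtration_mul_mem
      (IsCrossing.filtration_mono (show 1 ≤ b + 2 by omega) hmem)
      (x_pow_mem_parabolic (Q := Q) (Fin.last (n + 1)) p)
    have h0 := strandVec_mul_cyc_mul a β j hmem' (r * descProd (cross Q (n + 2)) (b + 1 + 1) d) m
    have hcom : cross Q (n + 2) b * x Q (Fin.last (n + 1)) ^ p =
        x Q (Fin.last (n + 1)) ^ p * KLR.incl Q (n + 1) (cross Q (n + 1) b) := by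
      rw [← incl_cross Q (by omega), incl_comm_x_pow]
    rw [← hm', ← strandVec_mul_incl, ← sub_eq_zero, ← AddMonoidHom.sub_apply, ← map_sub, ← h0,
      descProd_succ]
    congr 2
    have hcyc : ∀ z, cross Q (n + 2) (b + 1) * (cyc Q a 0 * z) =
        cyc Q a 0 * (cross Q (n + 2) (b + 1) * z) := fun z => by
      rw [← mul_assoc, (cross_mul_cyc Q a (Nat.succ_pos b)).eq, mul_assoc]
    rw [sub_mul, mul_sub, mul_assoc (ascProd _ 0 _), hcom]
    simp only [mul_assoc, hcyc]

end StrandVec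

end CycKLR

/-! ### The comparison map and its surjectivity -/

namespace CycKLR

open KLR

section Swap

variable (Q : KLRDatum C 𝓀) {Λ : P} (a : CyclotomicDatum C 𝓀 Λ) (n : ℕ) {β₀ β β' γ : P} {i j : I}
  (h₀ : β₀ + C.α i = β) (h₁ : β₀ + C.α j = β') (h₂ : β + C.α j = γ) (h₃ : β' + C.α i = γ)
  (M : Type*) [AddCommGroup M] [Module (CycKLR Q a (n + 1) β) M]

/-- The space `e(*, i) M`. -/
noncomputable abbrev TruncSpace := (cornerHom Q a i n h₀).truncSubgroup M

variable {M}

variable {Q n} in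
theorem coe_proj_smul (b : KLR Q n) (w : TruncSpace Q a n h₀ M) :
    ((proj Q a n β₀ b • w : TruncSpace Q a n h₀ M) : M) =
      proj Q a (n + 1) β (KLR.incl Q n b) • (w : M) := by
  rw [GrMod.CornerHom.coe_trunc_smul, cornerHom_proj, map_mul, mul_smul, ← cornerHom_idem a h₀]
  exact congrArg _ w.2

variable {Q n} in
theorem eLast_smul_coe (w : TruncSpace Q a n h₀ M) :
    proj Q a (n + 1) β (eLast Q i) • (w : M) = w := by
  rw [← cornerHom_idem a h₀]
  exact w.2

/-- The element `e(*, i) m` of `e(*, i) M`. -/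
noncomputable def truncate (m : M) : TruncSpace Q a n h₀ M :=
  ⟨proj Q a (n + 1) β (eLast Q i) • m, by
    rw [GrMod.CornerHom.mem_truncSubgroup, cornerHom_idem, ← mul_smul, ← map_mul, eAt_mul_eAt,
      if_pos rfl]⟩

variable {Q n} in
theorem coe_truncate (m : M) :
    (truncate Q a n h₀ m : M) = proj Q a (n + 1) β (eLast Q i) • m := rfl

theorem incl_eLast_comm_τLast_mul (s : KLR Q (n + 1)) :
    eLast Q i * (KLR.incl Q (n + 1) s * τLast Q n) =
      KLR.incl Q (n + 1) s * τLast Q n * KLR.incl Q (n + 1) (eLast Q i) := by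
  rw [← mul_assoc, ← incl_comm_eLast, mul_assoc, eLast_mul_τLast, mul_assoc]

variable (M)

/-- The balancing relation over R(n) holds because τ_n commutes with R(n), the cyclotomic relation
because x[1] of R(n + 1) maps to x[1] of R(n + 2), and the restriction to words ending in j because
τ_n carries this letter to the end. -/
theorem exists_swapMap : ∃ F : (cornerHom Q a j n h₁).Tens (TruncSpace Q a n h₀ M) →+
    (cornerHom Q a j (n + 1) h₂).Tens M, ∀ (s : KLR Q (n + 1)) (w : TruncSpace Q a n h₀ M),
      F (ten a h₁ s w) = ten a h₂ (KLR.incl Q (n + 1) s * τLast Q n) (w : M) := by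
  let f : KLR Q (n + 1) →+ TruncSpace Q a n h₀ M →+ (cornerHom Q a j (n + 1) h₂).Tens M :=
    AddMonoidHom.mk' (fun s => (tenHom (M := M) a h₂ (KLR.incl Q (n + 1) s * τLast Q n)).comp
      (AddSubgroup.subtype _)) fun s s' => AddMonoidHom.ext fun w => by
        change ten a h₂ (KLR.incl Q (n + 1) (s + s') * τLast Q n) (w : M) =
          ten a h₂ (KLR.incl Q (n + 1) s * τLast Q n) (w : M) +
            ten a h₂ (KLR.incl Q (n + 1) s' * τLast Q n) (w : M)
        rw [map_add, add_mul, ten_add]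
  have hf : ∀ s w, f s w = ten a h₂ (KLR.incl Q (n + 1) s * τLast Q n) (w : M) := fun _ _ => rfl
  obtain ⟨F, hF⟩ := exists_lift a h₁ f (fun r b w => by
      rw [hf, hf, map_mul, mul_assoc, incl_incl_comm_τLast, ← mul_assoc, ten_mul_incl, coe_proj_smul])
    (fun r s w => by
      rw [hf, map_mul, map_mul, incl_cyc_zero, mul_assoc _ (KLR.incl Q (n + 1) s), ten_mul_cyc])
    (fun r w => by
      rw [hf, hf, map_mul, mul_assoc, incl_eLast_mul_τLast, ← mul_assoc, ten_mul_eLast])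
  exact ⟨F, hF⟩

/-- The map `F_j E_i M → F_j M`, `s ⊗ w ↦ s τ_n ⊗ w`. -/
noncomputable def swapMap : (cornerHom Q a j n h₁).Tens (TruncSpace Q a n h₀ M) →+
    (cornerHom Q a j (n + 1) h₂).Tens M := (exists_swapMap Q a n h₀ h₁ h₂ M).choose

variable {M}

variable {Q n} in
theorem swapMap_ten (s : KLR Q (n + 1)) (w : TruncSpace Q a n h₀ M) :
    swapMap Q a n h₀ h₁ h₂ M (ten a h₁ s w) =
      ten a h₂ (KLR.incl Q (n + 1) s * τLast Q n) (w : M) :=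
  (exists_swapMap Q a n h₀ h₁ h₂ M).choose_spec s w

/-- The last letter i of w crosses τ_n and ends up as the last letter on the left. -/
theorem idem_smul_swapMap (z : (cornerHom Q a j n h₁).Tens (TruncSpace Q a n h₀ M)) :
    proj Q a (n + 2) γ (eLast Q i) • swapMap Q a n h₀ h₁ h₂ M z = swapMap Q a n h₀ h₁ h₂ M z := by
  refine AddSubgroup.closure_induction (p := fun z _ => proj Q a (n + 2) γ (eLast Q i) •
    swapMap Q a n h₀ h₁ h₂ M z = swapMap Q a n h₀ h₁ h₂ M z) ?_ ?_ ?_ ?_ (mem_closure_ten a h₁ z)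
  · rintro _ ⟨s, w, rfl⟩
    rw [swapMap_ten, proj_smul_ten, incl_eLast_comm_τLast_mul, ten_mul_incl, eLast_smul_coe]
  · rw [map_zero, smul_zero]
  · intro x y _ _ hx hy; rw [map_add, smul_add, hx, hy]
  · intro x _ hx; rw [map_neg, smul_neg, hx]

theorem swapMap_smul (s : KLR Q (n + 1)) (z : (cornerHom Q a j n h₁).Tens (TruncSpace Q a n h₀ M)) :
    swapMap Q a n h₀ h₁ h₂ M (proj Q a (n + 1) β' s • z) =
      proj Q a (n + 2) γ (KLR.incl Q (n + 1) s) • swapMap Q a n h₀ h₁ h₂ M z := by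
  refine AddSubgroup.closure_induction (p := fun z _ => swapMap Q a n h₀ h₁ h₂ M
    (proj Q a (n + 1) β' s • z) = proj Q a (n + 2) γ (KLR.incl Q (n + 1) s) •
      swapMap Q a n h₀ h₁ h₂ M z) ?_ ?_ ?_ ?_ (mem_closure_ten a h₁ z)
  · rintro _ ⟨r, w, rfl⟩
    rw [proj_smul_ten, swapMap_ten, swapMap_ten, proj_smul_ten, map_mul, mul_assoc]
  · rw [smul_zero, map_zero, smul_zero]
  · intro x y _ _ hx hy; rw [smul_add, map_add, hx, hy, map_add, smul_add]
  · intro x _ hx; rw [smul_neg, map_neg, hx, map_neg, smul_neg]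

section Surjective

variable (hij : i ≠ j)
include hij

/-- Up to elements absorbed by `M`, it suffices to treat r = τ_b ⋯ τ_n x_{n+1}^p. Multiplied by e_i
on the left, it is zero if no crossing occurs, and otherwise it has τ_n as its last crossing. -/
theorem eLast_smul_mem_range_swapMap (z : (cornerHom Q a j (n + 1) h₂).Tens M) :
    proj Q a (n + 2) γ (eLast Q i) • z ∈ (swapMap Q a n h₀ h₁ h₂ M).range := by
  set G := (swapMap Q a n h₀ h₁ h₂ M).range
  refine AddSubgroup.closure_induction (p := fun z _ => proj Q a (n + 2) γ (eLast Q i) • z ∈ G)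
    ?_ ?_ ?_ ?_ (mem_closure_ten a h₂ z)
  · rintro _ ⟨r, m, rfl⟩
    rw [proj_smul_ten]
    refine AddSubgroup.closure_induction (p := fun r _ => ten a h₂ (eLast Q i * r) m ∈ G)
      ?_ ?_ ?_ ?_ ((isCrossing Q (n + 1)).mem_filtration (closure_eq_top Q (n + 1)) r)
    · rintro _ ⟨b, d, c, hc, -, hd, rfl⟩
      rw [← mul_assoc, ← tenHom_apply]
      refine apply_mul_parabolic_mem β j (tenHom a h₂) (ten_mul_incl a h₂) (ten_mul_eLast a h₂) hc
        G _ m fun p b' => ?_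
      rw [tenHom_apply]
      generalize proj Q a (n + 1) β b' • m = m
      cases d with
      | zero =>
        -- No crossing: the last letter would have to be both i and j.
        rw [ascProd_zero, mul_one, ← ten_mul_eLast, ← x_pow_comm_eAt, mul_assoc, eAt_mul_eAt,
          if_neg hij, mul_zero, ← tenHom_apply, map_zero]
        exact zero_mem _
      | succ d =>
        -- The preimage has τ_n removed. The power of the last dot, which stands to the right of
        -- τ_n, slides back through it to the last strand of R(n + 1).
        refine ⟨ten a h₁ (ascProd (cross Q (n + 1)) b d * x Q (Fin.last n) ^ p) (truncate Q a n h₀ m), ?_⟩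
        rw [swapMap_ten, coe_truncate, ← ten_mul_incl, ← ten_mul_eLast, ascProd_eq Q (by omega),
          incl_eLast_comm_τLast_mul, map_mul, ← ten_mul_eLast a h₂ (_ * x Q _ ^ p)]
        have := incl_x_pow_mul_τLast Q (n := n) hij p
        simp only [mul_assoc]
        rw [this]
        congr 2
        rw [← mul_assoc (x Q _ ^ p), ← incl_comm_x_pow, mul_assoc]
    · rw [mul_zero, ← tenHom_apply, map_zero]; exact zero_mem _
    · intro x y _ _ hx hy; rw [mul_add, ten_add]; exact add_mem hx hy
    · intro x _ hx; rw [mul_neg, ← tenHom_apply, map_neg]; exact neg_mem hx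
  · rw [smul_zero]; exact zero_mem _
  · intro x y _ _ hx hy; rw [smul_add]; exact add_mem hx hy
  · intro x _ hx; rw [smul_neg]; exact neg_mem hx

end Surjective

end Swap

end CycKLR

/-! ### Injectivity of the comparison map -/

namespace CycKLR

open KLR

section Injective

variable (Q : KLRDatum C 𝓀) {Λ : P} (a : CyclotomicDatum C 𝓀 Λ) (n : ℕ) {β₀ β β' γ : P} {i j : I}
  (h₀ : β₀ + C.α i = β) (h₁ : β₀ + C.α j = β') (h₂ : β + C.α j = γ)
  (M : Type*) [AddCommGroup M] [Module (CycKLR Q a (n + 1) β) M]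

/-- The pairs `(s ⊗ w, strandVec (s τ_n) w)`. -/
noncomputable def pairHom : KLR Q (n + 1) →+ TruncSpace Q a n h₀ M →+
    (cornerHom Q a j n h₁).Tens (TruncSpace Q a n h₀ M) × (Fin (n + 2) × ℤ → M) :=
  AddMonoidHom.mk' (fun s => AddMonoidHom.prod (tenHom a h₁ s)
      ((strandVec a β j M (KLR.incl Q (n + 1) s * τLast Q n)).comp (AddSubgroup.subtype _)))
    fun s s' => AddMonoidHom.ext fun w => Prod.ext (ten_add a h₁ s s' w) (by
      change strandVec a β j M _ (w : M) = strandVec a β j M _ (w : M) + strandVec a β j M _ (w : M)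
      rw [map_add, add_mul, map_add, AddMonoidHom.add_apply])

variable {M}

theorem pairHom_apply (s : KLR Q (n + 1)) (w : TruncSpace Q a n h₀ M) : pairHom Q a n h₀ h₁ M s w =
    (ten a h₁ s w, strandVec a β j M (KLR.incl Q (n + 1) s * τLast Q n) (w : M)) := rfl

theorem pairHom_mul_incl (s : KLR Q (n + 1)) (b : KLR Q n) (w : TruncSpace Q a n h₀ M) :
    pairHom Q a n h₀ h₁ M (s * KLR.incl Q n b) w =
      pairHom Q a n h₀ h₁ M s (proj Q a n β₀ b • w) := by
  rw [pairHom_apply, pairHom_apply, ten_mul_incl, map_mul (KLR.incl Q (n + 1)), mul_assoc, incl_incl_comm_τLast,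
    ← mul_assoc, strandVec_mul_incl, coe_proj_smul]

theorem pairHom_mul_eLast (s : KLR Q (n + 1)) (w : TruncSpace Q a n h₀ M) :
    pairHom Q a n h₀ h₁ M (s * eLast Q j) w = pairHom Q a n h₀ h₁ M s w := by
  rw [pairHom_apply, pairHom_apply, ten_mul_eLast, map_mul (KLR.incl Q (n + 1)), mul_assoc, incl_eLast_mul_τLast,
    ← mul_assoc, strandVec_mul_eLast]

variable (M)

/-- The correspondence generated by the pairs `(s ⊗ w, strandVec (s τ_n) w)`. -/
noncomputable def pairGroup : AddSubgroup
    ((cornerHom Q a j n h₁).Tens (TruncSpace Q a n h₀ M) × (Fin (n + 2) × ℤ → M)) :=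
  AddSubgroup.closure {g | ∃ (s : KLR Q (n + 1)) (w : TruncSpace Q a n h₀ M),
    g = pairHom Q a n h₀ h₁ M s w}

/-- The elements `∑ pairHom (τ_b ⋯ τ_{n-1} x_n^p) w_{b,p}`. -/
noncomputable def pairSum : (Fin (n + 1) × ℕ →₀ TruncSpace Q a n h₀ M) →+
    (cornerHom Q a j n h₁).Tens (TruncSpace Q a n h₀ M) × (Fin (n + 2) × ℤ → M) :=
  Finsupp.liftAddHom fun q => pairHom Q a n h₀ h₁ M
    (ascProd (cross Q (n + 1)) q.1 (n - q.1) * x Q (Fin.last n) ^ q.2)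

/-- R(n + 1) e_j is spanned over R(n) by the τ_b ⋯ τ_{n-1} x_n^p, and in both components of a pair
the elements of R(n) can be moved over to w. So tensor and vector are expressed simultaneously by
the same finite family. -/
theorem pairGroup_le : pairGroup Q a n h₀ h₁ M ≤ (pairSum Q a n h₀ h₁ M).range := by
  rw [pairGroup, AddSubgroup.closure_le]
  rintro _ ⟨s, w, rfl⟩
  rw [SetLike.mem_coe]
  refine AddSubgroup.closure_induction
    (p := fun s _ => pairHom Q a n h₀ h₁ M s w ∈ (pairSum Q a n h₀ h₁ M).range)
    ?_ ?_ ?_ ?_ ((isCrossing Q n).mem_filtration (closure_eq_top Q n) s)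
  · rintro _ ⟨b, d, c, hc, -, hd, rfl⟩
    refine apply_mul_parabolic_mem β₀ j (pairHom Q a n h₀ h₁ M) (pairHom_mul_incl Q a n h₀ h₁)
      (pairHom_mul_eLast Q a n h₀ h₁) hc _ _ w fun p b' => ?_
    refine ⟨Finsupp.single (⟨b, by omega⟩, p) (proj Q a n β₀ b' • w), ?_⟩
    obtain rfl : d = n - b := by omega
    rw [pairSum, Finsupp.liftAddHom_apply_single]
  · rw [map_zero]; exact zero_mem _
  · intro x y _ _ hx hy; rw [map_add]; exact add_mem hx hy
  · intro x _ hx; rw [map_neg]; exact neg_mem hx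

variable {M} (hij : i ≠ j)
include hij

/-- Since w = e_i w and i ≠ j, the power of the last dot of R(n + 1) slides through τ_n; the product
then has the shape to which triangularity applies. -/
theorem strandVec_ascProd (d b : ℕ) (hd : b + d = n) (p : ℕ) (w : TruncSpace Q a n h₀ M) :
    strandVec a β j M (KLR.incl Q (n + 1) (ascProd (cross Q (n + 1)) b d * x Q (Fin.last n) ^ p) *
      τLast Q n) (w : M) =
    strandVec a β j M (ascProd (cross Q (n + 2)) b (d + 1) * x Q (Fin.last (n + 1)) ^ p) w := by
  have hx := incl_x_pow_mul_τLast Q (n := n) hij p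
  rw [← eLast_smul_coe a h₀ w, ← strandVec_mul_incl, ← strandVec_mul_incl, ← strandVec_mul_eLast,
    ← strandVec_mul_eLast a β j (_ * x Q _ ^ p * _), ascProd_eq Q hd, map_mul (KLR.incl Q (n + 1))]
  simp only [mul_assoc]
  rw [hx]

/-- The vectors alone determine the family: the product starting at b has no component left of b and
exactly the monomial t^(-p) at b. -/
theorem pairSum_injective (f : Fin (n + 1) × ℕ →₀ TruncSpace Q a n h₀ M)
    (hf : (pairSum Q a n h₀ h₁ M f).2 = 0) : f = 0 := by
  have hsum : ∀ c l, (f.sum fun q w => strandVec a β j M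
      (ascProd (cross Q (n + 2)) q.1 (n - q.1 + 1) * x Q (Fin.last (n + 1)) ^ q.2) (w : M) (c, l)) =
        0 := by
    intro c l
    have := congrFun hf (c, l)
    let ev : (cornerHom Q a j n h₁).Tens (TruncSpace Q a n h₀ M) × (Fin (n + 2) × ℤ → M) →+ M :=
      (Pi.evalAddMonoidHom _ (c, l)).comp (AddMonoidHom.snd _ _)
    change ev (pairSum Q a n h₀ h₁ M f) = 0 at this
    rw [pairSum, Finsupp.liftAddHom_apply, Finsupp.sum, map_sum] at this
    rw [Finsupp.sum, ← this]
    refine Finset.sum_congr rfl fun q _ => ?_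
    rw [← strandVec_ascProd Q a n h₀ hij _ _ (by omega)]
    rfl
  have key : ∀ (c : ℕ) (hc : c < n + 1) (p : ℕ), f (⟨c, hc⟩, p) = 0 := by
    intro c
    induction c using Nat.strong_induction_on with
    | _ c ih =>
      intro hc p
      -- In this coefficient the terms with b < c vanish by induction, those with b > c do not reach
      -- position c, and among those with b = c only the exponent p contributes. What is left is f
      -- (c, p).
      have h := hsum ⟨c, by omega⟩ (-(p : ℤ))
      rw [Finsupp.sum, Finset.sum_eq_single (⟨c, hc⟩, p)] at h
      · rw [strandVec_apply, strandCoeff_ascProd Q (n + 1) j (-(p : ℤ)) (a := c) (d := n - c + 1)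
          (by omega) p, if_pos rfl, map_one, one_smul] at h
        exact Subtype.ext h
      · rintro ⟨⟨b, hb⟩, p'⟩ _ hne
        rcases lt_trichotomy b c with hbc | rfl | hbc
        · rw [ih b hbc hb p']
          exact map_zero _ |> fun h => congrFun h _
        · rw [strandVec_apply, strandCoeff_ascProd Q (n + 1) j (-(p : ℤ)) (a := b) (d := n - b + 1)
            (by omega) p', if_neg, map_zero, zero_smul]
          intro h'
          apply hne
          have : p' = p := by omega
          rw [this]
        · rw [strandVec_apply, strandCoeff_ascProd_of_lt Q (n + 1) j _ _ (by dsimp only; omega)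
            hbc, map_zero, zero_smul]
      · intro hn
        rw [Finsupp.notMem_support_iff.1 hn]
        exact map_zero _ |> fun h => congrFun h _
  ext q
  obtain ⟨⟨c, hc⟩, p⟩ := q
  rw [key c hc p]
  rfl

/-- So `pairGroup` is the graph of a homomorphism from vectors to tensors: strand coefficients
determine the tensor, although the tensor does not determine the coefficients. -/
theorem eq_zero_of_mem_pairGroup {y : (cornerHom Q a j n h₁).Tens (TruncSpace Q a n h₀ M)}
    (hy : (y, 0) ∈ pairGroup Q a n h₀ h₁ M) : y = 0 := by
  obtain ⟨f, hf⟩ := pairGroup_le Q a n h₀ h₁ M hy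
  have := pairSum_injective Q a n h₀ h₁ hij f (by rw [hf])
  rw [this, map_zero] at hf
  exact (congrArg Prod.fst hf).symm

omit hij in
/-- The subgroup by which the strand coefficients of `F_j M` are ambiguous. -/
noncomputable def ambiguity (β : P) (i j : I) (M : Type*) [AddCommGroup M]
    [Module (CycKLR Q a (n + 1) β) M] : AddSubgroup (Fin (n + 2) × ℤ → M) :=
  AddSubgroup.closure {v | ∃ (r : KLR Q (n + 2)) (p : ℕ) (m : M), v = strandVec a β j M
    (eLast Q i * r * cyc Q a 0 * ascProd (cross Q (n + 2)) 0 (n + 1) *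
      x Q (Fin.last (n + 1)) ^ p) m}

/-- The ambiguity created by the cyclotomic relation in F_j M is already accounted for by the
cyclotomic relation in F_j E_i M: each generator is the vector of a tensor s ⊗ w with s in the
cyclotomic ideal, or it is zero. -/
theorem mem_pairGroup_of_mem_ambiguity {v : Fin (n + 2) × ℤ → M}
    (hv : v ∈ ambiguity Q a n β i j M) : (0, v) ∈ pairGroup Q a n h₀ h₁ M := by
  have hzero : ∀ (s : KLR Q (n + 1)) (p p' : ℕ) (m : M), ((0 : (cornerHom Q a j n h₁).Tens
      (TruncSpace Q a n h₀ M)), strandVec a β j M (x Q (Fin.last (n + 1)) ^ p *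
        KLR.incl Q (n + 1) s * eLast Q i * cyc Q a 0 * ascProd (cross Q (n + 2)) 0 (n + 1) *
          x Q (Fin.last (n + 1)) ^ p') m) ∈ pairGroup Q a n h₀ h₁ M := by
    intro s p p' m
    set T := ascProd (cross Q (n + 1)) 0 n
    have hT : ascProd (cross Q (n + 2)) 0 (n + 1) = KLR.incl Q (n + 1) T * τLast Q n :=
      ascProd_eq Q (Nat.zero_add n)
    -- A is the part that comes from R(n + 1). It contains x[1], so its tensor with any w is zero.
    -- The dots of exponent p' come from the right of τ_n, while those of exponent p slide from the
    -- left of τ_n to its right and act on m.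
    set A := KLR.incl Q (n + 1) (s * cyc Q a 0 * T * x Q (Fin.last n) ^ p') with hA
    have e1 : eLast Q i * (cyc Q a 0 * (KLR.incl Q (n + 1) T * τLast Q n)) =
        cyc Q a 0 * (KLR.incl Q (n + 1) T * (τLast Q n * KLR.incl Q (n + 1) (eLast Q i))) := by
      rw [← mul_assoc, (eAt_mul_cyc Q a _ _ i).eq, mul_assoc, incl_eLast_comm_τLast_mul, mul_assoc]
    have e2 : x Q (Fin.last (n + 1)) ^ p * KLR.incl Q (n + 1) s * eLast Q i * cyc Q a 0 *
        ascProd (cross Q (n + 2)) 0 (n + 1) * x Q (Fin.last (n + 1)) ^ p' * eLast Q j =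
        A * (x Q (Fin.last (n + 1)) ^ p *
          (τLast Q n * (KLR.incl Q (n + 1) (eLast Q i) * eLast Q j))) := by
      rw [← mul_assoc A, hA, incl_comm_x_pow, hT, mul_assoc _ (cyc Q a 0), mul_assoc _ (eLast Q i),
        e1, map_mul, map_mul, map_mul, incl_cyc_zero]
      have e3 := incl_comm_x_pow Q (eLast (n := n) Q i) p'
      have e4 := incl_x_pow_mul_τLast Q (n := n) hij p'
      simp only [mul_assoc]
      rw [e4, ← mul_assoc (KLR.incl Q (n + 1) (eLast Q i)), e3, mul_assoc]
    have e5 : A * τLast Q n * KLR.incl Q (n + 1) (eLast Q i * x Q (Fin.last n) ^ p) * eLast Q j =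
        A * (x Q (Fin.last (n + 1)) ^ p *
          (τLast Q n * (KLR.incl Q (n + 1) (eLast Q i) * eLast Q j))) := by
      rw [x_last_pow_mul_τLast Q hij, ← x_pow_comm_eAt, map_mul]
      simp only [mul_assoc]
    rw [← strandVec_mul_eLast, e2, ← e5, strandVec_mul_eLast, strandVec_mul_incl, map_mul (proj Q a (n + 1) β), mul_smul]
    refine AddSubgroup.subset_closure
      ⟨s * cyc Q a 0 * T * x Q (Fin.last n) ^ p', truncate Q a n h₀ (proj Q a (n + 1) β (x Q (Fin.last n) ^ p) • m), ?_⟩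
    rw [pairHom_apply, coe_truncate, mul_assoc _ T, ten_mul_cyc, ← mul_assoc _ T]
  have hadd : ∀ v v', ((0 : (cornerHom Q a j n h₁).Tens (TruncSpace Q a n h₀ M)), v) ∈
      pairGroup Q a n h₀ h₁ M → (0, v') ∈ pairGroup Q a n h₀ h₁ M →
        (0, v + v') ∈ pairGroup Q a n h₀ h₁ M := fun v v' h h' => by
    have := add_mem h h'
    rwa [Prod.mk_add_mk, add_zero] at this
  have hneg : ∀ v, ((0 : (cornerHom Q a j n h₁).Tens (TruncSpace Q a n h₀ M)), v) ∈
      pairGroup Q a n h₀ h₁ M → (0, -v) ∈ pairGroup Q a n h₀ h₁ M := fun v h => by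
    have := neg_mem h
    rwa [Prod.neg_mk, neg_zero] at this
  have hker : ∀ (r : KLR Q (n + 2)) (p : ℕ) (m : M), ((0 : (cornerHom Q a j n h₁).Tens
      (TruncSpace Q a n h₀ M)), strandVec a β j M (eLast Q i * r * cyc Q a 0 *
        ascProd (cross Q (n + 2)) 0 (n + 1) * x Q (Fin.last (n + 1)) ^ p) m) ∈
          pairGroup Q a n h₀ h₁ M := by
    intro r p m
    let f : KLR Q (n + 2) →+ (cornerHom Q a j n h₁).Tens (TruncSpace Q a n h₀ M) ×
        (Fin (n + 2) × ℤ → M) :=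
      AddMonoidHom.mk' (fun r => (0, strandVec a β j M (r * cyc Q a 0 *
        ascProd (cross Q (n + 2)) 0 (n + 1) * x Q (Fin.last (n + 1)) ^ p) m)) fun r r' => by
          rw [Prod.mk_add_mk, add_zero, add_mul, add_mul, add_mul, map_add, AddMonoidHom.add_apply]
    have hf : ∀ r, f r = (0, strandVec a β j M (r * cyc Q a 0 *
        ascProd (cross Q (n + 2)) 0 (n + 1) * x Q (Fin.last (n + 1)) ^ p) m) := fun _ => rfl
    rw [← hf]
    refine AddSubgroup.closure_induction (p := fun r _ => f (eLast Q i * r) ∈ _)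
      ?_ ?_ ?_ ?_ ((isCrossing Q (n + 1)).exists_descProd (closure_eq_top Q (n + 1)) r)
    · rintro _ ⟨b, d, c, hc, hd, rfl⟩
      -- e_i passes c, and c e_i is a sum of terms x_{n+1}^q s e_i with s in R(n + 1).
      rw [← mul_assoc, ← (parabolic_comm_eLast Q hc i).eq]
      refine AddSubgroup.closure_induction (p := fun y _ => f (y * _) ∈ _)
        ?_ ?_ ?_ ?_ (parabolic_mul_eLast hc i)
      · rintro _ ⟨q, s, rfl⟩
        rw [hf]
        rcases Nat.eq_zero_or_pos b with rfl | hb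
        -- For b = 0 the letter i goes from the last strand to the first along τ_n ⋯ τ_0, past x[1],
        -- and back to the last along τ_0 ⋯ τ_n. There e_i on the right gives zero, since the extra
        -- strand has colour j ≠ i.
        · obtain rfl : d = n + 1 := by omega
          have e1 := eAt_mul_descProd Q (n := n + 2) i (n + 1) 0 (by omega)
          have e2 := eAt_mul_ascProd Q (n := n + 2) i (n + 1) 0 (by omega)
          have hl : (pos (0 + (n + 1)) (by omega) : Fin (n + 2)) = Fin.last (n + 1) :=
            Fin.ext (Nat.zero_add _)
          rw [hl] at e1 e2
          have e3 : x Q (Fin.last (n + 1)) ^ q * KLR.incl Q (n + 1) s * eLast Q i *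
              descProd (cross Q (n + 2)) 0 (n + 1) * cyc Q a 0 *
                ascProd (cross Q (n + 2)) 0 (n + 1) * x Q (Fin.last (n + 1)) ^ p =
              x Q (Fin.last (n + 1)) ^ q * KLR.incl Q (n + 1) s *
              descProd (cross Q (n + 2)) 0 (n + 1) * cyc Q a 0 *
                ascProd (cross Q (n + 2)) 0 (n + 1) * x Q (Fin.last (n + 1)) ^ p * eLast Q i := by
            rw [mul_assoc _ (eLast Q i), e1, mul_assoc _ _ (eLast Q i), x_pow_comm_eAt,
              ← mul_assoc _ (eLast Q i), mul_assoc _ _ (eLast Q i), ← e2, ← mul_assoc _ (eAt Q _ i),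
              mul_assoc _ (cyc Q a 0) (eAt Q _ i), ← (eAt_mul_cyc Q a _ _ i).eq]
            simp only [mul_assoc]
          rw [e3, strandVec_mul_eLast_of_ne a β j hij]
          exact zero_mem _
        -- For b > 0 the descending product is absorbed by m, which reduces the claim to `hzero`.
        · obtain ⟨m', hm'⟩ := strandVec_mul_descProd a β j d b hb hd
            (x Q (Fin.last (n + 1)) ^ q * KLR.incl Q (n + 1) s * eLast Q i) p m
          rw [hm']
          exact hzero s q p m'
      · rw [zero_mul, map_zero]; exact zero_mem _
      · intro x y _ _ hx hy; rw [add_mul, map_add]; exact add_mem hx hy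
      · intro x _ hx; rw [neg_mul, map_neg]; exact neg_mem hx
    · rw [mul_zero, map_zero]; exact zero_mem _
    · intro x y _ _ hx hy; rw [mul_add, map_add]; exact add_mem hx hy
    · intro x _ hx; rw [mul_neg, map_neg]; exact neg_mem hx
  refine AddSubgroup.closure_induction (p := fun v _ => (0, v) ∈ pairGroup Q a n h₀ h₁ M)
    ?_ (zero_mem _) (fun v v' _ _ => hadd v v') (fun v _ => hneg v) hv
  rintro _ ⟨r, p, m, rfl⟩
  exact hker r p m

end Injective

end CycKLR

namespace CycKLR

open KLR

section SwapInjective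

variable (Q : KLRDatum C 𝓀) {Λ : P} (a : CyclotomicDatum C 𝓀 Λ) (n : ℕ) {β₀ β β' γ : P} {i j : I}
  (h₀ : β₀ + C.α i = β) (h₁ : β₀ + C.α j = β') (h₂ : β + C.α j = γ)
  (M : Type*) [AddCommGroup M] [Module (CycKLR Q a (n + 1) β) M]

/-- Expand the factor s to the right of x[1] in products τ_b ⋯ τ_n c. Those with b > 0 contribute
zero, and those with b = 0 give the generators of `ambiguity`. So nothing more has to be divided out
for the coordinates of e_i r to descend to F_j M. -/
theorem exists_strandVec_quotient : ∃ Ψ : (cornerHom Q a j (n + 1) h₂).Tens M →+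
    (Fin (n + 2) × ℤ → M) ⧸ ambiguity Q a n β i j M, ∀ r m,
      Ψ (ten a h₂ r m) = QuotientAddGroup.mk (strandVec a β j M (eLast Q i * r) m) := by
  let f : KLR Q (n + 2) →+ M →+ (Fin (n + 2) × ℤ → M) ⧸ ambiguity Q a n β i j M :=
    AddMonoidHom.mk' (fun r => (QuotientAddGroup.mk' _).comp (strandVec a β j M (eLast Q i * r)))
      fun r s => by rw [mul_add, map_add, AddMonoidHom.comp_add]
  have hf : ∀ r m, f r m = QuotientAddGroup.mk (strandVec a β j M (eLast Q i * r) m) :=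
    fun _ _ => rfl
  obtain ⟨Ψ, hΨ⟩ := exists_lift a h₂ f (fun r b m => by
      rw [hf, hf, ← mul_assoc, strandVec_mul_incl])
    (fun r s m => by
      rw [hf, QuotientAddGroup.eq_zero_iff, ← mul_assoc, ← mul_assoc]
      refine AddSubgroup.closure_induction (p := fun s _ => strandVec a β j M
        (eLast Q i * r * cyc Q a 0 * s) m ∈ ambiguity Q a n β i j M) ?_ ?_ ?_ ?_
        ((isCrossing Q (n + 1)).mem_filtration (closure_eq_top Q (n + 1)) s)
      · rintro _ ⟨b, d, c, hc, -, hd, rfl⟩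
        rcases Nat.eq_zero_or_pos b with rfl | hb
        · obtain rfl : d = n + 1 := by omega
          rw [← mul_assoc]
          refine apply_mul_parabolic_mem β j (strandVec a β j M) (strandVec_mul_incl a β j)
            (strandVec_mul_eLast a β j) hc _ _ m fun p b' => ?_
          exact AddSubgroup.subset_closure ⟨r, p, _, rfl⟩
        · rw [strandVec_mul_cyc_mul a β j (AddSubgroup.subset_closure ⟨b, d, c, hc, hb, hd, rfl⟩)]
          exact zero_mem _
      · rw [mul_zero, map_zero]; exact zero_mem _
      · intro x y _ _ hx hy; rw [mul_add, map_add]; exact add_mem hx hy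
      · intro x _ hx; rw [mul_neg, map_neg]; exact neg_mem hx)
    (fun r m => by rw [hf, hf, ← mul_assoc, strandVec_mul_eLast])
  exact ⟨Ψ, hΨ⟩

variable (hij : i ≠ j)
include hij

/-- Choose a vector v paired with y. If y maps to zero, v lies in the ambiguity, hence it is also
paired with 0. By subtraction y is paired with the zero vector, and y = 0 by triangularity. -/
theorem swapMap_injective : Function.Injective (swapMap Q a n h₀ h₁ h₂ M) := by
  rw [injective_iff_map_eq_zero]
  intro y hy
  obtain ⟨Ψ, hΨ⟩ := exists_strandVec_quotient Q a n h₂ M (i := i)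
  have hex : ∃ v, (y, v) ∈ pairGroup Q a n h₀ h₁ M := by
    refine AddSubgroup.closure_induction (p := fun y _ => ∃ v, (y, v) ∈ pairGroup Q a n h₀ h₁ M)
      ?_ ⟨0, zero_mem _⟩ ?_ ?_ (mem_closure_ten a h₁ y)
    · rintro _ ⟨s, w, rfl⟩
      exact ⟨_, AddSubgroup.subset_closure ⟨s, w, rfl⟩⟩
    · rintro _ _ _ _ ⟨v, hv⟩ ⟨v', hv'⟩
      exact ⟨_, add_mem hv hv'⟩
    · rintro _ _ ⟨v, hv⟩
      exact ⟨_, neg_mem hv⟩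
  obtain ⟨v, hv⟩ := hex
  have hΨv : Ψ (swapMap Q a n h₀ h₁ h₂ M y) = QuotientAddGroup.mk v := by
    refine AddSubgroup.closure_induction (p := fun g _ =>
      Ψ (swapMap Q a n h₀ h₁ h₂ M g.1) = QuotientAddGroup.mk g.2) ?_ ?_ ?_ ?_ hv
    · rintro _ ⟨s, w, rfl⟩
      rw [pairHom_apply]
      dsimp only
      rw [swapMap_ten, hΨ, incl_eLast_comm_τLast_mul, strandVec_mul_incl, eLast_smul_coe]
    · rw [Prod.fst_zero, map_zero, map_zero]; rfl
    · intro x y _ _ hx hy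
      rw [Prod.fst_add, map_add, map_add, hx, hy]; rfl
    · intro x _ hx
      rw [Prod.fst_neg, map_neg, map_neg, hx]; rfl
  rw [hy, map_zero] at hΨv
  have hvU := (QuotientAddGroup.eq_zero_iff v).1 hΨv.symm
  have := sub_mem hv (mem_pairGroup_of_mem_ambiguity Q a n h₀ h₁ hij hvU)
  rw [Prod.mk_sub_mk, sub_zero, sub_self] at this
  exact eq_zero_of_mem_pairGroup Q a n h₀ h₁ hij this

end SwapInjective

end CycKLR

end KLRAlgebras

/-! ### Degrees, naturality and the isomorphism of functors -/

theorem gradingCoaction_map {M N : Type*} [AddCommGroup M] [AddCommGroup N]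
    {ℳ : ℤ → AddSubgroup M} {𝒩 : ℤ → AddSubgroup N} (h : DirectSum.IsInternal ℳ)
    (h' : DirectSum.IsInternal 𝒩) (f : M →+ N) (hf : ∀ d, ∀ m ∈ ℳ d, f m ∈ 𝒩 d) (m : M) (d : ℤ) :
    gradingCoaction h' (f m) d = f (gradingCoaction h m d) := by
  refine grading_induction (p := fun m => gradingCoaction h' (f m) d = f (gradingCoaction h m d)) h
    (fun e m hm => ?_) ?_ ?_ m
  · rw [gradingCoaction_of_mem h hm, gradingCoaction_of_mem h' (hf e m hm), Finsupp.single_apply,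
      Finsupp.single_apply]
    split_ifs <;> simp
  · simp
  · intro x y hx hy; simp [hx, hy]

namespace GrMod

variable {A : Type w} [Ring A] {𝒜 : ℤ → AddSubgroup A}

/-- A degree-preserving map commutes with taking homogeneous components, so if it is injective, the
components of m outside degree d vanish. Hence the inverse of a bijective morphism preserves
degrees. -/
theorem mem_gr_of_map_mem {M N : GrMod 𝒜} (f : M ⟶ N) (hf : Function.Injective f.lin) {d : ℤ}
    {m : M.carrier} (hm : f.lin m ∈ N.gr d) : m ∈ M.gr d := by
  have h : ∀ e, e ≠ d → gradingCoaction M.internal m e = 0 := fun e he => by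
    apply hf
    rw [map_zero]
    refine (gradingCoaction_map M.internal N.internal f.lin.toAddMonoidHom f.map_mem m e).symm.trans
      ?_
    change gradingCoaction N.internal (f.lin m) e = 0
    rw [gradingCoaction_of_mem _ hm, Finsupp.single_eq_of_ne he]
  rw [← coaction_sum M.internal m]
  refine sum_mem fun e _ => ?_
  rcases eq_or_ne e d with rfl | he
  · exact coaction_mem M.internal m e
  · dsimp only
    rw [h e he]
    exact zero_mem _

/-- A bijective morphism of graded modules is an isomorphism. -/
noncomputable def isoOfBijective {M N : GrMod 𝒜} (f : M ⟶ N) (hf : Function.Bijective f.lin) :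
    M ≅ N where
  hom := f
  inv :=
    { lin := (LinearEquiv.ofBijective f.lin hf).symm
      map_mem := fun d m hm => mem_gr_of_map_mem f hf.1 (by
        change LinearEquiv.ofBijective f.lin hf ((LinearEquiv.ofBijective f.lin hf).symm m) ∈ _
        rwa [LinearEquiv.apply_symm_apply]) }
  hom_inv_id := hom_ext fun m => (LinearEquiv.ofBijective f.lin hf).symm_apply_apply m
  inv_hom_id := hom_ext fun m => (LinearEquiv.ofBijective f.lin hf).apply_symm_apply m

end GrMod

section KLRAlgebras

variable {I : Type v} [Fintype I] [DecidableEq I] {P : Type*} [AddCommGroup P]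
    [Module.Free ℤ P] [Module.Finite ℤ P]
variable {C : CartanDatum I P} {k : Type u} [CommRing k] {𝓀 : ℤ → AddSubgroup k}

namespace CycKLR

open KLR

section SwapIso

variable (Q : KLRDatum C 𝓀) {Λ : P} (a : CyclotomicDatum C 𝓀 Λ) (n : ℕ) {β₀ β β' γ : P} {i j : I}
  (h₀ : β₀ + C.α i = β) (h₁ : β₀ + C.α j = β') (h₂ : β + C.α j = γ) (h₃ : β' + C.α i = γ)

/-- The relevant words end in i, j, so on each of them τ_n has degree -(α_i|α_j). -/
theorem τLast_homog (i j : I) : IsHomog Q (-C.form i j)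
    (τLast Q n * (KLR.incl Q (n + 1) (eLast Q i) * eLast Q j)) := by
  rw [← mul_one (τLast Q n * _), ← sum_e, Finset.mul_sum]
  refine .sum Q fun ν _ => ?_
  rw [mul_assoc, mul_assoc, eAt_mul_e, incl_eAt]
  split_ifs with hj
  · rw [eAt_mul_e]
    split_ifs with hi
    · have h := IsHomog.τ (Q := Q) n (Nat.lt_succ_self (n + 1)) ν
      rwa [show ν (pos n _) = i from hi, show ν (pos (n + 1) _) = j from hj] at h
    · rw [mul_zero]; exact .zero _
  · rw [mul_zero, mul_zero]; exact .zero _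

variable {Q n} in
theorem proj_mem_gr {d : ℤ} {r : KLR Q n} (hr : IsHomog Q d r) (β : P) :
    proj Q a n β r ∈ gr Q a n β d := by
  refine ⟨KLRβ.proj Q β r, ?_, rfl⟩
  have := IsHomog.mul (.mul (eSum_homog Q (words C n β)) hr) (eSum_homog Q (words C n β))
  rwa [zero_add, add_zero] at this

variable {Q n} in
theorem exists_homog_of_mem_gr {d : ℤ} {y : CycKLR Q a n β} (hy : y ∈ gr Q a n β d) :
    ∃ r, IsHomog Q d r ∧ proj Q a n β r = y := by
  obtain ⟨z, hz, rfl⟩ := hy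
  exact ⟨KLRβ.val Q z, hz, by rw [proj_apply, KLRβ.proj_val]; rfl⟩

theorem swapMap_mem (M : Type*) [AddCommGroup M] [Module (CycKLR Q a (n + 1) β) M]
    (z : (cornerHom Q a j n h₁).Tens (TruncSpace Q a n h₀ M)) : swapMap Q a n h₀ h₁ h₂ M z ∈
      (cornerHom Q a i (n + 1) h₃).truncSubgroup ((cornerHom Q a j (n + 1) h₂).Tens M) := by
  rw [GrMod.CornerHom.mem_truncSubgroup, cornerHom_idem, idem_smul_swapMap]

theorem swapMap_smul_eq (M : Type*) [AddCommGroup M] [Module (CycKLR Q a (n + 1) β) M]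
    (c : CycKLR Q a (n + 1) β') (z : (cornerHom Q a j n h₁).Tens (TruncSpace Q a n h₀ M)) :
    swapMap Q a n h₀ h₁ h₂ M (c • z) =
      (cornerHom Q a i (n + 1) h₃).toHom c • swapMap Q a n h₀ h₁ h₂ M z := by
  obtain ⟨s, rfl⟩ := proj_surjective Q a (n + 1) β' c
  rw [cornerHom_proj, map_mul, mul_smul, idem_smul_swapMap, swapMap_smul]

/-- The map `F_j E_i M → E_i F_j M`, `s ⊗ w ↦ s τ_n ⊗ w`. -/
noncomputable def swapLin (M : Type*) [AddCommGroup M] [Module (CycKLR Q a (n + 1) β) M] :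
    (cornerHom Q a j n h₁).Tens (TruncSpace Q a n h₀ M) →ₗ[CycKLR Q a (n + 1) β']
      (cornerHom Q a i (n + 1) h₃).truncSubgroup ((cornerHom Q a j (n + 1) h₂).Tens M) :=
  { (swapMap Q a n h₀ h₁ h₂ M).codRestrict _ (swapMap_mem Q a n h₀ h₁ h₂ h₃ M) with
    map_smul' := fun c z => Subtype.ext (swapMap_smul_eq Q a n h₀ h₁ h₂ h₃ M c z) }

theorem swapLin_bijective (hij : i ≠ j) (M : Type*) [AddCommGroup M]
    [Module (CycKLR Q a (n + 1) β) M] :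
    Function.Bijective (swapLin Q a n h₀ h₁ h₂ h₃ M) := by
  refine ⟨fun y z h => swapMap_injective Q a n h₀ h₁ h₂ M hij (congrArg Subtype.val h), fun z => ?_⟩
  obtain ⟨y, hy⟩ := eLast_smul_mem_range_swapMap Q a n h₀ h₁ h₂ hij (z : (cornerHom Q a j _ h₂).Tens M)
  refine ⟨y, Subtype.ext (hy.trans ?_)⟩
  rw [← cornerHom_idem a h₃]
  exact z.2

theorem swapLin_tmk_mem {M : GrMod (gr Q a (n + 1) β)} {d e : ℤ}
    {y : (cornerHom Q a j n h₁).leftIdeal} (hy : y.1 ∈ gr Q a (n + 1) β' d)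
    {w : TruncSpace Q a n h₀ M.carrier} (hw : (w : M.carrier) ∈ M.gr e) :
    (swapLin Q a n h₀ h₁ h₂ h₃ M.carrier ((cornerHom Q a j n h₁).tmk y w)).1 ∈
      (cornerHom Q a j (n + 1) h₂).tensGr M.gr (d - C.form i j + e) := by
  obtain ⟨r, hr, hry⟩ := exists_homog_of_mem_gr a hy
  change swapMap Q a n h₀ h₁ h₂ M.carrier _ ∈ _
  -- w is replaced by e_i w so that e_i can be attached to τ_n: τ_n is homogeneous only on words
  -- with prescribed last two letters.
  rw [← projLeft_eq a h₁ hry, ← ten, swapMap_ten, ← eLast_smul_coe a h₀ w, ← ten_mul_incl]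
  refine AddSubgroup.subset_closure ⟨_, e, _, _, rfl, ?_, hw, rfl⟩
  rw [projLeft_val, mul_assoc, mul_assoc, sub_eq_add_neg]
  exact proj_mem_gr a (.mul (incl_homog Q hr) (τLast_homog Q n i j)) γ

/-- The comparison map changes only the left tensor factor and module maps change only the right
one, so they commute. -/
theorem swapMap_tensMap {M N : Type*} [AddCommGroup M] [Module (CycKLR Q a (n + 1) β) M]
    [AddCommGroup N] [Module (CycKLR Q a (n + 1) β) N]
    (g : TruncSpace Q a n h₀ M →ₗ[CycKLR Q a n β₀] TruncSpace Q a n h₀ N)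
    (f : M →ₗ[CycKLR Q a (n + 1) β] N) (hg : ∀ w, (g w : N) = f w)
    (z : (cornerHom Q a j n h₁).Tens (TruncSpace Q a n h₀ M)) :
    swapMap Q a n h₀ h₁ h₂ N ((cornerHom Q a j n h₁).tensMap g z) =
      (cornerHom Q a j (n + 1) h₂).tensMap f (swapMap Q a n h₀ h₁ h₂ M z) := by
  refine AddSubgroup.closure_induction (p := fun z _ =>
    swapMap Q a n h₀ h₁ h₂ N ((cornerHom Q a j n h₁).tensMap g z) =
      (cornerHom Q a j (n + 1) h₂).tensMap f (swapMap Q a n h₀ h₁ h₂ M z)) ?_ ?_ ?_ ?_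
    (mem_closure_ten a h₁ z)
  · rintro _ ⟨s, w, rfl⟩
    rw [swapMap_ten, ten, ten, GrMod.CornerHom.tensMap_tmk, GrMod.CornerHom.tensMap_tmk, ← ten,
      ← ten, swapMap_ten, hg]
  · simp only [map_zero]
  · intro x y _ _ hx hy; simp only [map_add, hx, hy]
  · intro x _ hx; simp only [map_neg, hx]

variable [GradedRing 𝓀]

/-- The morphism `q^{-(α_i | α_j)} F_j E_i M → E_i F_j M`, `s ⊗ w ↦ s τ_n ⊗ w`. -/
noncomputable def swapHom (M : GrMod (gr Q a (n + 1) β)) :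
    ((functorE Q a i n h₀ ⋙ functorF Q a j n h₁) ⋙ GrMod.shift _ (-C.form i j)).obj M ⟶
      (functorF Q a j (n + 1) h₂ ⋙ functorE Q a i (n + 1) h₃).obj M :=
  show GrMod.Hom _ _ from
  { lin := swapLin Q a n h₀ h₁ h₂ h₃ M.carrier
    map_mem := fun d z hz => by
      refine AddSubgroup.closure_induction (p := fun z _ =>
        (swapLin Q a n h₀ h₁ h₂ h₃ M.carrier z).1 ∈
          (cornerHom Q a j (n + 1) h₂).tensGr M.gr d) ?_ ?_ ?_ ?_ hz
      · rintro _ ⟨b, e, y, w, hd, hy, hw, rfl⟩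
        -- Degree d of the shifted module is degree d + (α_i|α_j) of F_j E_i M, which τ_n lowers to
        -- d.
        have hd' : b + e = d - -C.form i j := hd
        have h := swapLin_tmk_mem Q a n h₀ h₁ h₂ h₃ hy hw
        rwa [show b - C.form i j + e = d by omega] at h
      · rw [map_zero]; exact zero_mem _
      · intro x y _ _ hx hy; rw [map_add]; exact add_mem hx hy
      · intro x _ hx; rw [map_neg]; exact neg_mem hx }

/-- The isomorphism `q^{-(α_i | α_j)} F_j E_i ≅ E_i F_j`. -/
noncomputable def swapIso (hij : i ≠ j) :
    (functorE Q a i n h₀ ⋙ functorF Q a j n h₁) ⋙ GrMod.shift _ (-C.form i j) ≅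
      functorF Q a j (n + 1) h₂ ⋙ functorE Q a i (n + 1) h₃ :=
  NatIso.ofComponents
    (fun M => GrMod.isoOfBijective (swapHom Q a n h₀ h₁ h₂ h₃ M)
      (swapLin_bijective Q a n h₀ h₁ h₂ h₃ hij M.carrier)) fun {M N} f => by
    refine GrMod.hom_ext fun z => ?_
    exact Subtype.ext (swapMap_tensMap Q a n h₀ h₁ h₂ ((functorE Q a i n h₀).map f).lin f.lin
      (fun _ => rfl) z)

end SwapIso

end CycKLR

end KLRAlgebras

/-- The height of β ≠ 0 is written n + 1. If β - α_i is not in Q⁺, no word has this weight, R^Λ(β -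
α_i) is the zero ring, and the isomorphism says that both functors vanish. -/
theorem mainTheorem5 {I : Type v} [Fintype I] [DecidableEq I] {P : Type*} [AddCommGroup P]
    [Module.Free ℤ P] [Module.Finite ℤ P] (C : CartanDatum I P)
    {k : Type u} [CommRing k] (𝓀 : ℤ → AddSubgroup k) [GradedRing 𝓀] (h𝓀 : ∀ d < 0, 𝓀 d = ⊥)
    (Q : KLRDatum C 𝓀) (Λ : P) (hΛ : C.IsDominant Λ) (a : CyclotomicDatum C 𝓀 Λ)
    (i j : I) (hij : i ≠ j)
    (n : ℕ) (m : I → ℕ) (hm : ∑ l, m l = n + 1) (β : P) (hβ : β = ∑ l, m l • C.α l) :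
    Nonempty
      ((CycKLR.functorE Q a i n (sub_add_cancel β (C.α i)) ⋙
          CycKLR.functorF Q a j n (rfl : β - C.α i + C.α j = β - C.α i + C.α j)) ⋙
            GrMod.shift _ (-C.form i j) ≅
        CycKLR.functorF Q a j (n + 1) (rfl : β + C.α j = β + C.α j) ⋙
          CycKLR.functorE Q a i (n + 1)
            (show β - C.α i + C.α j + C.α i = β + C.α j by abel)) := by
  exact ⟨CycKLR.swapIso Q a n _ _ _ _ hij⟩
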